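/- Let $q,\xi\in[0,1)$. For a partition $\lambda=(\lambda_1\ge\lambda_2\ge\cdots\ge\lambda_\ell>0)$ write $\ell(\lambda)=\ell$ for its length, $|\lambda|=\sum_i\lambda_i$, $b(\lambda)=\sum_{i=1}^{\ell(\lambda)}(i-1)\lambda_i$, and, for a cell $(i,j)$ of its Young diagram, $h(i,j)=\lambda_i+\lambda^{\mathrm T}_j-i-j+1$ for the hook length, where $\lambda^{\mathrm T}$ is the transposed partition ($\lambda_1=0$ for the empty partition). Let $M(\xi;q)=\prod_{n\ge1}(1-\xi^2q^n)^{-n}$ be the modified MacMahon function. The squared type $q$-Plancherel measure on the set of all partitions is $$\mu[\lambda]=M(\xi;q)^{-1}(\xi^2q)^{|\lambda|}\,q^{2b(\lambda)}\prod_{(i,j)\in\lambda}\frac{1}{(1-q^{h(i,j)})^2}$$ (with $0^0=1$). With $(x;q)_\infty=\prod_{k\ge0}(1-xq^k)$ put $$\mathbb I(z;\xi)=\frac{1}{(\xi q^{1/2}z;q)_\infty(\xi q^{1/2}z^{-1};q)_\infty},\qquad \check{\mathbb I}(z;\xi)=(-\xi q^{1/2}z;q)_\infty(-\xi q^{1/2}z^{-1};q)_\infty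 ,$$ and, for integers $N\ge0$, $$Z_N=\int_{\mathrm U(N)}\det\mathbb I(U;\xi)\,dU,\qquad \check Z_N=\int_{\mathrm U(N)}\det\check{\mathbb I}(U;\xi)\,dU,$$ where $dU$ is the Haar probability measure on the unitary group $\mathrm U(N)$ and $\mathbb I(U;\xi)$, $\check{\mathbb I}(U;\xi)$ are defined by functional calculus. Then $\mu$ is a probability measure; the limits $Z_\infty=\lim_{N\to\infty}Z_N$ and $\check Z_\infty=\lim_{N\to\infty}\check Z_N$ exist and $Z_\infty=\check Z_\infty=M(\xi;q)$; and for every $N\ge0$ $$\mathbb P_\mu[\ell(\lambda)\le N]=\frac{Z_N}{Z_\infty},\qquad \mathbb P_\mu[\lambda_1\le N]=\frac{\check Z_N}{\check Z_\infty}.$$ Moreover, if $q>0$, then for all $z\in\mathbb C$ with $\xi q^{1/2}<|z|$ and $\xi q^{1/2}|z|<1$ (in particular on the unit circle) $$\mathbb I(z;\xi)=\exp\Big(-\sum_{n\ge1}\frac{\xi^n(z^n+z^{-n})}{n(q^{n/2}-q^{-n/2})}\Big),\qquad \check{\mathbb I}(z;\xi)=\exp\Big(\sum_{n\ge1}\frac{(-\xi)^n(z^n+z^{-n})}{n(q^{n/2}-q^{-n/2})}\Big),$$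 with convergent series. -/

import Mathlib

/-! ### Partitions and the squared type q-Plancherel measure

A partition is a `YoungDiagram`; rows and columns are indexed from `0`, so that `lam.rowLen i` is the
`(i+1)`-st part, `lam.colLen j` the `(j+1)`-st part of the transposed partition, `lam.rowLen 0` the
largest part, and `lam.colLen 0` the length. -/

/-- The largest part (`0` for the empty partition). -/
def largestPart (lam : YoungDiagram) : ℕ := lam.rowLen 0

/-- The number of non-zero parts. -/
def partLength (lam : YoungDiagram) : ℕ := lam.colLen 0

/-- `b(λ) = ∑_{i ≥ 1} (i - 1) λ_i`. -/
def bStat (lam : YoungDiagram) : ℕ := ∑ i ∈ Finset.range (partLength lam), i * lam.rowLen i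

/-- The hook length of the cell in row `c.1` and column `c.2` (indexed from `0`). For a cell of the
diagram the subtraction does not truncate. -/
def hookLen (lam : YoungDiagram) (c : ℕ × ℕ) : ℕ :=
  lam.rowLen c.1 + lam.colLen c.2 - c.1 - c.2 - 1

/-- The modified MacMahon function `M(ξ;q) = ∏_{n ≥ 1} (1 - ξ² qⁿ)⁻ⁿ`. -/
noncomputable def macMahon (ξ q : ℝ) : ℝ :=
  ∏' n : ℕ, 1 / (1 - ξ ^ 2 * q ^ (n + 1)) ^ (n + 1)

/-- The mass of `λ` under the squared type q-Plancherel measure. -/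
noncomputable def qPlancherelMass (ξ q : ℝ) (lam : YoungDiagram) : ℝ :=
  (macMahon ξ q)⁻¹ * (ξ ^ 2 * q) ^ lam.card * q ^ (2 * bStat lam) *
    ∏ c ∈ lam.cells, 1 / (1 - q ^ hookLen lam c) ^ 2

/-- All sets of partitions are measurable. -/
instance instMeasurableSpaceYoungDiagram : MeasurableSpace YoungDiagram := ⊤

/-- The squared type q-Plancherel measure on the set of all partitions. -/
noncomputable def qPlancherel (ξ q : ℝ) : MeasureTheory.Measure YoungDiagram :=
  MeasureTheory.Measure.sum fun lam =>
    ENNReal.ofReal (qPlancherelMass ξ q lam) • MeasureTheory.Measure.dirac lam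

/-! ### Weight functions -/

/-- `(x;q)_∞ = ∏_{k ≥ 0} (1 - x qᵏ)`. -/
noncomputable def qPochInf (x : ℂ) (q : ℝ) : ℂ := ∏' k : ℕ, (1 - x * (q : ℂ) ^ k)

/-- `𝕀(z;ξ) = (ξ q^{1/2} z, ξ q^{1/2} z⁻¹; q)_∞⁻¹`. -/
noncomputable def weight (ξ q : ℝ) (z : ℂ) : ℂ :=
  (qPochInf (ξ * √q * z) q * qPochInf (ξ * √q * z⁻¹) q)⁻¹

/-- `𝕀̌(z;ξ) = (-ξ q^{1/2} z, -ξ q^{1/2} z⁻¹; q)_∞`. -/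
noncomputable def weightCheck (ξ q : ℝ) (z : ℂ) : ℂ :=
  qPochInf (-(ξ * √q * z)) q * qPochInf (-(ξ * √q * z⁻¹)) q

/-- The term `a^n (z^n + z^{-n}) / (n (q^{n/2} - q^{-n/2}))` of the exponents in the exponential
formulas for the weights; it is used for `n ≥ 1`. -/
noncomputable def expTerm (a q : ℝ) (z : ℂ) (n : ℕ) : ℂ :=
  (a : ℂ) ^ n * (z ^ n + (z ^ n)⁻¹) / (n * ((√q : ℂ) ^ n - ((√q : ℂ) ^ n)⁻¹))

/-! ### Integrals over the unitary group -/

/-- The unitary group carries the topology of the space of matrices and its Borel sets. -/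
noncomputable instance instMeasurableSpaceUnitaryGroup (N : ℕ) :
    MeasurableSpace (Matrix.unitaryGroup (Fin N) ℂ) := borel _

instance instBorelSpaceUnitaryGroup (N : ℕ) : BorelSpace (Matrix.unitaryGroup (Fin N) ℂ) := ⟨rfl⟩

instance instCompactSpaceUnitaryGroup (N : ℕ) :
    CompactSpace (Matrix.unitaryGroup (Fin N) ℂ) := by
  have hclosed : IsClosed (Matrix.unitaryGroup (Fin N) ℂ : Set (Matrix (Fin N) (Fin N) ℂ)) := by
    have h : (Matrix.unitaryGroup (Fin N) ℂ : Set (Matrix (Fin N) (Fin N) ℂ)) =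
        {A | A * star A = 1} := by
      ext A
      exact Matrix.mem_unitaryGroup_iff
    rw [h]
    exact isClosed_eq (continuous_id.mul continuous_star) continuous_const
  have hK : IsCompact (Set.univ.pi fun _ : Fin N => Set.univ.pi fun _ : Fin N =>
      Metric.closedBall (0 : ℂ) 1) :=
    isCompact_univ_pi fun _ => isCompact_univ_pi fun _ => isCompact_closedBall 0 1
  refine isCompact_iff_compactSpace.mp (IsCompact.of_isClosed_subset hK hclosed ?_)
  intro A hA i _ j _
  simpa using entry_norm_bound_of_unitary hA i j

/-- The Haar measure on `U(N)`, normalized to total mass `1`. -/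
noncomputable def haarU (N : ℕ) : MeasureTheory.Measure (Matrix.unitaryGroup (Fin N) ℂ) :=
  MeasureTheory.Measure.haarMeasure ⊤

section MatrixFunctions

open scoped Matrix.Norms.L2Operator

/-- The matrix `f(A)`, for a normal matrix `A`, by the continuous functional calculus (the norm of
the matrix algebra being the operator norm): `f` acts on the eigenvalues of `A`. -/
noncomputable def matrixFun {N : ℕ} (f : ℂ → ℂ) (A : Matrix (Fin N) (Fin N) ℂ) :
    Matrix (Fin N) (Fin N) ℂ := cfc f A

end MatrixFunctions

/-- `Z_N = ∫_{U(N)} det 𝕀(U;ξ) dU`. -/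
noncomputable def Zint (ξ q : ℝ) (N : ℕ) : ℂ :=
  ∫ U : Matrix.unitaryGroup (Fin N) ℂ,
    (matrixFun (weight ξ q) (U : Matrix (Fin N) (Fin N) ℂ)).det ∂(haarU N)

/-- `Ž_N = ∫_{U(N)} det 𝕀̌(U;ξ) dU`. -/
noncomputable def ZintCheck (ξ q : ℝ) (N : ℕ) : ℂ :=
  ∫ U : Matrix.unitaryGroup (Fin N) ℂ,
    (matrixFun (weightCheck ξ q) (U : Matrix (Fin N) (Fin N) ℂ)).det ∂(haarU N)

/-!
The Haar average over `U(N)` of `(det U)⁻ᵐ ∏ₖ det (xₖ - U)`, with `n` points `xₖ`, follows from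
translation invariance alone. Invariance under the reflections `1 + s v v*`, averaged over finitely
many `v`, shows that the product of this average with the Vandermonde determinant of `x` is an
eigenvector of `∑ θₖ` and `∑ θₖ²`, where `θₖ = xₖ ∂/∂xₖ`. The eigenvalues force its exponents to be
the integers below `n + N` outside the gap `{m, …, m + N - 1}`, so it is an alternant, and
complementary minors turn it into a Toeplitz determinant.

For the weight `|∑ᵣ hᵣ zʳ|²` the Toeplitz determinant is that of `H Hᵀ` with `H = (h_{j-i})`, after
truncating the series and passing to the limit. By the Cauchy–Binet formula the unitary integral is
the sum, over partitions `λ` of length at most `N`, of the squared Jacobi–Trudi minors of `h`. For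
the two weights of the theorem Euler's expansions of `1 / (w;q)_∞` and `(w;q)_∞` make each minor a
Vandermonde determinant in powers of `q`. The hook formula identifies it, up to sign and a power of
`ξ q^{1/2}`, with `q^{b(λ)} ∏ (1 - q^h)⁻¹`, for `λ` in the first case and for its transpose in the
second.

The total mass comes from the Cauchy determinant with nodes `ξ q^{1/2} qⁱ`, `i < N`: Cauchy–Binet
expands it, after division by the squared Vandermonde determinant of the nodes, into the same sum
up to factors in `[0, 1]` that tend to `1`, while the quotient tends to the MacMahon product.
-/

section MatrixAlgebra

open Matrix Polynomial
open scoped ComplexOrder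

variable {n R : Type*} [Fintype n] [DecidableEq n] [CommRing R]

theorem det_add_vecMulVec_of_isUnit {A : Matrix n n R} (hA : IsUnit A.det) (u v : n → R) :
    (A + vecMulVec u v).det = A.det + v ⬝ᵥ A.adjugate *ᵥ u := by
  have hdet := det_add_replicateCol_mul_replicateRow (ι := Unit) hA u v
  rw [← vecMulVec_eq, det_unique (n := Unit)] at hdet
  have hentry : (1 + replicateRow Unit v * A⁻¹ * replicateCol Unit u : Matrix Unit Unit R)
      default default = 1 + v ⬝ᵥ A⁻¹ *ᵥ u := by
    simp [Matrix.mul_assoc, Matrix.mul_apply, dotProduct, mulVec]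
  have hadj : A.adjugate = A.det • A⁻¹ := by
    rw [inv_def, smul_smul, Ring.mul_inverse_cancel _ hA, one_smul]
  rw [hdet, hentry, hadj, smul_mulVec, dotProduct_smul, smul_eq_mul, mul_add, mul_one]

theorem map_det_add_vecMulVec {S : Type*} [CommRing S] (φ : R →+* S) (A : Matrix n n R)
    (u v : n → R) :
    φ (A + vecMulVec u v).det = (φ.mapMatrix A + vecMulVec (φ ∘ u) (φ ∘ v)).det := by
  rw [RingHom.map_det]
  congr 1
  ext i j
  simp [vecMulVec_apply]

theorem map_det_add_dotProduct_adjugate {S : Type*} [CommRing S] (φ : R →+* S) (A : Matrix n n R)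
    (u v : n → R) :
    φ (A.det + v ⬝ᵥ A.adjugate *ᵥ u) =
      (φ.mapMatrix A).det + (φ ∘ v) ⬝ᵥ (φ.mapMatrix A).adjugate *ᵥ (φ ∘ u) := by
  rw [map_add, RingHom.map_det, RingHom.map_dotProduct, ← RingHom.map_adjugate]
  congr 2
  exact funext fun i => RingHom.map_mulVec φ _ _ i

theorem charmatrix_map_eval (A : Matrix n n R) (x : R) :
    (evalRingHom x).mapMatrix (charmatrix A) = scalar n x - A := by
  ext i j
  by_cases hij : i = j
  · subst hij
    simp
  · simp [hij, charmatrix_apply_ne]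

theorem det_add_vecMulVec (A : Matrix n n R) (u v : n → R) :
    (A + vecMulVec u v).det = A.det + v ⬝ᵥ A.adjugate *ᵥ u := by
  -- The determinant of `X + A` is monic, hence a unit in an overring of `R[X]`; then set `X = 0`.
  set B : Matrix n n R[X] := charmatrix (-A)
  let φ : R[X] →+* Localization.Away B.det := algebraMap R[X] _
  have hφ : Function.Injective φ := IsLocalization.injective _ (M := Submonoid.powers B.det)
    (Submonoid.powers_le.2 (charpoly_monic (-A)).mem_nonZeroDivisors)
  have hunit : IsUnit (φ.mapMatrix B).det := by
    rw [← RingHom.map_det]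
    exact IsLocalization.Away.algebraMap_isUnit B.det
  have hgeneric : (B + vecMulVec (C ∘ u) (C ∘ v)).det =
      B.det + (C ∘ v) ⬝ᵥ B.adjugate *ᵥ (C ∘ u) :=
    hφ <| by rw [map_det_add_vecMulVec, map_det_add_dotProduct_adjugate,
      det_add_vecMulVec_of_isUnit hunit]
  have hB : (evalRingHom 0).mapMatrix B = A := by
    rw [charmatrix_map_eval, map_zero, zero_sub, neg_neg]
  have hC (w : n → R) : evalRingHom 0 ∘ (C ∘ w) = w := by
    ext i
    simp
  simpa only [map_det_add_vecMulVec, map_det_add_dotProduct_adjugate, hB, hC] using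
    congrArg (evalRingHom 0) hgeneric

theorem det_one_add_vecMulVec (u v : n → R) :
    (1 + vecMulVec u v : Matrix n n R).det = 1 + v ⬝ᵥ u := by
  simp [det_add_vecMulVec]

theorem adjugate_charmatrix_apply_self (A : Matrix n n R) (i : n) :
    (charmatrix A).adjugate i i = ∑ σ : Equiv.Perm n, Equiv.Perm.sign σ •
      ((∏ b ∈ Finset.univ.erase i, charmatrix A (σ b) b) *
        derivative (charmatrix A (σ i) i)) := by
  rw [← transpose_apply (adjugate _), adjugate_transpose, adjugate_apply, updateRow_transpose,
    det_transpose, det_apply]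
  refine Finset.sum_congr rfl fun σ _ => ?_
  rw [← Finset.prod_erase_mul _ _ (Finset.mem_univ i), updateCol_self]
  congr 2
  · exact Finset.prod_congr rfl fun b hb => by rw [updateCol_ne (Finset.ne_of_mem_erase hb)]
  · by_cases h : σ i = i <;> simp [h]

theorem derivative_charpoly_eq_trace_adjugate (A : Matrix n n R) :
    derivative A.charpoly = (charmatrix A).adjugate.trace := by
  simp only [trace, diag, adjugate_charmatrix_apply_self]
  rw [Finset.sum_comm, charpoly, det_apply, map_sum]
  refine Finset.sum_congr rfl fun σ _ => ?_
  rw [Units.smul_def, map_zsmul, derivative_prod_finset, Finset.smul_sum]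
  rfl

theorem eval_derivative_charpoly (A : Matrix n n R) (x : R) :
    (derivative A.charpoly).eval x = (scalar n x - A).adjugate.trace := by
  rw [derivative_charpoly_eq_trace_adjugate, ← charmatrix_map_eval, ← RingHom.map_adjugate]
  exact map_sum (evalRingHom x) _ _

/-- The numerator `A adj(x - A)` of the resolvent-type matrix `A (x - A)⁻¹`; unlike the quotient it
is polynomial in `x` and in the entries of `A`. -/
noncomputable def resolventNum (A : Matrix n n R) (x : R) : Matrix n n R :=
  A * (scalar n x - A).adjugate

theorem scalar_sub_mul_adjugate (A : Matrix n n R) (x : R) :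
    (scalar n x - A) * (scalar n x - A).adjugate = A.charpoly.eval x • 1 := by
  rw [mul_adjugate, eval_charpoly]

theorem adjugate_mul_scalar_sub (A : Matrix n n R) (x : R) :
    (scalar n x - A).adjugate * (scalar n x - A) = A.charpoly.eval x • 1 := by
  rw [adjugate_mul, eval_charpoly]

theorem resolventNum_eq (A : Matrix n n R) (x : R) :
    resolventNum A x = x • (scalar n x - A).adjugate - A.charpoly.eval x • 1 := by
  rw [← scalar_sub_mul_adjugate, resolventNum, Matrix.sub_mul, scalar_apply,
    ← smul_one_eq_diagonal, Matrix.smul_mul, Matrix.one_mul]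
  abel

theorem trace_resolventNum (A : Matrix n n R) (x : R) :
    (resolventNum A x).trace =
      x * (derivative A.charpoly).eval x - Fintype.card n * A.charpoly.eval x := by
  simp [resolventNum_eq, eval_derivative_charpoly, mul_comm]

theorem sub_smul_adjugate_mul_adjugate (A : Matrix n n R) (x y : R) :
    (x - y) • ((scalar n x - A).adjugate * (scalar n y - A).adjugate) =
      A.charpoly.eval x • (scalar n y - A).adjugate -
        A.charpoly.eval y • (scalar n x - A).adjugate := by
  have hsub : (x - y) • (1 : Matrix n n R) = (scalar n x - A) - (scalar n y - A) := by
    rw [sub_sub_sub_cancel_right, ← map_sub, scalar_apply, smul_one_eq_diagonal]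
  calc (x - y) • ((scalar n x - A).adjugate * (scalar n y - A).adjugate)
    _ = (scalar n x - A).adjugate * (((x - y) • (1 : Matrix n n R)) *
          (scalar n y - A).adjugate) := by
        rw [Matrix.smul_mul, Matrix.one_mul, Matrix.mul_smul]
    _ = (scalar n x - A).adjugate * (scalar n x - A) * (scalar n y - A).adjugate -
          (scalar n x - A).adjugate * ((scalar n y - A) * (scalar n y - A).adjugate) := by
        rw [hsub, Matrix.sub_mul, Matrix.mul_sub, Matrix.mul_assoc]
    _ = _ := by
        rw [adjugate_mul_scalar_sub, scalar_sub_mul_adjugate]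
        simp only [Matrix.smul_mul, Matrix.mul_smul, Matrix.one_mul, Matrix.mul_one]

theorem sub_smul_resolventNum_mul_resolventNum (A : Matrix n n R) (x y : R) :
    (x - y) • (resolventNum A x * resolventNum A y) =
      (y * A.charpoly.eval x) • resolventNum A y -
        (x * A.charpoly.eval y) • resolventNum A x := by
  have hadj : (x - y) • (resolventNum A x * (scalar n y - A).adjugate) =
      A.charpoly.eval x • resolventNum A y - A.charpoly.eval y • resolventNum A x := by
    rw [resolventNum, resolventNum, Matrix.mul_assoc, ← Matrix.mul_smul,
      sub_smul_adjugate_mul_adjugate, Matrix.mul_sub, Matrix.mul_smul, Matrix.mul_smul]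
  have hmul : resolventNum A x * resolventNum A y =
      y • (resolventNum A x * (scalar n y - A).adjugate) -
        A.charpoly.eval y • resolventNum A x := by
    rw [resolventNum_eq A y, Matrix.mul_sub, Matrix.mul_smul, Matrix.mul_smul, Matrix.mul_one]
  rw [hmul, smul_sub, smul_comm (x - y) y, hadj]
  module

theorem eval_charpoly_one_add_vecMulVec_mul (A : Matrix n n R) (u v : n → R) (x : R) :
    ((1 + vecMulVec u v) * A).charpoly.eval x =
      A.charpoly.eval x - v ⬝ᵥ resolventNum A x *ᵥ u := by
  have hsub : scalar n x - (1 + vecMulVec u v) * A =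
      (scalar n x - A) + vecMulVec (-u) (v ᵥ* A) := by
    rw [Matrix.add_mul, Matrix.one_mul, vecMulVec_mul, neg_vecMulVec]
    abel
  rw [eval_charpoly, eval_charpoly, hsub, det_add_vecMulVec, ← dotProduct_mulVec, mulVec_mulVec,
    mulVec_neg, dotProduct_neg, ← sub_eq_add_neg, resolventNum]

theorem one_add_smul_vecMulVec_mem_unitaryGroup {v : n → ℂ} {s : ℂ}
    (hs : ‖1 + s * (star v ⬝ᵥ v)‖ = 1) :
    1 + vecMulVec (s • v) (star v) ∈ unitaryGroup n ℂ := by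
  rcases eq_or_ne v 0 with rfl | hv
  · simp
  set c := star v ⬝ᵥ v with hc
  have hc_ne : c ≠ 0 := by rwa [Ne, dotProduct_star_self_eq_zero]
  have hc_star : star c = c := (star_dotProduct v v).symm
  have hadj : star (vecMulVec (s • v) (star v)) = star s • vecMulVec v (star v) := by
    rw [smul_vecMulVec, star_smul, star_eq_conjTranspose, conjTranspose_vecMulVec, star_star]
  have hsq : vecMulVec v (star v) * vecMulVec v (star v) = c • vecMulVec v (star v) := by
    rw [vecMulVec_mul_vecMulVec, ← hc, vecMulVec_smul]
  have hscalar : s + star s + s * star s * c = 0 := by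
    have hnorm : (1 + s * c) * star (1 + s * c) = 1 := by
      rw [Complex.star_def, Complex.mul_conj, Complex.normSq_eq_norm_sq, hs]
      simp
    rw [star_add, star_one, star_mul, hc_star] at hnorm
    exact mul_left_cancel₀ hc_ne (by linear_combination hnorm)
  rw [mem_unitaryGroup_iff, star_add, star_one, hadj, smul_vecMulVec, Matrix.add_mul,
    Matrix.one_mul, Matrix.mul_add, Matrix.mul_one, Matrix.smul_mul, Matrix.mul_smul, hsq]
  calc _ = 1 + (s + star s + s * star s * c) • vecMulVec v (star v) := by module
    _ = 1 := by rw [hscalar, zero_smul, add_zero]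

end MatrixAlgebra

section ProductCoefficients

open Polynomial Finset

variable {R ι : Type*} [CommRing R] [DecidableEq ι]

theorem coeff_one_prod_C_add_C_mul_X (s : Finset ι) (a b : ι → R) :
    (∏ k ∈ s, (C (a k) + C (b k) * X)).coeff 1 =
      ∑ k ∈ s, (∏ j ∈ s.erase k, a j) * b k := by
  have h := coeff_derivative (∏ k ∈ s, (C (a k) + C (b k) * X)) 0
  rw [coeff_zero_eq_eval_zero, derivative_prod_finset, eval_finsetSum] at h
  simpa [eval_prod] using h.symm

theorem two_mul_coeff_two_prod_C_add_C_mul_X (s : Finset ι) (a b : ι → R) :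
    2 * (∏ k ∈ s, (C (a k) + C (b k) * X)).coeff 2 =
      ∑ k ∈ s, ∑ l ∈ s.erase k, (∏ j ∈ (s.erase k).erase l, a j) * (b k * b l) := by
  have h := coeff_derivative (∏ k ∈ s, (C (a k) + C (b k) * X)) 1
  have hderiv (k : ι) : derivative (C (a k) + C (b k) * X) = C (b k) := by simp
  simp only [derivative_prod_finset, finsetSum_coeff, hderiv, coeff_mul_C,
    coeff_one_prod_C_add_C_mul_X, sum_mul] at h
  rw [mul_comm, show (2 : R) = (1 : ℕ) + 1 by norm_num, ← h]
  exact sum_congr rfl fun k _ => sum_congr rfl fun l _ => by ring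

end ProductCoefficients

section QuadraticForms

open Matrix

variable {n S : Type*} [Fintype n] [DecidableEq n] [CommRing S] [Algebra ℂ S]

/-- The Hermitian quadratic form `v* A v` of a matrix `A` with entries in a `ℂ`-algebra at a complex
vector `v`. -/
def quadForm (A : Matrix n n S) (v : n → ℂ) : S :=
  (algebraMap ℂ S ∘ star v) ⬝ᵥ (A *ᵥ (algebraMap ℂ S ∘ v))

theorem quadForm_single (A : Matrix n n S) (i : n) : quadForm A (Pi.single i 1) = A i i := by
  simp [quadForm, dotProduct, mulVec, Pi.single_apply, apply_ite (algebraMap ℂ S)]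

theorem trace_eq_sum_quadForm_single (A : Matrix n n S) :
    A.trace = ∑ i, quadForm A (Pi.single i 1) :=
  Finset.sum_congr rfl fun i _ => (quadForm_single A i).symm

theorem quadForm_single_add_single (A : Matrix n n S) (i j : n) (ω : ℂ) :
    quadForm A (Pi.single i 1 + Pi.single j ω) =
      A i i + algebraMap ℂ S (star ω * ω) * A j j +
        (algebraMap ℂ S ω * A i j + algebraMap ℂ S (star ω) * A j i) := by
  simp [quadForm, dotProduct, mulVec, Pi.single_apply, apply_ite (algebraMap ℂ S),
    add_mul, mul_add, Finset.sum_add_distrib]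
  ring

/-- The phases `1, I, -1, -I` average out every term in which the two cross terms are not
conjugate. -/
theorem sum_quadForm_phases (A B : Matrix n n S) (i j : n) :
    ∑ a : Fin 4, quadForm A (Pi.single i 1 + Pi.single j (Complex.I ^ (a : ℕ))) *
        quadForm B (Pi.single i 1 + Pi.single j (Complex.I ^ (a : ℕ))) =
      4 * ((A i i + A j j) * (B i i + B j j) + A i j * B j i + A j i * B i j) := by
  have hI : algebraMap ℂ S Complex.I ^ 2 = -1 := by
    rw [← map_pow, Complex.I_sq, map_neg, map_one]
  simp only [quadForm_single_add_single, Fin.sum_univ_four, Fin.val_zero, Fin.val_one, Fin.val_two,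
    show ((3 : Fin 4) : ℕ) = 3 from rfl, pow_zero, pow_one, Complex.I_sq, Complex.I_pow_three,
    Complex.star_def, Complex.conj_I, map_one, map_neg, neg_mul, mul_neg,
    neg_neg, one_mul, Complex.I_mul_I]
  linear_combination (-2) * (A i j - A j i) * (B j i - B i j) * hI

theorem quadForm_one (v : n → ℂ) :
    quadForm (1 : Matrix n n S) v = algebraMap ℂ S (star v ⬝ᵥ v) := by
  simp [quadForm, dotProduct]

variable {M M' : Type*} [AddCommGroup M] [Module ℂ M] [AddCommGroup M'] [Module ℂ M']

variable (n M) in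
/-- A finite quadrature rule with nodes `e i` and `e i + I ^ a • e j`, which integrates the product
of the Hermitian forms of `A` and `B` to the value `tr A * tr B + tr (A * B)` of its mean over
complex Gaussian vectors. -/
noncomputable def hermitianQuadrature : ((n → ℂ) → M) →ₗ[ℂ] M :=
  (8⁻¹ : ℂ) • ∑ i : n, ∑ j : n, ∑ a : Fin 4,
      LinearMap.proj (Pi.single i 1 + Pi.single j (Complex.I ^ (a : ℕ))) -
    (Fintype.card n : ℂ) • ∑ i : n, LinearMap.proj (Pi.single i 1)

theorem map_hermitianQuadrature (f : M →ₗ[ℂ] M') (φ : (n → ℂ) → M) :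
    f (hermitianQuadrature n M φ) = hermitianQuadrature n M' fun v => f (φ v) := by
  simp [hermitianQuadrature]

theorem hermitianQuadrature_quadForm_mul_quadForm (A B : Matrix n n S) :
    hermitianQuadrature n S (fun v => quadForm A v * quadForm B v) =
      A.trace * B.trace + (A * B).trace := by
  have htrace : A.trace * B.trace = ∑ i, ∑ j, A i i * B j j := Finset.sum_mul_sum _ _ _ _
  have htrace' : A.trace * B.trace = ∑ i, ∑ j, A j j * B i i := htrace.trans Finset.sum_comm
  have hmul : (A * B).trace = ∑ i, ∑ j, A i j * B j i := by simp [Matrix.trace, Matrix.mul_apply]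
  have hmul' : (A * B).trace = ∑ i, ∑ j, A j i * B i j := hmul.trans Finset.sum_comm
  have hexpand (i j : n) : (A i i + A j j) * (B i i + B j j) + A i j * B j i + A j i * B i j =
      A i i * B i i + A i i * B j j + A j j * B i i + A j j * B j j + A i j * B j i +
        A j i * B i j := by ring
  simp only [hermitianQuadrature, LinearMap.sub_apply, LinearMap.smul_apply, LinearMap.sum_apply,
    LinearMap.proj_apply, sum_quadForm_phases, quadForm_single, hexpand,
    ← Finset.mul_sum _ _ (4 : S), Finset.sum_add_distrib, ← htrace, ← htrace', ← hmul, ← hmul',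
    Finset.sum_const, Finset.card_univ]
  rw [← Finset.smul_sum, ← Nat.cast_smul_eq_nsmul ℂ, ← map_ofNat (algebraMap ℂ S) 4,
    ← Algebra.smul_def]
  module

end QuadraticForms

section ReflectionRelations

open Matrix Polynomial Finset

theorem map_coeff_of_infinite {K S : Type*} [CommRing K] [IsDomain K] [CommRing S] [Algebra K S]
    (L : S →ₗ[K] K) {P : S[X]} {p : K[X]}
    (h : {s : K | L (P.eval (algebraMap K S s)) = p.eval s}.Infinite) (i : ℕ) :
    L (P.coeff i) = p.coeff i := by
  set p' : K[X] := P.sum fun j a => monomial j (L a) with hp'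
  have hcoeff : p'.coeff i = L (P.coeff i) := by
    simp +contextual [hp', Polynomial.sum, finsetSum_coeff, coeff_monomial]
  have heval (s : K) : p'.eval s = L (P.eval (algebraMap K S s)) := by
    rw [hp', Polynomial.sum, eval_finsetSum, eval_eq_sum, Polynomial.sum, map_sum]
    refine sum_congr rfl fun j _ => ?_
    rw [eval_monomial, ← map_pow, mul_comm _ (algebraMap K S _), ← Algebra.smul_def, map_smul,
      smul_eq_mul, mul_comm]
  rw [← hcoeff, eq_of_infinite_eval_eq p' p (h.mono fun s hs => (heval s).trans hs)]

theorem infinite_setOf_norm_one_add_mul_eq_one (c : ℂ) : {s : ℂ | ‖1 + s * c‖ = 1}.Infinite := by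
  rcases eq_or_ne c 0 with rfl | hc
  · simpa using Set.infinite_univ
  have hmaps : Set.MapsTo (fun t : ℝ => (Complex.exp (t * Complex.I) - 1) / c) (Set.Icc 0 1)
      {s : ℂ | ‖1 + s * c‖ = 1} := fun t _ => by
    simp [div_mul_cancel₀ _ hc, Complex.norm_exp_ofReal_mul_I]
  refine Set.infinite_of_injOn_mapsTo (fun a ha b hb h => ?_) hmaps (Set.Icc_infinite zero_lt_one)
  have hexp : Complex.exp (a * Complex.I) = Complex.exp (b * Complex.I) := by
    simpa [div_left_inj' hc] using h
  have hcos : Real.cos a = Real.cos b := by simpa using congrArg Complex.re hexp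
  have hpi : (1 : ℝ) ≤ Real.pi := by linarith [Real.pi_gt_three]
  exact Real.injOn_cos ⟨ha.1, ha.2.trans hpi⟩ ⟨hb.1, hb.2.trans hpi⟩ hcos

variable {n ι K S : Type*} [Fintype n] [DecidableEq n] [Fintype ι]
  [CommRing K] [Algebra ℂ K] [CommRing S] [Algebra K S] [Algebra ℂ S]

/-- The functional `L` sees the products of characteristic polynomials of `A` at the points `x` as a
relative invariant of weight `det ^ m` under left multiplication of `A` by unitary matrices. -/
def IsUnitaryRelInvariant (L : S →ₗ[K] K) (A : Matrix n n S) (x : ι → S) (m : ℕ) : Prop :=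
  ∀ g ∈ unitaryGroup n ℂ, L (∏ k, (g.map (algebraMap ℂ S) * A).charpoly.eval (x k)) =
    algebraMap ℂ K (g.det ^ m) * L (∏ k, A.charpoly.eval (x k))

theorem IsUnitaryRelInvariant.map_prod_sub_mul_quadForm {L : S →ₗ[K] K} {A : Matrix n n S}
    {x : ι → S} {m : ℕ} (h : IsUnitaryRelInvariant L A x m) (v : n → ℂ) {s : ℂ}
    (hs : ‖1 + s * (star v ⬝ᵥ v)‖ = 1) :
    L (∏ k, (A.charpoly.eval (x k) - quadForm (resolventNum A (x k)) v * algebraMap ℂ S s)) =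
      algebraMap ℂ K (1 + s * (star v ⬝ᵥ v)) ^ m * L (∏ k, A.charpoly.eval (x k)) := by
  have hmap : (1 + vecMulVec (s • v) (star v)).map (algebraMap ℂ S) =
      1 + vecMulVec (algebraMap ℂ S s • (algebraMap ℂ S ∘ v)) (algebraMap ℂ S ∘ star v) := by
    ext i j
    simp [vecMulVec_apply, Matrix.one_apply, apply_ite (algebraMap ℂ S), Algebra.smul_def]
  have hg := h _ (one_add_smul_vecMulVec_mem_unitaryGroup hs)
  rw [hmap, det_one_add_vecMulVec, dotProduct_smul, smul_eq_mul, map_pow] at hg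
  rw [← hg]
  refine congrArg L (prod_congr rfl fun k _ => ?_)
  rw [eval_charpoly_one_add_vecMulVec_mul, mulVec_smul, dotProduct_smul, smul_eq_mul, mul_comm,
    quadForm]

variable [IsDomain K] [IsScalarTower ℂ K S]

theorem IsUnitaryRelInvariant.map_coeff_prod {L : S →ₗ[K] K} {A : Matrix n n S}
    {x : ι → S} {m : ℕ} (h : IsUnitaryRelInvariant L A x m) (v : n → ℂ) (i : ℕ) :
    L ((∏ k, (C (A.charpoly.eval (x k)) + C (-quadForm (resolventNum A (x k)) v) * X)).coeff i) =
      algebraMap ℂ K ((star v ⬝ᵥ v) ^ i * m.choose i) * L (∏ k, A.charpoly.eval (x k)) := by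
  have hinf := (infinite_setOf_norm_one_add_mul_eq_one (star v ⬝ᵥ v)).image
    (FaithfulSMul.algebraMap_injective ℂ K).injOn
  rw [map_coeff_of_infinite (p := ((1 + C (algebraMap ℂ K (star v ⬝ᵥ v)) * X) ^ m *
      C (L (∏ k, A.charpoly.eval (x k))))) L (hinf.mono ?_) i, coeff_mul_C]
  · have hbinom : ((1 + C (algebraMap ℂ K (star v ⬝ᵥ v)) * X) ^ m).coeff i =
        ((1 + X) ^ m : K[X]).coeff i * algebraMap ℂ K (star v ⬝ᵥ v) ^ i := by
      rw [← comp_C_mul_X_coeff]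
      simp
    rw [hbinom, coeff_one_add_X_pow, map_mul, map_pow, map_natCast]
    ring
  · rintro _ ⟨s, hs, rfl⟩
    have hpert := h.map_prod_sub_mul_quadForm v hs
    simp only [map_add, map_mul, map_one] at hpert
    simp only [Set.mem_ofPred_eq, eval_prod, eval_add, eval_mul, eval_pow, eval_C, eval_X, eval_one,
      neg_mul, ← sub_eq_add_neg, ← IsScalarTower.algebraMap_apply, hpert]
    rw [mul_comm (algebraMap ℂ K s)]

variable [DecidableEq ι]

theorem IsUnitaryRelInvariant.map_sum_quadForm {L : S →ₗ[K] K} {A : Matrix n n S}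
    {x : ι → S} {m : ℕ} (h : IsUnitaryRelInvariant L A x m) (v : n → ℂ) :
    L (∑ k, (∏ j ∈ univ.erase k, A.charpoly.eval (x j)) * quadForm (resolventNum A (x k)) v) =
      algebraMap ℂ K (-m * (star v ⬝ᵥ v)) * L (∏ k, A.charpoly.eval (x k)) := by
  have hcoeff := h.map_coeff_prod v 1
  rw [coeff_one_prod_C_add_C_mul_X] at hcoeff
  simp only [mul_neg, sum_neg_distrib, map_neg, pow_one, Nat.choose_one_right] at hcoeff
  rw [← neg_inj, hcoeff, ← neg_mul, ← map_neg]
  ring_nf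

theorem IsUnitaryRelInvariant.map_sum_quadForm_mul_quadForm {L : S →ₗ[K] K} {A : Matrix n n S}
    {x : ι → S} {m : ℕ} (h : IsUnitaryRelInvariant L A x m) (v : n → ℂ) :
    L (∑ k, ∑ l ∈ univ.erase k, (∏ j ∈ (univ.erase k).erase l, A.charpoly.eval (x j)) *
        (quadForm (resolventNum A (x k)) v * quadForm (resolventNum A (x l)) v)) =
      algebraMap ℂ K (m * (m - 1) * (star v ⬝ᵥ v) ^ 2) * L (∏ k, A.charpoly.eval (x k)) := by
  have hcoeff := congrArg (2 * ·) (h.map_coeff_prod v 2)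
  have htwo (a : S) : 2 * L a = L (2 * a) := by simp [two_mul]
  rw [htwo, two_mul_coeff_two_prod_C_add_C_mul_X] at hcoeff
  simp only [neg_mul_neg] at hcoeff
  rw [hcoeff, Nat.cast_choose_two, ← mul_assoc, ← map_ofNat (algebraMap ℂ K) 2, ← map_mul]
  ring_nf

end ReflectionRelations

section TraceRelations

open Matrix Polynomial Finset

variable {n ι K S : Type*} [Fintype n] [DecidableEq n] [Fintype ι] [DecidableEq ι]
  [CommRing K] [IsDomain K] [Algebra ℂ K] [CommRing S] [Algebra K S] [Algebra ℂ S]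
  [IsScalarTower ℂ K S] {L : S →ₗ[K] K} {A : Matrix n n S} {x : ι → S} {m : ℕ}

theorem IsUnitaryRelInvariant.map_sum_trace (h : IsUnitaryRelInvariant L A x m) :
    L (∑ k, (∏ j ∈ univ.erase k, A.charpoly.eval (x j)) * (resolventNum A (x k)).trace) =
      -(m * Fintype.card n) * L (∏ k, A.charpoly.eval (x k)) := by
  simp only [trace_eq_sum_quadForm_single, mul_sum]
  rw [sum_comm, map_sum]
  simp only [h.map_sum_quadForm, map_mul, map_neg, map_natCast, ← quadForm_one]
  rw [← sum_mul, ← mul_sum, ← trace_eq_sum_quadForm_single, trace_one, neg_mul]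

theorem IsUnitaryRelInvariant.map_sum_trace_mul_trace (h : IsUnitaryRelInvariant L A x m) :
    L (∑ k, ∑ l ∈ univ.erase k, (∏ j ∈ (univ.erase k).erase l, A.charpoly.eval (x j)) *
        ((resolventNum A (x k)).trace * (resolventNum A (x l)).trace +
          (resolventNum A (x k) * resolventNum A (x l)).trace)) =
      (m * (m - 1) * Fintype.card n * (Fintype.card n + 1)) *
        L (∏ k, A.charpoly.eval (x k)) := by
  set q : (n → ℂ) → S := fun v => ∑ k, ∑ l ∈ univ.erase k,
    (∏ j ∈ (univ.erase k).erase l, A.charpoly.eval (x j)) *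
      (quadForm (resolventNum A (x k)) v * quadForm (resolventNum A (x l)) v) with hq
  have hLq (v : n → ℂ) : L (q v) = m * (m - 1) * L (∏ k, A.charpoly.eval (x k)) *
      (quadForm (1 : Matrix n n K) v * quadForm (1 : Matrix n n K) v) := by
    rw [hq, h.map_sum_quadForm_mul_quadForm, quadForm_one]
    simp only [map_mul, map_sub, map_natCast, map_one, map_pow]
    ring
  have hquad (f : S) (B C : Matrix n n S) : f * (B.trace * C.trace + (B * C).trace) =
      hermitianQuadrature n S fun v => f * (quadForm B v * quadForm C v) := by
    rw [← hermitianQuadrature_quadForm_mul_quadForm]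
    exact map_hermitianQuadrature (LinearMap.mulLeft ℂ f) _
  calc _ = L (hermitianQuadrature n S q) := by
        simp only [hquad, ← map_sum]
        rw [hq]
        congr 2
        ext v
        simp only [Finset.sum_apply]
    _ = hermitianQuadrature n K fun v => L (q v) :=
      map_hermitianQuadrature (L.restrictScalars ℂ) q
    _ = m * (m - 1) * L (∏ k, A.charpoly.eval (x k)) *
        hermitianQuadrature n K
          fun v => quadForm (1 : Matrix n n K) v * quadForm (1 : Matrix n n K) v := by
      simp only [hLq]
      exact (map_hermitianQuadrature (LinearMap.mulLeft ℂ (m * (m - 1) * L _)) _).symm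
    _ = _ := by
      rw [hermitianQuadrature_quadForm_mul_quadForm, Matrix.mul_one, trace_one]
      ring

end TraceRelations

section EulerOperators

open MvPolynomial

variable {σ R : Type*} [CommRing R]

/-- The Euler operator `X k * ∂ / ∂ X k`. -/
noncomputable def eulerOp (k : σ) : Derivation R (MvPolynomial σ R) (MvPolynomial σ R) :=
  (X k : MvPolynomial σ R) • pderiv k

theorem coeff_eulerOp (k : σ) (p : MvPolynomial σ R) (α : σ →₀ ℕ) :
    coeff α (eulerOp k p) = α k * coeff α p := by
  classical
  induction p using MvPolynomial.induction_on' with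
  | monomial u a =>
    rw [eulerOp, Derivation.smul_apply, smul_eq_mul, X_mul_pderiv_monomial, coeff_smul,
      nsmul_eq_mul, coeff_monomial]
    split_ifs with h
    · rw [h]
    · simp
  | add p q hp hq => simp [hp, hq, mul_add]

theorem eulerOp_X_self (k : σ) : eulerOp k (X k : MvPolynomial σ R) = X k := by
  simp [eulerOp]

theorem eulerOp_X_of_ne {k j : σ} (h : j ≠ k) : eulerOp k (X j : MvPolynomial σ R) = 0 := by
  simp [eulerOp, pderiv_X_of_ne h]

theorem eulerOp_aeval_X_self (k : σ) (p : Polynomial R) :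
    eulerOp k (Polynomial.aeval (X k : MvPolynomial σ R) p) =
      X k * Polynomial.aeval (X k : MvPolynomial σ R) p.derivative := by
  rw [Derivation.map_aeval, eulerOp_X_self, smul_eq_mul, mul_comm]

theorem eulerOp_aeval_X_of_ne {k j : σ} (h : j ≠ k) (p : Polynomial R) :
    eulerOp k (Polynomial.aeval (X j : MvPolynomial σ R) p) = 0 := by
  rw [Derivation.map_aeval, eulerOp_X_of_ne h, smul_zero]

theorem eulerOp_prod_aeval_X_of_notMem {k : σ} {s : Finset σ} (hk : k ∉ s) (p : Polynomial R) :
    eulerOp k (∏ j ∈ s, Polynomial.aeval (X j : MvPolynomial σ R) p) = 0 := by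
  classical
  induction s using Finset.induction_on with
  | empty => simp
  | insert a s ha ih =>
    rw [Finset.mem_insert, not_or] at hk
    rw [Finset.prod_insert ha, Derivation.leibniz, ih hk.2,
      eulerOp_aeval_X_of_ne (Ne.symm hk.1), smul_zero, smul_zero, add_zero]

theorem eulerOp_prod_aeval_X [DecidableEq σ] {k : σ} {s : Finset σ} (hk : k ∈ s)
    (p : Polynomial R) :
    eulerOp k (∏ j ∈ s, Polynomial.aeval (X j : MvPolynomial σ R) p) =
      (∏ j ∈ s.erase k, Polynomial.aeval (X j : MvPolynomial σ R) p) *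
        (X k * Polynomial.aeval (X k : MvPolynomial σ R) p.derivative) := by
  rw [← Finset.prod_erase_mul _ _ hk, Derivation.leibniz,
    eulerOp_prod_aeval_X_of_notMem (Finset.notMem_erase k s), smul_zero, add_zero,
    eulerOp_aeval_X_self, smul_eq_mul]

end EulerOperators

section AlternantCoefficients

open MvPolynomial Matrix

variable {σ R : Type*} [Fintype σ] [CommRing R]

theorem prod_aeval_X_eq_sum_monomial [DecidableEq σ] (p : σ → Polynomial R) :
    ∏ k, Polynomial.aeval (X k : MvPolynomial σ R) (p k) =
      ∑ f ∈ Fintype.piFinset fun k => (p k).support,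
        monomial (Finsupp.equivFunOnFinite.symm f) (∏ k, (p k).coeff (f k)) := by
  have hterm (k : σ) : Polynomial.aeval (X k : MvPolynomial σ R) (p k) =
      ∑ i ∈ (p k).support, monomial (Finsupp.single k i) ((p k).coeff i) := by
    rw [Polynomial.aeval_def, Polynomial.eval₂_eq_sum, Polynomial.sum]
    exact Finset.sum_congr rfl fun i _ => by
      rw [algebraMap_eq, X_pow_eq_monomial, C_mul_monomial, mul_one]
  rw [Finset.prod_congr rfl fun k _ => hterm k, Finset.prod_univ_sum]
  refine Finset.sum_congr rfl fun f _ => ?_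
  have hexp : Finsupp.equivFunOnFinite.symm f = ∑ k, Finsupp.single k (f k) := by
    ext i
    simp [Finsupp.finsetSum_apply, Finsupp.single_apply]
  rw [hexp, monomial_sum_index, map_prod, ← Finset.prod_mul_distrib]
  exact Finset.prod_congr rfl fun k _ => by rw [C_mul_monomial, mul_one]

theorem coeff_prod_aeval_X (p : σ → Polynomial R) (α : σ →₀ ℕ) :
    coeff α (∏ k, Polynomial.aeval (X k : MvPolynomial σ R) (p k)) =
      ∏ k, (p k).coeff (α k) := by
  classical
  rw [prod_aeval_X_eq_sum_monomial, coeff_sum, Finset.sum_eq_single ⇑α]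
  · rw [Finsupp.equivFunOnFinite_symm_coe, coeff_monomial, if_pos rfl]
  · intro f _ hf
    rw [coeff_monomial, if_neg]
    rintro rfl
    exact hf rfl
  · intro hα
    obtain ⟨k, hk⟩ : ∃ k, (p k).coeff (α k) = 0 := by simpa [Fintype.mem_piFinset] using hα
    rw [Finset.prod_eq_zero (Finset.mem_univ k) hk, map_zero, coeff_zero]

theorem coeff_det_aeval_X [DecidableEq σ] (p : σ → Polynomial R) (α : σ →₀ ℕ) :
    coeff α (of fun k j => Polynomial.aeval (X k : MvPolynomial σ R) (p j)).det =
      (of fun k j => (p j).coeff (α k)).det := by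
  rw [← det_transpose, ← det_transpose (of fun k j => (p j).coeff (α k)), det_apply, det_apply,
    coeff_sum]
  refine Finset.sum_congr rfl fun τ _ => ?_
  simp only [transpose_apply, of_apply]
  rw [Units.smul_def, Units.smul_def, coeff_smul, coeff_prod_aeval_X]

end AlternantCoefficients

section OffDiagonalSums

variable {ι : Type*} [Fintype ι] [DecidableEq ι]

theorem sum_sum_erase_comm {M : Type*} [AddCommMonoid M] (f : ι → ι → M) :
    ∑ k, ∑ l ∈ Finset.univ.erase k, f k l = ∑ k, ∑ l ∈ Finset.univ.erase k, f l k :=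
  Finset.sum_comm' fun k l => by simp [eq_comm]

theorem sum_sum_erase_const {R : Type*} [CommRing R] (f : ι → R) :
    ∑ k, ∑ _l ∈ Finset.univ.erase k, f k = (Fintype.card ι - 1) * ∑ k, f k := by
  rw [Finset.mul_sum]
  refine Finset.sum_congr rfl fun k hk => ?_
  rw [Finset.sum_erase_eq_sub hk, Finset.sum_const, Finset.card_univ, nsmul_eq_mul, sub_mul,
    one_mul]

end OffDiagonalSums

section Vandermonde

open MvPolynomial Matrix

variable (n : ℕ) (R : Type*) [CommRing R]

/-- The Vandermonde determinant of the variables. -/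
noncomputable def vdmPoly : MvPolynomial (Fin n) R := (vandermonde X).det

theorem vdmPoly_ne_zero [IsDomain R] : vdmPoly n R ≠ 0 :=
  det_vandermonde_ne_zero_iff.2 X_injective

variable {n R}

theorem vdmPoly_mul_prod_aeval (p : Polynomial R) :
    vdmPoly n R * ∏ k, Polynomial.aeval (X k : MvPolynomial (Fin n) R) p =
      (of fun k j : Fin n =>
        Polynomial.aeval (X k : MvPolynomial (Fin n) R) (Polynomial.X ^ (j : ℕ) * p)).det := by
  rw [mul_comm, vdmPoly, ← det_mul_column]
  congr 1
  ext1 k j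
  simp [vandermonde_apply, mul_comm]

theorem exists_perm_of_coeff_vdmPoly_ne_zero {α : Fin n →₀ ℕ} (h : coeff α (vdmPoly n R) ≠ 0) :
    ∃ τ : Equiv.Perm (Fin n), ∀ k, α k = τ k := by
  have hdet := vdmPoly_mul_prod_aeval (n := n) (1 : Polynomial R)
  simp only [map_one, Finset.prod_const_one, mul_one] at hdet
  rw [hdet, coeff_det_aeval_X, ← det_transpose, det_apply] at h
  obtain ⟨τ, _, hτ⟩ := Finset.exists_ne_zero_of_sum_ne_zero h
  refine ⟨τ, fun k => ?_⟩
  contrapose! hτ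
  rw [Finset.prod_eq_zero (Finset.mem_univ k), smul_zero]
  simp [transpose_apply, Polynomial.coeff_X_pow, hτ]

theorem sum_eulerOp_vdmPoly :
    ∑ k, eulerOp k (vdmPoly n R) = C (∑ k : Fin n, (k : R)) * vdmPoly n R := by
  ext α
  rw [coeff_sum, coeff_C_mul]
  simp only [coeff_eulerOp, ← Finset.sum_mul]
  by_cases h : coeff α (vdmPoly n R) = 0
  · simp [h]
  · obtain ⟨τ, hτ⟩ := exists_perm_of_coeff_vdmPoly_ne_zero h
    simp only [hτ, Equiv.sum_comp τ fun k : Fin n => ((k : ℕ) : R)]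

theorem sum_eulerOp_eulerOp_vdmPoly :
    ∑ k, eulerOp k (eulerOp k (vdmPoly n R)) = C (∑ k : Fin n, (k : R) ^ 2) * vdmPoly n R := by
  ext α
  rw [coeff_sum, coeff_C_mul]
  simp only [coeff_eulerOp, ← mul_assoc, ← pow_two, ← Finset.sum_mul]
  by_cases h : coeff α (vdmPoly n R) = 0
  · simp [h]
  · obtain ⟨τ, hτ⟩ := exists_perm_of_coeff_vdmPoly_ne_zero h
    simp only [hτ, Equiv.sum_comp τ fun k : Fin n => ((k : ℕ) : R) ^ 2]

theorem algebraMap_derivation_prod {A F ι : Type*} [CommRing A] [Algebra R A] [Field F]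
    [Algebra A F] (D : Derivation R A A) {s : Finset ι} {f : ι → A}
    (hf : ∀ i ∈ s, algebraMap A F (f i) ≠ 0) :
    algebraMap A F (D (∏ i ∈ s, f i)) =
      algebraMap A F (∏ i ∈ s, f i) * ∑ i ∈ s, algebraMap A F (D (f i)) / algebraMap A F (f i) := by
  classical
  induction s using Finset.induction_on with
  | empty => simp
  | insert a s ha ih =>
    rw [Finset.prod_insert ha, Finset.sum_insert ha, Derivation.leibniz, map_add, smul_eq_mul,
      smul_eq_mul, map_mul, map_mul, map_mul, ih fun i hi => hf i (Finset.mem_insert_of_mem hi)]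
    have := hf a (Finset.mem_insert_self a s)
    field_simp
    ring

variable [IsDomain R]

theorem algebraMap_eulerOp_vdmPoly {F : Type*} [Field F] [Algebra (MvPolynomial (Fin n) R) F]
    [FaithfulSMul (MvPolynomial (Fin n) R) F] (k : Fin n) :
    algebraMap (MvPolynomial (Fin n) R) F (eulerOp k (vdmPoly n R)) =
      algebraMap (MvPolynomial (Fin n) R) F (vdmPoly n R) *
        ∑ l ∈ Finset.univ.erase k,
          algebraMap (MvPolynomial (Fin n) R) F (X k) /
            algebraMap (MvPolynomial (Fin n) R) F (X k - X l) := by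
  set φ := algebraMap (MvPolynomial (Fin n) R) F
  have hne (i j : Fin n) (h : i ≠ j) : φ (X i) - φ (X j) ≠ 0 := by
    rw [sub_ne_zero, (FaithfulSMul.algebraMap_injective _ F).ne_iff]
    exact X_injective.ne h
  set g : Fin n → Fin n → F := fun i j => if i = k then φ (X i) / φ (X i - X j) else 0
  have hX (j : Fin n) : φ (eulerOp k (X j)) = if j = k then φ (X j) else 0 := by
    split_ifs with h
    · rw [h, eulerOp_X_self]
    · rw [eulerOp_X_of_ne h, map_zero]
  have hterm (i j : Fin n) (hij : i < j) :
      φ (eulerOp k (X j - X i)) / φ (X j - X i) = g j i + g i j := by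
    have := hne j i hij.ne'
    have := hne i j hij.ne
    simp only [g, map_sub, hX]
    split_ifs <;> grind
  rw [vdmPoly, det_vandermonde, Finset.prod_sigma', algebraMap_derivation_prod, Finset.sum_sigma]
  · rw [Finset.sum_congr rfl fun i _ => Finset.sum_congr rfl fun j hj =>
      hterm i j (Finset.mem_Ioi.1 hj), Finset.sum_sum_Ioi_add_eq_sum_sum_off_diag]
    simp only [Finset.compl_singleton]
    rw [← sum_sum_erase_comm, Finset.sum_eq_single k]
    · simp only [g, if_true, φ]
    · intro i _ hi
      simp only [g, if_neg hi, Finset.sum_const_zero]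
    · simp
  · rintro ⟨i, j⟩ hij
    simpa using hne j i (Finset.mem_Ioi.1 (Finset.mem_sigma.1 hij).2).ne'

theorem two_mul_sum_eulerOp_vdmPoly_mul {f : Fin n → MvPolynomial (Fin n) R}
    {G : Fin n → Fin n → MvPolynomial (Fin n) R}
    (hG : ∀ k l, l ≠ k → (X k - X l) * G k l = X k * f k - X l * f l) :
    2 * ∑ k, eulerOp k (vdmPoly n R) * f k =
      vdmPoly n R * ∑ k, ∑ l ∈ Finset.univ.erase k, G k l := by
  set φ := algebraMap (MvPolynomial (Fin n) R) (FractionRing (MvPolynomial (Fin n) R)) with hφ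
  apply IsFractionRing.injective _ (FractionRing (MvPolynomial (Fin n) R))
  have hpair (k l : Fin n) (h : l ≠ k) :
      φ (X k) / φ (X k - X l) * φ (f k) + φ (X l) / φ (X l - X k) * φ (f l) = φ (G k l) := by
    have hne : φ (X k) - φ (X l) ≠ 0 := by
      rw [sub_ne_zero, (IsFractionRing.injective _ _).ne_iff]
      exact X_injective.ne h.symm
    have hne' : φ (X l) - φ (X k) ≠ 0 := by rwa [← neg_sub, neg_ne_zero]
    have := congrArg φ (hG k l h)
    simp only [map_mul, map_sub] at this ⊢
    field_simp
    grind
  rw [← hφ, map_mul, map_ofNat, map_sum, map_mul, map_sum]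
  simp only [map_mul, hφ, algebraMap_eulerOp_vdmPoly, map_sum]
  simp only [← hφ, mul_assoc, Finset.sum_mul, ← Finset.mul_sum, mul_left_comm (2 : FractionRing _)]
  congr 1
  rw [two_mul]
  nth_rw 2 [sum_sum_erase_comm]
  simp only [← Finset.sum_add_distrib]
  exact Finset.sum_congr rfl fun k _ => Finset.sum_congr rfl fun l hl =>
    hpair k l (Finset.ne_of_mem_erase hl)

end Vandermonde

section CoefficientwiseFunctional

open MvPolynomial

variable {σ S R : Type*} [CommRing S] [CommRing R] [Algebra S R]

attribute [local instance] MvPolynomial.algebraMvPolynomial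

/-- A linear functional applied to each coefficient of a polynomial. It is linear over the
polynomials with coefficients in the base ring. -/
noncomputable def coeffMap (L : R →ₗ[S] S) :
    MvPolynomial σ R →ₗ[MvPolynomial σ S] MvPolynomial σ S where
  toFun p := AddMonoidAlgebra.map L p
  map_add' p q := by
    ext α
    exact map_add L _ _
  map_smul' f p := by
    classical
    ext α
    change L (coeff α (f • p)) = _
    rw [Algebra.smul_def, algebraMap_def, coeff_mul, map_sum, RingHom.id_apply, smul_eq_mul,
      coeff_mul]
    refine Finset.sum_congr rfl fun β _ => ?_
    rw [coeff_map, ← Algebra.smul_def, map_smul]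
    rfl

theorem coeff_coeffMap (L : R →ₗ[S] S) (p : MvPolynomial σ R) (α : σ →₀ ℕ) :
    coeff α (coeffMap L p) = L (coeff α p) := rfl

theorem coeffMap_monomial (L : R →ₗ[S] S) (α : σ →₀ ℕ) (r : R) :
    coeffMap L (monomial α r) = monomial α (L r) := by
  classical
  ext β
  rw [coeff_coeffMap, coeff_monomial, coeff_monomial, apply_ite L, map_zero]

theorem eval_coeffMap (L : R →ₗ[S] S) (p : MvPolynomial σ R) (x : σ → S) :
    eval x (coeffMap L p) = L (eval (fun k => algebraMap S R (x k)) p) := by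
  induction p using MvPolynomial.induction_on' with
  | monomial α r =>
    simp only [coeffMap_monomial, eval_monomial, ← map_pow, Finsupp.prod, ← map_prod]
    rw [mul_comm r, ← Algebra.smul_def, map_smul, smul_eq_mul, mul_comm]
  | add p q hp hq => simp only [map_add, hp, hq]

theorem coeffMap_eulerOp (L : R →ₗ[S] S) (k : σ) (p : MvPolynomial σ R) :
    coeffMap L (eulerOp k p) = eulerOp k (coeffMap L p) := by
  ext α
  rw [coeff_coeffMap, coeff_eulerOp, coeff_eulerOp, coeff_coeffMap, ← nsmul_eq_mul, map_nsmul,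
    nsmul_eq_mul]

theorem coeffMap_X_mul (L : R →ₗ[S] S) (k : σ) (p : MvPolynomial σ R) :
    coeffMap L (X k * p) = X k * coeffMap L p := by
  have h : X k * p = (X k : MvPolynomial σ S) • p := by
    rw [Algebra.smul_def, algebraMap_def, map_X]
  rw [h, map_smul, smul_eq_mul]

theorem coeffMap_natCast_mul (L : R →ₗ[S] S) (a : ℕ) (p : MvPolynomial σ R) :
    coeffMap L ((a : MvPolynomial σ R) * p) = (a : MvPolynomial σ S) * coeffMap L p := by
  rw [← nsmul_eq_mul, map_nsmul, nsmul_eq_mul]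

end CoefficientwiseFunctional

section CharacteristicProducts

open MvPolynomial Finset Matrix

variable {σ ι R : Type*} [Fintype ι] [DecidableEq ι] [CommRing R]

/-- The product of the characteristic polynomials of a matrix in the variables of a finite set. -/
noncomputable def charProd (A : Matrix ι ι R) (s : Finset σ) : MvPolynomial σ R :=
  ∏ k ∈ s, Polynomial.aeval (X k) A.charpoly

/-- The trace of the numerator of the resolvent of a matrix at a variable. -/
noncomputable def resolventTrace (A : Matrix ι ι R) (k : σ) : MvPolynomial σ R :=
  (resolventNum (A.map C) (X k)).trace

variable (A : Matrix ι ι R)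

theorem eval_charpoly_map_C (f : MvPolynomial σ R) :
    (A.map C : Matrix ι ι (MvPolynomial σ R)).charpoly.eval f = Polynomial.aeval f A.charpoly := by
  rw [charpoly_map, Polynomial.eval_map, Polynomial.aeval_def, algebraMap_eq]

theorem resolventTrace_eq (k : σ) :
    resolventTrace A k = X k * Polynomial.aeval (X k) (Polynomial.derivative A.charpoly) -
      (Fintype.card ι : MvPolynomial σ R) * Polynomial.aeval (X k) A.charpoly := by
  rw [resolventTrace, trace_resolventNum, eval_charpoly_map_C, charpoly_map,
    Polynomial.derivative_map, Polynomial.eval_map, Polynomial.aeval_def, Polynomial.aeval_def,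
    algebraMap_eq]

theorem eulerOp_resolventTrace_of_ne {k l : σ} (h : k ≠ l) :
    eulerOp l (resolventTrace A k) = 0 := by
  rw [resolventTrace_eq, map_sub, Derivation.leibniz, Derivation.leibniz, eulerOp_X_of_ne h,
    eulerOp_aeval_X_of_ne h, eulerOp_aeval_X_of_ne h, Derivation.map_natCast]
  simp only [smul_zero, add_zero, sub_zero]

variable [DecidableEq σ]

theorem charProd_erase_mul {k : σ} {s : Finset σ} (hk : k ∈ s) :
    charProd A (s.erase k) * Polynomial.aeval (X k) A.charpoly = charProd A s :=
  prod_erase_mul s _ hk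

theorem charProd_erase_mul_resolventTrace {k : σ} {s : Finset σ} (hk : k ∈ s) :
    charProd A (s.erase k) * resolventTrace A k =
      eulerOp k (charProd A s) - (Fintype.card ι : MvPolynomial σ R) * charProd A s := by
  rw [resolventTrace_eq, mul_sub, charProd, charProd, eulerOp_prod_aeval_X hk,
    ← prod_erase_mul s _ hk]
  ring

theorem charProd_erase_erase_mul_resolventTrace_mul {k l : σ} {s : Finset σ} (hk : k ∈ s)
    (hl : l ∈ s.erase k) :
    charProd A ((s.erase k).erase l) * (resolventTrace A k * resolventTrace A l) =
      eulerOp l (eulerOp k (charProd A s)) - Fintype.card ι * eulerOp k (charProd A s) -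
        Fintype.card ι * eulerOp l (charProd A s) + Fintype.card ι ^ 2 * charProd A s := by
  have hcalc : eulerOp l (charProd A (s.erase k) * resolventTrace A k) =
      resolventTrace A k * eulerOp l (charProd A (s.erase k)) := by
    rw [Derivation.leibniz, eulerOp_resolventTrace_of_ne A (ne_of_mem_erase hl).symm, smul_zero,
      zero_add, smul_eq_mul]
  have hk' := charProd_erase_mul_resolventTrace A hk
  have hl' := charProd_erase_mul_resolventTrace A hl
  rw [hk', map_sub, Derivation.leibniz, Derivation.map_natCast, smul_zero, add_zero,
    smul_eq_mul] at hcalc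
  linear_combination resolventTrace A k * hl' - hcalc - Fintype.card ι * hk'

theorem X_sub_X_mul_charProd_mul_trace {k l : σ} {s : Finset σ} (hk : k ∈ s) (hl : l ∈ s)
    (h : l ≠ k) :
    (X k - X l) * (charProd A ((s.erase k).erase l) *
        (resolventNum (A.map C) (X k) * resolventNum (A.map C) (X l)).trace) =
      X l * (eulerOp l (charProd A s) - (Fintype.card ι : MvPolynomial σ R) * charProd A s) -
        X k * (eulerOp k (charProd A s) - (Fintype.card ι : MvPolynomial σ R) * charProd A s) := by
  have htr := congrArg trace
    (sub_smul_resolventNum_mul_resolventNum (A.map C) (X k : MvPolynomial σ R) (X l))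
  rw [trace_smul, trace_sub, trace_smul, trace_smul, eval_charpoly_map_C, eval_charpoly_map_C,
    ← resolventTrace, ← resolventTrace] at htr
  simp only [smul_eq_mul] at htr
  rw [← charProd_erase_mul_resolventTrace A hk, ← charProd_erase_mul_resolventTrace A hl,
    ← charProd_erase_mul A (mem_erase.2 ⟨h.symm, hk⟩),
    ← charProd_erase_mul A (mem_erase.2 ⟨h, hl⟩), erase_right_comm (a := l)]
  linear_combination charProd A ((s.erase k).erase l) * htr

end CharacteristicProducts

section CasimirEquations

open MvPolynomial Finset Matrix

attribute [local instance] MvPolynomial.algebraMvPolynomial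

variable {σ ι R : Type*} [Fintype ι] [DecidableEq ι] [CommRing R] [Algebra ℂ R]

instance isScalarTower_mvPolynomial : IsScalarTower ℂ (MvPolynomial σ ℂ) (MvPolynomial σ R) :=
  IsScalarTower.of_algebraMap_eq' <| by
    ext z
    rw [RingHom.comp_apply, algebraMap_eq, algebraMap_def, map_C, MvPolynomial.algebraMap_apply]

variable [Fintype σ] {L : R →ₗ[ℂ] ℂ} {A : Matrix ι ι R} {m : ℕ}

theorem sum_eulerOp_coeffMap_charProd
    (h : IsUnitaryRelInvariant (coeffMap L) (A.map C) (X : σ → MvPolynomial σ R) m) :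
    ∑ k, eulerOp k (coeffMap L (charProd A univ)) =
      (Fintype.card ι * (Fintype.card σ - m) : MvPolynomial σ ℂ) *
        coeffMap L (charProd A univ) := by
  classical
  have htrace := h.map_sum_trace
  simp only [eval_charpoly_map_C] at htrace
  change coeffMap L (∑ k, charProd A (univ.erase k) * resolventTrace A k) =
    _ * coeffMap L (charProd A univ) at htrace
  simp only [charProd_erase_mul_resolventTrace A (mem_univ _), map_sum, map_sub,
    coeffMap_natCast_mul, coeffMap_eulerOp, sum_sub_distrib, sum_const, card_univ,
    nsmul_eq_mul] at htrace
  linear_combination htrace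

variable [DecidableEq σ]

/-- The mean of the product of two resolvents at different variables, which enters the second
order Casimir equation. -/
noncomputable def resolventPairMean (L : R →ₗ[ℂ] ℂ) (A : Matrix ι ι R) (k l : σ) :
    MvPolynomial σ ℂ :=
  coeffMap L (charProd A ((univ.erase k).erase l) *
    (resolventNum (A.map C) (X k) * resolventNum (A.map C) (X l)).trace)

theorem X_sub_X_mul_resolventPairMean {k l : σ} (hkl : l ≠ k) :
    (X k - X l) * resolventPairMean L A k l =
      X l * (eulerOp l (coeffMap L (charProd A univ)) -
        (Fintype.card ι : MvPolynomial σ ℂ) * coeffMap L (charProd A univ)) -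
      X k * (eulerOp k (coeffMap L (charProd A univ)) -
        (Fintype.card ι : MvPolynomial σ ℂ) * coeffMap L (charProd A univ)) := by
  have hX := congrArg (coeffMap L)
    (X_sub_X_mul_charProd_mul_trace A (mem_univ k) (mem_univ l) hkl)
  simpa only [resolventPairMean, sub_mul, map_sub, coeffMap_X_mul, coeffMap_natCast_mul,
    coeffMap_eulerOp] using hX

theorem sum_sum_eulerOp_eulerOp_coeffMap_charProd
    (h : IsUnitaryRelInvariant (coeffMap L) (A.map C) (X : σ → MvPolynomial σ R) m) :
    ∑ k, ∑ l ∈ univ.erase k, (eulerOp l (eulerOp k (coeffMap L (charProd A univ))) -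
        (Fintype.card ι : MvPolynomial σ ℂ) * eulerOp k (coeffMap L (charProd A univ)) -
        (Fintype.card ι : MvPolynomial σ ℂ) * eulerOp l (coeffMap L (charProd A univ)) +
        (Fintype.card ι : MvPolynomial σ ℂ) ^ 2 * coeffMap L (charProd A univ) +
        resolventPairMean L A k l) =
      (m * (m - 1) * Fintype.card ι * (Fintype.card ι + 1) : MvPolynomial σ ℂ) *
        coeffMap L (charProd A univ) := by
  have htrace := h.map_sum_trace_mul_trace
  simp only [eval_charpoly_map_C] at htrace
  change coeffMap L (∑ k, ∑ l ∈ univ.erase k, charProd A ((univ.erase k).erase l) *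
    (resolventTrace A k * resolventTrace A l + _)) = _ * coeffMap L (charProd A univ) at htrace
  rw [← htrace, map_sum]
  refine sum_congr rfl fun k _ => ?_
  rw [map_sum]
  refine sum_congr rfl fun l hl => ?_
  rw [mul_add, charProd_erase_erase_mul_resolventTrace_mul A (mem_univ k) hl]
  simp only [map_add, map_sub, ← Nat.cast_pow, coeffMap_natCast_mul, coeffMap_eulerOp,
    resolventPairMean]

end CasimirEquations

section MeanAlternant

open MvPolynomial Finset Matrix

variable {n m : ℕ} {ι R : Type*} [Fintype ι] [DecidableEq ι] [CommRing R] [Algebra ℂ R]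
  {L : R →ₗ[ℂ] ℂ} {A : Matrix ι ι R}

attribute [local instance] MvPolynomial.algebraMvPolynomial

theorem sum_eulerOp_vdmPoly_mul_coeffMap_charProd
    (h : IsUnitaryRelInvariant (coeffMap L) (A.map C) (X : Fin n → MvPolynomial (Fin n) R) m) :
    ∑ k, eulerOp k (vdmPoly n ℂ * coeffMap L (charProd A univ)) =
      C ((∑ k : Fin n, (k : ℂ)) + Fintype.card ι * (n - m)) *
        (vdmPoly n ℂ * coeffMap L (charProd A univ)) := by
  have hH := sum_eulerOp_coeffMap_charProd h
  have hV := sum_eulerOp_vdmPoly (n := n) (R := ℂ)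
  simp only [Derivation.leibniz, smul_eq_mul, sum_add_distrib, ← mul_sum]
  rw [hH, hV, Fintype.card_fin]
  simp only [map_add, map_mul, map_sub, map_natCast]
  ring

theorem two_mul_sum_eulerOp_vdmPoly_mul_eulerOp_coeffMap_charProd :
    2 * ∑ k, eulerOp k (vdmPoly n ℂ) * eulerOp k (coeffMap L (charProd A univ)) =
      vdmPoly n ℂ * ∑ k, ∑ l ∈ univ.erase k,
        ((Fintype.card ι : MvPolynomial (Fin n) ℂ) * coeffMap L (charProd A univ) -
          resolventPairMean L A k l) :=
  two_mul_sum_eulerOp_vdmPoly_mul fun _ _ hkl => by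
    linear_combination -X_sub_X_mul_resolventPairMean (L := L) (A := A) hkl

theorem sum_eulerOp_eulerOp_vdmPoly_mul_coeffMap_charProd
    (h : IsUnitaryRelInvariant (coeffMap L) (A.map C) (X : Fin n → MvPolynomial (Fin n) R) m) :
    ∑ k, eulerOp k (eulerOp k (vdmPoly n ℂ * coeffMap L (charProd A univ))) =
      C ((∑ k : Fin n, (k : ℂ) ^ 2) + Fintype.card ι * (n * (n - 1) - m * (m - 1)) +
          Fintype.card ι ^ 2 * (n - m)) *
        (vdmPoly n ℂ * coeffMap L (charProd A univ)) := by
  set H : MvPolynomial (Fin n) ℂ := coeffMap L (charProd A univ) with hH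
  have hV := sum_eulerOp_eulerOp_vdmPoly (n := n) (R := ℂ)
  have hfirst := sum_eulerOp_coeffMap_charProd h
  have hsecond := sum_sum_eulerOp_eulerOp_coeffMap_charProd h
  have hcross := two_mul_sum_eulerOp_vdmPoly_mul_eulerOp_coeffMap_charProd (n := n) (L := L)
    (A := A)
  rw [← hH, Fintype.card_fin] at hfirst
  rw [← hH] at hsecond hcross
  have hsquare : ∑ k, eulerOp k (eulerOp k H) =
      ∑ l, eulerOp l (∑ k, eulerOp k H) - ∑ k, ∑ l ∈ univ.erase k, eulerOp l (eulerOp k H) := by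
    simp only [map_sum]
    rw [sum_comm, ← sum_sub_distrib]
    exact sum_congr rfl fun k _ => by rw [← add_sum_erase _ _ (mem_univ k), add_sub_cancel_right]
  have hfirst' : ∑ l, eulerOp l (∑ k, eulerOp k H) =
      (Fintype.card ι * (n - m) : MvPolynomial (Fin n) ℂ) ^ 2 * H := by
    simp only [hfirst, Derivation.leibniz, map_sub, Derivation.map_natCast, add_zero,
      sub_zero, smul_eq_mul, mul_zero, ← mul_sum]
    ring
  simp only [sum_add_distrib, sum_sub_distrib, sum_sum_erase_const, Fintype.card_fin,
    ← mul_sum] at hsecond hcross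
  rw [sum_sum_erase_comm fun _ l => eulerOp l H, sum_sum_erase_const, Fintype.card_fin] at hsecond
  simp only [sum_const, card_univ, Fintype.card_fin, nsmul_eq_mul] at hsecond hcross
  simp only [Derivation.leibniz, smul_eq_mul, map_add, sum_add_distrib, ← mul_sum]
  simp only [mul_comm (eulerOp _ H) (eulerOp _ (vdmPoly n ℂ))]
  rw [hsquare, hfirst', hV]
  simp only [map_mul, map_sub, map_natCast, map_pow, map_one]
  linear_combination hcross - vdmPoly n ℂ * hsecond -
    2 * vdmPoly n ℂ * (Fintype.card ι : MvPolynomial (Fin n) ℂ) *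
      ((n : MvPolynomial (Fin n) ℂ) - 1) * hfirst

end MeanAlternant

section GapExponents

variable {N m n : ℕ}

/-- The `l`-th element of `ℕ` with the gap `{m, …, N + m - 1}` removed. -/
def gapExp (N m l : ℕ) : ℕ := if l < m then l else N + l

theorem gapExp_injective : Function.Injective (gapExp N m) := fun a b h => by
  simp only [gapExp] at h
  split_ifs at h <;> omega

theorem gapExp_val_injective : Function.Injective fun l : Fin n => gapExp N m l :=
  gapExp_injective.comp Fin.val_injective

theorem exists_gapExp_eq_iff (hmn : m ≤ n) {s : ℕ} :
    (∃ l : Fin n, gapExp N m l = s) ↔ s < N + n ∧ (s < m ∨ N + m ≤ s) := by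
  simp only [gapExp]
  constructor
  · rintro ⟨l, rfl⟩
    split_ifs <;> omega
  · rintro ⟨hs, hsm | hsm⟩
    · exact ⟨⟨s, by omega⟩, if_pos hsm⟩
    · exact ⟨⟨s - N, by omega⟩, by dsimp only; split_ifs <;> omega⟩

theorem subset_of_forall_sdiff_lt {α M : Type*} [DecidableEq α] [AddCommGroup M] [LinearOrder M]
    [IsOrderedAddMonoid M] {S T : Finset α} {φ : α → M} (hcard : S.card = T.card)
    (hsum : ∑ s ∈ S, φ s = ∑ t ∈ T, φ t) (hlt : ∀ s ∈ S \ T, ∀ t ∈ T \ S, φ s < φ t) :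
    S ⊆ T := by
  by_contra hST
  have hne : (S \ T).Nonempty := Finset.sdiff_nonempty.2 hST
  let e : ↥(S \ T) ≃ ↥(T \ S) := Finset.equivOfCardEq (Finset.card_sdiff_comm hcard)
  have hsdiff : ∑ s ∈ S \ T, φ s < ∑ t ∈ T \ S, φ t := by
    rw [← Finset.sum_coe_sort (S \ T), ← Finset.sum_coe_sort (T \ S), ← e.sum_comp]
    exact Finset.sum_lt_sum_of_nonempty (Finset.univ_nonempty_iff.2 hne.to_subtype)
      fun s _ => hlt s s.2 (e s) (e s).2
  have hS := Finset.sum_inter_add_sum_sdiff S T φ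
  have hT := Finset.sum_inter_add_sum_sdiff T S φ
  rw [Finset.inter_comm, ← hsum, ← hS, Finset.inter_comm] at hT
  exact hsdiff.ne' (add_left_cancel hT)

theorem exists_perm_gapExp_of_sum_eq (hmn : m ≤ n) {α : Fin n → ℕ} (hα : Function.Injective α)
    (hlt : ∀ k, α k < N + n) (hsum : ∑ k, α k = ∑ k : Fin n, gapExp N m k)
    (hsumsq : ∑ k, α k ^ 2 = ∑ k : Fin n, gapExp N m k ^ 2) :
    ∃ σ : Equiv.Perm (Fin n), ∀ k, α k = gapExp N m (σ k) := by
  -- `φ` is nonpositive exactly on the gap, and its sum over a set of exponents is determined by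
  -- their number, their sum and the sum of their squares.
  let φ : ℕ → ℤ := fun s => (s - m) * (s - (N + m - 1))
  have hφ (β : Fin n → ℕ) : ∑ k, φ (β k) = ((∑ k, β k ^ 2 : ℕ) : ℤ) -
      (2 * m + N - 1) * ((∑ k, β k : ℕ) : ℤ) + n * (m * (N + m - 1)) := by
    have hterm (k : Fin n) :
        φ (β k) = (β k : ℤ) ^ 2 - (2 * m + N - 1) * β k + m * (N + m - 1) := by
      simp only [φ]; ring
    simp [hterm, Finset.sum_add_distrib, Finset.sum_sub_distrib, ← Finset.mul_sum]
  have hsubset : Finset.univ.image α ⊆ Finset.univ.image fun k : Fin n => gapExp N m k := by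
    refine subset_of_forall_sdiff_lt (φ := φ) ?_ ?_ fun s hs t ht => ?_
    · rw [Finset.card_image_of_injective _ hα,
        Finset.card_image_of_injective _ gapExp_val_injective]
    · rw [Finset.sum_image hα.injOn, Finset.sum_image gapExp_val_injective.injOn, hφ, hφ, hsum,
        hsumsq]
    · simp only [Finset.mem_sdiff, Finset.mem_image, Finset.mem_univ, true_and,
        exists_gapExp_eq_iff hmn] at hs ht
      obtain ⟨⟨k, rfl⟩, hk⟩ := hs
      have := hlt k
      calc φ (α k) ≤ 0 := mul_nonpos_of_nonneg_of_nonpos (by omega) (by omega)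
        _ < φ t := by
          rcases ht.1.2 with htm | htm
          · exact mul_pos_of_neg_of_neg (by omega) (by omega)
          · exact mul_pos (by omega) (by omega)
  have hex (k : Fin n) : ∃ l : Fin n, gapExp N m l = α k := by
    simpa using hsubset (Finset.mem_image_of_mem α (Finset.mem_univ k))
  choose f hf using hex
  have hf_inj : Function.Injective f := fun a b hab => hα (by rw [← hf a, ← hf b, hab])
  exact ⟨Equiv.ofBijective f (Finite.injective_iff_bijective.1 hf_inj), fun k => (hf k).symm⟩

end GapExponents

section GapDeterminant

open Matrix

theorem det_of_blockTriangular_of_injective {ι α R : Type*} [Fintype ι] [DecidableEq ι]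
    [LinearOrder α] [CommRing R] {M : Matrix ι ι R} {b : ι → α} (hb : Function.Injective b)
    (h : BlockTriangular M b) : M.det = ∏ i, M i i := by
  let : LinearOrder ι := LinearOrder.lift' b hb
  exact det_of_isUpperTriangular h

theorem det_coeff_gapExp {N m n : ℕ} {R : Type*} [CommRing R] (hmn : m ≤ n) {p : Polynomial R}
    (hp : p.Monic) (hdeg : p.natDegree = N) :
    (of fun k j : Fin n => (Polynomial.X ^ (j : ℕ) * p).coeff (gapExp N m k)).det =
      p.coeff 0 ^ m := by
  let b : Fin n → ℕ := fun k => if (k : ℕ) < m then 2 * (m - 1 - k) else 2 * (k - m) + 1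
  have hb : Function.Injective b := fun k l h => by
    simp only [b] at h
    ext
    split_ifs at h <;> omega
  have hdiag (k : Fin n) : (Polynomial.X ^ (k : ℕ) * p).coeff (gapExp N m k) =
      if (k : ℕ) < m then p.coeff 0 else 1 := by
    simp only [Polynomial.coeff_X_pow_mul', gapExp]
    split_ifs
    · simp
    · omega
    · simpa [hdeg] using hp.coeff_natDegree
    · omega
  rw [det_of_blockTriangular_of_injective hb fun k j hkj => ?_]
  · simp only [of_apply, hdiag, Finset.prod_ite, Finset.prod_const, Fin.card_filter_val_lt,
      one_pow, mul_one, min_eq_right hmn]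
  · simp only [of_apply, Polynomial.coeff_X_pow_mul', gapExp]
    simp only [b] at hkj
    split_ifs at hkj ⊢ <;>
      first
        | rfl
        | omega
        | exact Polynomial.coeff_eq_zero_of_natDegree_lt (by omega)

end GapDeterminant

section GapAlternant

open MvPolynomial Matrix

variable {N m n : ℕ}

theorem eq_of_coeff_ne_zero_of_sum_eulerOp {σ R : Type*} [Fintype σ] [CommRing R] [IsDomain R]
    {p : MvPolynomial σ R} {c : R} (h : ∑ k, eulerOp k p = C c * p) {α : σ →₀ ℕ}
    (hα : coeff α p ≠ 0) : ∑ k, (α k : R) = c := by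
  have hcoeff := congrArg (coeff α) h
  simp only [coeff_sum, coeff_eulerOp, coeff_C_mul, ← Finset.sum_mul] at hcoeff
  exact mul_right_cancel₀ hα hcoeff

theorem eq_of_coeff_ne_zero_of_sum_eulerOp_eulerOp {σ R : Type*} [Fintype σ] [CommRing R]
    [IsDomain R] {p : MvPolynomial σ R} {c : R} (h : ∑ k, eulerOp k (eulerOp k p) = C c * p)
    {α : σ →₀ ℕ} (hα : coeff α p ≠ 0) : ∑ k, (α k : R) ^ 2 = c := by
  have hcoeff := congrArg (coeff α) h
  simp only [coeff_sum, coeff_eulerOp, coeff_C_mul, ← mul_assoc, ← pow_two, ← Finset.sum_mul]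
    at hcoeff
  exact mul_right_cancel₀ hα hcoeff

/-- The alternant with exponents `gapExp N m 0, …, gapExp N m (n - 1)`. -/
noncomputable def gapAlternant (N m n : ℕ) : MvPolynomial (Fin n) ℂ :=
  (of fun k j : Fin n => (X k : MvPolynomial (Fin n) ℂ) ^ gapExp N m j).det

theorem coeff_gapAlternant (α : Fin n →₀ ℕ) : coeff α (gapAlternant N m n) =
    (of fun k j : Fin n => if α k = gapExp N m j then (1 : ℂ) else 0).det := by
  simpa [gapAlternant, Polynomial.coeff_X_pow] using
    coeff_det_aeval_X (fun j : Fin n => (Polynomial.X : Polynomial ℂ) ^ gapExp N m j) α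

theorem coeff_gapAlternant_of_perm {α : Fin n →₀ ℕ} {σ : Equiv.Perm (Fin n)}
    (hα : ∀ k, α k = gapExp N m (σ k)) : coeff α (gapAlternant N m n) = Equiv.Perm.sign σ := by
  rw [coeff_gapAlternant, ← det_permutation]
  congr 1
  ext k j
  simp [hα, gapExp_injective.eq_iff, Equiv.Perm.permMatrix, PEquiv.toMatrix_apply,
    Fin.val_inj, eq_comm]

theorem exists_perm_of_coeff_gapAlternant_ne_zero {α : Fin n →₀ ℕ}
    (h : coeff α (gapAlternant N m n) ≠ 0) :
    ∃ σ : Equiv.Perm (Fin n), ∀ k, α k = gapExp N m (σ k) := by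
  rw [coeff_gapAlternant, ← det_transpose, det_apply] at h
  obtain ⟨σ, -, hσ⟩ := Finset.exists_ne_zero_of_sum_ne_zero h
  refine ⟨σ, fun k => by_contra fun hk => hσ ?_⟩
  rw [Finset.prod_eq_zero (Finset.mem_univ k) (by simp [hk]), smul_zero]

end GapAlternant

section GapAlternantIdentity

open MvPolynomial Matrix

variable {n m : ℕ} {ι R : Type*} [Fintype ι] [DecidableEq ι] [CommRing R] [Algebra ℂ R]
  {L : R →ₗ[ℂ] ℂ} {A : Matrix ι ι R}

attribute [local instance] MvPolynomial.algebraMvPolynomial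

theorem coeff_vdmPoly_mul_coeffMap_charProd (α : Fin n →₀ ℕ) :
    coeff α (vdmPoly n ℂ * coeffMap L (charProd A Finset.univ)) =
      L (of fun k j : Fin n => (Polynomial.X ^ (j : ℕ) * A.charpoly).coeff (α k)).det := by
  have hV : algebraMap (MvPolynomial (Fin n) ℂ) (MvPolynomial (Fin n) R) (vdmPoly n ℂ) =
      vdmPoly n R := by
    rw [vdmPoly, RingHom.map_det, vdmPoly]
    congr 1
    ext k j : 1
    simp only [RingHom.mapMatrix_apply, map_apply, vandermonde_apply, map_pow, algebraMap_def,
      map_X]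
  rw [← smul_eq_mul, ← map_smul, Algebra.smul_def, hV, coeff_coeffMap, charProd,
    vdmPoly_mul_prod_aeval, coeff_det_aeval_X]

variable {α : Fin n →₀ ℕ}

theorem injective_of_coeff_vdmPoly_mul_ne_zero
    (hα : coeff α (vdmPoly n ℂ * coeffMap L (charProd A Finset.univ)) ≠ 0) :
    Function.Injective α := by
  rw [coeff_vdmPoly_mul_coeffMap_charProd] at hα
  intro k l hkl
  by_contra hne
  refine hα ?_
  rw [det_zero_of_row_eq hne (by ext j; simp [hkl]), map_zero]

theorem lt_of_coeff_vdmPoly_mul_ne_zero [Nontrivial R]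
    (hα : coeff α (vdmPoly n ℂ * coeffMap L (charProd A Finset.univ)) ≠ 0) (k : Fin n) :
    α k < Fintype.card ι + n := by
  rw [coeff_vdmPoly_mul_coeffMap_charProd] at hα
  by_contra! hk
  refine hα ?_
  rw [det_eq_zero_of_row_eq_zero k fun j => ?_, map_zero]
  rw [of_apply, Polynomial.coeff_X_pow_mul', Polynomial.coeff_eq_zero_of_natDegree_lt, ite_self]
  rw [charpoly_natDegree_eq_dim]
  omega

theorem coeff_gapExp_perm_vdmPoly_mul [Nontrivial R] (hmn : m ≤ n) {σ : Equiv.Perm (Fin n)}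
    (hα : ∀ k, α k = gapExp (Fintype.card ι) m (σ k)) :
    coeff α (vdmPoly n ℂ * coeffMap L (charProd A Finset.univ)) =
      Equiv.Perm.sign σ * L (A.charpoly.coeff 0 ^ m) := by
  have hperm := det_permute σ (of fun k j : Fin n =>
    (Polynomial.X ^ (j : ℕ) * A.charpoly).coeff (gapExp (Fintype.card ι) m k))
  rw [det_coeff_gapExp hmn A.charpoly_monic A.charpoly_natDegree_eq_dim] at hperm
  simp only [coeff_vdmPoly_mul_coeffMap_charProd, hα]
  calc L _ = L (Equiv.Perm.sign σ * A.charpoly.coeff 0 ^ m) := congrArg L hperm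
    _ = Equiv.Perm.sign σ * L (A.charpoly.coeff 0 ^ m) := by
      rw [← zsmul_eq_mul, map_zsmul, zsmul_eq_mul]

theorem vdmPoly_mul_coeffMap_charProd [Nontrivial R]
    (h : IsUnitaryRelInvariant (coeffMap L) (A.map C) (X : Fin n → MvPolynomial (Fin n) R) m)
    (hmn : m ≤ n) (hL : L (A.charpoly.coeff 0 ^ m) ≠ 0) :
    vdmPoly n ℂ * coeffMap L (charProd A Finset.univ) =
      C (L (A.charpoly.coeff 0 ^ m)) * gapAlternant (Fintype.card ι) m n := by
  set e : Fin n →₀ ℕ := Finsupp.equivFunOnFinite.symm fun k => gapExp (Fintype.card ι) m k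
  have he : coeff e (vdmPoly n ℂ * coeffMap L (charProd A Finset.univ)) ≠ 0 := by
    simpa [coeff_gapExp_perm_vdmPoly_mul hmn (α := e) (σ := 1) fun _ => rfl] using hL
  have hsum := sum_eulerOp_vdmPoly_mul_coeffMap_charProd h
  have hsumsq := sum_eulerOp_eulerOp_vdmPoly_mul_coeffMap_charProd h
  ext α
  rw [coeff_C_mul]
  by_cases hα : ∃ σ : Equiv.Perm (Fin n), ∀ k, α k = gapExp (Fintype.card ι) m (σ k)
  · obtain ⟨σ, hσ⟩ := hα
    rw [coeff_gapExp_perm_vdmPoly_mul hmn hσ, coeff_gapAlternant_of_perm hσ, mul_comm]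
  · rw [not_imp_comm.1 exists_perm_of_coeff_gapAlternant_ne_zero hα, mul_zero]
    refine by_contra fun hne => hα (exists_perm_gapExp_of_sum_eq hmn
      (injective_of_coeff_vdmPoly_mul_ne_zero hne) (lt_of_coeff_vdmPoly_mul_ne_zero hne) ?_ ?_)
    · exact_mod_cast (eq_of_coeff_ne_zero_of_sum_eulerOp hsum hne).trans
        (eq_of_coeff_ne_zero_of_sum_eulerOp hsum he).symm
    · exact_mod_cast (eq_of_coeff_ne_zero_of_sum_eulerOp_eulerOp hsumsq hne).trans
        (eq_of_coeff_ne_zero_of_sum_eulerOp_eulerOp hsumsq he).symm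

end GapAlternantIdentity

section TranslationInvariance

open MvPolynomial Matrix

attribute [local instance] MvPolynomial.algebraMvPolynomial

theorem isUnitaryRelInvariant_coeffMap {σ ι R : Type*} [Fintype σ] [Fintype ι] [DecidableEq ι]
    [CommRing R] [Algebra ℂ R] {L : R →ₗ[ℂ] ℂ} {A : Matrix ι ι R} {m : ℕ}
    {T : unitaryGroup ι ℂ → R →ₐ[ℂ] R}
    (hT : ∀ g, A.map (T g) = (g : Matrix ι ι ℂ).map (algebraMap ℂ R) * A)
    (hL : ∀ g f, L (T g f) = (g : Matrix ι ι ℂ).det ^ m * L f) :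
    IsUnitaryRelInvariant (coeffMap L) (A.map C) (X : σ → MvPolynomial σ R) m := by
  intro g hg
  have hmap : g.map (algebraMap ℂ (MvPolynomial σ R)) * A.map C =
      (A.map C).map (map (T ⟨g, hg⟩ : R →+* R) : MvPolynomial σ R →+* _) := by
    have hcomp : (A.map C).map (map (T ⟨g, hg⟩ : R →+* R) : MvPolynomial σ R →+* _) =
        (A.map (T ⟨g, hg⟩)).map C := by
      ext i j : 2
      simp
    rw [hcomp, hT, Matrix.map_mul, Matrix.map_map]
    rfl
  have hprod : ∏ k, (g.map (algebraMap ℂ (MvPolynomial σ R)) * A.map C).charpoly.eval (X k) =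
      map (T ⟨g, hg⟩ : R →+* R) (∏ k, (A.map C).charpoly.eval (X k : MvPolynomial σ R)) := by
    rw [hmap, map_prod]
    refine Finset.prod_congr rfl fun k _ => ?_
    rw [charpoly_map, Polynomial.eval_map, ← Polynomial.eval₂_at_apply, map_X]
  ext α
  rw [hprod, algebraMap_eq, coeff_C_mul, coeff_coeffMap, coeff_map, coeff_coeffMap]
  exact hL ⟨g, hg⟩ _

end TranslationInvariance

section HaarFunctional

open Matrix MeasureTheory

instance isProbabilityMeasure_haarU (N : ℕ) : IsProbabilityMeasure (haarU N) :=
  ⟨by simpa [haarU] using Measure.haarMeasure_self (G := unitaryGroup (Fin N) ℂ) (K₀ := ⊤)⟩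

instance isMulLeftInvariant_haarU (N : ℕ) : (haarU N).IsMulLeftInvariant := by
  unfold haarU; infer_instance

theorem integrable_haarU_of_continuous {N : ℕ} {E : Type*} [NormedAddCommGroup E]
    {f : unitaryGroup (Fin N) ℂ → E} (hf : Continuous f) : Integrable f (haarU N) :=
  hf.integrable_of_hasCompactSupport (HasCompactSupport.of_compactSpace f)

theorem det_ne_zero_of_mem_unitaryGroup {ι : Type*} [Fintype ι] [DecidableEq ι]
    {U : Matrix ι ι ℂ} (hU : U ∈ unitaryGroup ι ℂ) : U.det ≠ 0 :=
  fun h => by simpa [h] using (det_of_mem_unitary hU).1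

variable {N : ℕ}

theorem continuous_inv_det_pow (N m : ℕ) :
    Continuous fun U : unitaryGroup (Fin N) ℂ => (U : Matrix (Fin N) (Fin N) ℂ).det⁻¹ ^ m :=
  (continuous_subtype_val.matrix_det.inv₀ fun U => det_ne_zero_of_mem_unitaryGroup U.2).pow m

/-- The mean of `det U ^ (-m) * f U` over the unitary group, as a functional of `f`. -/
noncomputable def haarMean (N m : ℕ) : C(unitaryGroup (Fin N) ℂ, ℂ) →ₗ[ℂ] ℂ where
  toFun f := ∫ U : unitaryGroup (Fin N) ℂ, (U : Matrix (Fin N) (Fin N) ℂ).det⁻¹ ^ m * f U ∂haarU N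
  map_add' f g := by
    simp only [ContinuousMap.add_apply, mul_add]
    exact integral_add
      (integrable_haarU_of_continuous ((continuous_inv_det_pow N m).mul f.continuous))
      (integrable_haarU_of_continuous ((continuous_inv_det_pow N m).mul g.continuous))
  map_smul' c f := by
    simp only [ContinuousMap.smul_apply, smul_eq_mul, mul_left_comm _ c, RingHom.id_apply]
    exact integral_const_mul _ _

theorem haarMean_apply {m : ℕ} (f : C(unitaryGroup (Fin N) ℂ, ℂ)) :
    haarMean N m f = ∫ U : unitaryGroup (Fin N) ℂ,
      (U : Matrix (Fin N) (Fin N) ℂ).det⁻¹ ^ m * f U ∂haarU N := rfl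

/-- Left translation of continuous functions on the unitary group by `g`. -/
noncomputable def leftTranslate (g : unitaryGroup (Fin N) ℂ) :
    C(unitaryGroup (Fin N) ℂ, ℂ) →ₐ[ℂ] C(unitaryGroup (Fin N) ℂ, ℂ) :=
  ContinuousMap.compRightAlgHom ℂ ℂ ⟨fun U => g * U, continuous_const_mul g⟩

theorem leftTranslate_apply (g U : unitaryGroup (Fin N) ℂ) (f : C(unitaryGroup (Fin N) ℂ, ℂ)) :
    leftTranslate g f U = f (g * U) := rfl

theorem haarMean_leftTranslate {m : ℕ} (g : unitaryGroup (Fin N) ℂ)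
    (f : C(unitaryGroup (Fin N) ℂ, ℂ)) :
    haarMean N m (leftTranslate g f) = (g : Matrix (Fin N) (Fin N) ℂ).det ^ m * haarMean N m f := by
  rw [haarMean_apply, haarMean_apply, ← integral_const_mul, ← integral_mul_left_eq_self
    (fun U : unitaryGroup (Fin N) ℂ => (g : Matrix (Fin N) (Fin N) ℂ).det ^ m *
      ((U : Matrix (Fin N) (Fin N) ℂ).det⁻¹ ^ m * f U)) g]
  refine integral_congr_ae (Filter.Eventually.of_forall fun U => ?_)
  have hg := pow_ne_zero m (det_ne_zero_of_mem_unitaryGroup g.2)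
  simp only [leftTranslate_apply, Submonoid.coe_mul, det_mul, mul_inv, mul_pow, inv_pow]
  field_simp

/-- The matrix of coordinate functions of the unitary group. -/
def coordMatrix (N : ℕ) : Matrix (Fin N) (Fin N) C(unitaryGroup (Fin N) ℂ, ℂ) :=
  of fun i j => ⟨fun U => U.1 i j, continuous_subtype_val.matrix_elem i j⟩

theorem map_evalAlgHom_coordMatrix (U : unitaryGroup (Fin N) ℂ) :
    (coordMatrix N).map (ContinuousMap.evalAlgHom ℂ ℂ U : _ →+* ℂ) = U := rfl

theorem map_leftTranslate_coordMatrix (g : unitaryGroup (Fin N) ℂ) :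
    (coordMatrix N).map (leftTranslate g) =
      (g : Matrix (Fin N) (Fin N) ℂ).map (algebraMap ℂ C(unitaryGroup (Fin N) ℂ, ℂ)) *
        coordMatrix N := by
  ext i j U
  simp [coordMatrix, leftTranslate_apply, mul_apply, ContinuousMap.coe_sum, Finset.sum_apply]

theorem isUnitaryRelInvariant_haarMean {σ : Type*} [Fintype σ] {m : ℕ} :
    letI := MvPolynomial.algebraMvPolynomial (σ := σ) (R := ℂ) (S := C(unitaryGroup (Fin N) ℂ, ℂ))
    IsUnitaryRelInvariant (coeffMap (haarMean N m)) ((coordMatrix N).map MvPolynomial.C)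
      (MvPolynomial.X : σ → MvPolynomial σ C(unitaryGroup (Fin N) ℂ, ℂ)) m :=
  isUnitaryRelInvariant_coeffMap map_leftTranslate_coordMatrix haarMean_leftTranslate

theorem haarMean_coeff_charpoly_coordMatrix_pow {m : ℕ} :
    haarMean N m ((coordMatrix N).charpoly.coeff 0 ^ m) = ((-1) ^ N) ^ m := by
  have hcoeff (U : unitaryGroup (Fin N) ℂ) : (coordMatrix N).charpoly.coeff 0 U =
      (-1) ^ N * (U : Matrix (Fin N) (Fin N) ℂ).det := by
    have h := Polynomial.coeff_map (p := (coordMatrix N).charpoly)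
      (ContinuousMap.evalAlgHom ℂ ℂ U : _ →+* ℂ) 0
    rw [← charpoly_map, map_evalAlgHom_coordMatrix] at h
    rw [det_eq_sign_charpoly_coeff, Fintype.card_fin, ← mul_assoc, ← mul_pow, h]
    simp
  have hterm (U : unitaryGroup (Fin N) ℂ) : (U : Matrix (Fin N) (Fin N) ℂ).det⁻¹ ^ m *
      ((-1) ^ N * (U : Matrix (Fin N) (Fin N) ℂ).det) ^ m = ((-1) ^ N) ^ m := by
    rw [← mul_pow, mul_left_comm, inv_mul_cancel₀ (det_ne_zero_of_mem_unitaryGroup U.2), mul_one]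
  simp only [haarMean_apply, ContinuousMap.pow_apply, hcoeff, hterm]
  simp

end HaarFunctional

section ToeplitzComplement

open Matrix Polynomial

variable {R S : Type*} [CommRing R] [CommRing S]

/-- The Toeplitz matrix of the coefficients of `p`, shifted so that the coefficient of `X ^ m`
stands on the diagonal. -/
noncomputable def coeffToeplitz (p : R[X]) (m N : ℕ) : Matrix (Fin N) (Fin N) R :=
  of fun i j => (X ^ (j : ℕ) * p).coeff (m + i)

theorem coeffToeplitz_C_mul (a : R) (p : R[X]) (m N : ℕ) :
    coeffToeplitz (C a * p) m N = a • coeffToeplitz p m N := by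
  ext i j
  simp only [coeffToeplitz, of_apply, Matrix.smul_apply, smul_eq_mul, mul_left_comm _ (C a),
    coeff_C_mul]

theorem map_coeffToeplitz (f : R →+* S) (p : R[X]) (m N : ℕ) :
    (coeffToeplitz p m N).map f = coeffToeplitz (p.map f) m N := by
  ext i j
  simp only [coeffToeplitz, map_apply, of_apply, ← coeff_map, Polynomial.map_mul,
    Polynomial.map_pow, map_X]

theorem det_coeffToeplitz_natDegree {p : R[X]} {n : ℕ} (hp : p.Monic) (hn : p.natDegree = n)
    (N : ℕ) : (coeffToeplitz p n N).det = 1 := by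
  subst hn
  rw [det_of_isUpperTriangular fun i j (hij : j < i) => ?_]
  · refine Finset.prod_eq_one fun i _ => ?_
    rw [coeffToeplitz, of_apply, coeff_X_pow_mul, hp.coeff_natDegree]
  · rw [coeffToeplitz, of_apply, coeff_X_pow_mul', if_pos (by omega)]
    exact coeff_eq_zero_of_natDegree_lt (by omega)

variable {N m n : ℕ}

/-- The enumeration of the numbers below `n + N` that lists the exponents `gapExp N m l` with
`l < n` first and the gap `m, …, m + N - 1` last. -/
noncomputable def gapEquiv (N : ℕ) (hmn : m ≤ n) : Fin n ⊕ Fin N ≃ Fin (n + N) :=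
  Equiv.ofBijective
    (Sum.elim (fun l => ⟨gapExp N m l, by have := l.2; grind [gapExp]⟩) fun i => ⟨m + i, by omega⟩)
    ((Fintype.bijective_iff_injective_and_card _).2 ⟨by
      rintro (a | a) (b | b) h <;>
        simp only [Sum.elim_inl, Sum.elim_inr, Fin.mk.injEq, gapExp] at h <;>
        grind, by simp⟩)

theorem gapEquiv_inl (hmn : m ≤ n) (l : Fin n) : (gapEquiv N hmn (.inl l) : ℕ) = gapExp N m l :=
  rfl

theorem gapEquiv_inr (hmn : m ≤ n) (i : Fin N) : (gapEquiv N hmn (.inr i) : ℕ) = m + i :=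
  rfl

/-- The block matrix whose first rows are the powers of the `x k` with exponents below `n + N`,
completed by unit rows to a square matrix. -/
def powerBlock (x : Fin n → R) (N : ℕ) : Matrix (Fin n ⊕ Fin N) (Fin n ⊕ Fin N) R :=
  fromBlocks (vandermonde x) (of fun k i => x k ^ (n + (i : ℕ))) 0 1

/-- The matrix whose columns are the unit vectors at the exponents `gapExp N m l`, followed by the
coefficient vectors of the polynomials `X ^ j * g`. -/
noncomputable def bandBlock (g : R[X]) (N m n : ℕ) : Matrix (Fin n ⊕ Fin N) (Fin n ⊕ Fin N) R :=
  of fun r => Sum.elim (fun l => if (finSumFinEquiv r : ℕ) = gapExp N m l then 1 else 0)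
    fun j => (X ^ (j : ℕ) * g).coeff (finSumFinEquiv r)

theorem det_powerBlock (x : Fin n → R) (N : ℕ) : (powerBlock x N).det = (vandermonde x).det := by
  rw [powerBlock, det_fromBlocks_zero₂₁, det_one, mul_one]

theorem det_bandBlock (g : R[X]) (hmn : m ≤ n) :
    (bandBlock g N m n).det =
      (Equiv.Perm.sign ((gapEquiv N hmn).trans finSumFinEquiv.symm) : ℤ) *
        (coeffToeplitz g m N).det := by
  set τ := (gapEquiv N hmn).trans finSumFinEquiv.symm with hτ
  have hblocks : (bandBlock g N m n).submatrix τ id = fromBlocks 1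
      (of fun l (j : Fin N) => (X ^ (j : ℕ) * g).coeff (gapExp N m l)) 0 (coeffToeplitz g m N) := by
    ext (l | i) (l' | j)
    · simp [bandBlock, hτ, gapEquiv_inl, Matrix.one_apply, (gapExp_val_injective).eq_iff]
    · simp [bandBlock, hτ, gapEquiv_inl]
    · simp only [bandBlock, hτ, submatrix_apply, id, of_apply, Sum.elim_inl, Equiv.trans_apply,
        Equiv.apply_symm_apply, gapEquiv_inr, fromBlocks_apply₂₁, Matrix.zero_apply]
      exact if_neg (by grind [gapExp])
    · simp [bandBlock, hτ, gapEquiv_inr, coeffToeplitz]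
  have hdet := det_permute τ (bandBlock g N m n)
  rw [hblocks, det_fromBlocks_zero₂₁, det_one, one_mul] at hdet
  rw [hdet, ← mul_assoc, ← Int.cast_mul, ← Units.val_mul, Int.units_mul_self, Units.val_one,
    Int.cast_one, one_mul]

theorem sum_powerBlock_inl_mul (x : Fin n → R) (k : Fin n) (f : ℕ → R) :
    ∑ r, powerBlock x N (.inl k) r * f (finSumFinEquiv r) =
      ∑ s ∈ Finset.range (n + N), x k ^ s * f s := by
  rw [← Fin.sum_univ_eq_sum_range (fun s => x k ^ s * f s), ← finSumFinEquiv.sum_comp]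
  refine Finset.sum_congr rfl fun r _ => ?_
  rcases r with i | i <;> simp [powerBlock, vandermonde_apply]

theorem powerBlock_mul_bandBlock {x : Fin n → R} {g : R[X]} (hg : g.natDegree = n)
    (hx : ∀ k, g.eval (x k) = 0) (hmn : m ≤ n) :
    powerBlock x N * bandBlock g N m n =
      fromBlocks (of fun k j : Fin n => x k ^ gapExp N m j) 0
        (bandBlock g N m n).toBlocks₂₁ (coeffToeplitz g n N) := by
  ext (k | i) (l | j)
  · have hsum := sum_powerBlock_inl_mul (N := N) x k fun s => if s = gapExp N m l then 1 else 0
    simp only [mul_ite, mul_one, mul_zero, Finset.sum_ite_eq', Finset.mem_range] at hsum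
    rw [if_pos (by have := l.2; grind [gapExp])] at hsum
    simpa [mul_apply, bandBlock] using hsum
  · have hdeg : (X ^ (j : ℕ) * g).natDegree < n + N :=
      natDegree_mul_le.trans_lt (by have := natDegree_X_pow_le (R := R) (j : ℕ); omega)
    have heval := eval_eq_sum_range' hdeg (x k)
    rw [eval_mul, hx, mul_zero] at heval
    rw [mul_apply, fromBlocks_apply₁₂, Matrix.zero_apply, heval]
    refine (sum_powerBlock_inl_mul x k fun s => (X ^ (j : ℕ) * g).coeff s).trans ?_
    exact Finset.sum_congr rfl fun _ _ => mul_comm _ _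
  · simp [mul_apply, powerBlock, Matrix.one_apply, toBlocks₂₁]
  · simp [mul_apply, powerBlock, Matrix.one_apply, bandBlock, coeffToeplitz]

theorem det_vandermonde_mul_det_coeffToeplitz {x : Fin n → R} {g : R[X]} (hmonic : g.Monic)
    (hg : g.natDegree = n) (hx : ∀ k, g.eval (x k) = 0) (hmn : m ≤ n) :
    (vandermonde x).det * ((Equiv.Perm.sign ((gapEquiv N hmn).trans finSumFinEquiv.symm) : ℤ) *
        (coeffToeplitz g m N).det) =
      (of fun k j : Fin n => x k ^ gapExp N m j).det := by
  have hdet := congrArg det (powerBlock_mul_bandBlock (N := N) hg hx hmn)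
  rwa [det_mul, det_powerBlock, det_bandBlock g hmn, det_fromBlocks_zero₁₂, 
    det_coeffToeplitz_natDegree hmonic hg, mul_one] at hdet

end ToeplitzComplement

section HaarToeplitz

open Matrix Polynomial

theorem eval_charProd {σ ι R : Type*} [Fintype ι] [DecidableEq ι] [CommRing R] (A : Matrix ι ι R)
    (s : Finset σ) (x : σ → R) :
    MvPolynomial.eval x (charProd A s) = ∏ k ∈ s, A.charpoly.eval (x k) := by
  have hC : (MvPolynomial.eval x).comp MvPolynomial.C = RingHom.id R := by ext; simp
  simp only [charProd, map_prod, aeval_def, hom_eval₂, MvPolynomial.algebraMap_eq, hC,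
    MvPolynomial.eval_X, eval₂_id]

theorem haarMean_prod_charpoly {N m n : ℕ} (hmn : m ≤ n) (x : Fin n → ℂ) :
    haarMean N m (∏ k, (coordMatrix N).charpoly.eval (algebraMap ℂ _ (x k))) =
      ((-1) ^ N) ^ m * ((Equiv.Perm.sign ((gapEquiv N hmn).trans finSumFinEquiv.symm) : ℤ) *
        (coeffToeplitz (∏ k, (X - C (x k))) m N).det) := by
  set g : (MvPolynomial (Fin n) ℂ)[X] := ∏ k, (X - C (MvPolynomial.X k)) with hg
  have hmonic : g.Monic := monic_prod_of_monic _ _ fun k _ => monic_X_sub_C _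
  have hdeg : g.natDegree = n := by
    rw [hg, natDegree_prod_of_monic _ _ fun k _ => monic_X_sub_C _]
    simp
  have hroot (k : Fin n) : g.eval (MvPolynomial.X k) = 0 := by
    rw [hg, eval_prod]
    exact Finset.prod_eq_zero (Finset.mem_univ k) (by simp)
  have hgap := vdmPoly_mul_coeffMap_charProd (isUnitaryRelInvariant_haarMean (N := N) (m := m))
    (by simpa using hmn) (by simp [haarMean_coeff_charpoly_coordMatrix_pow])
  rw [haarMean_coeff_charpoly_coordMatrix_pow, Fintype.card_fin, gapAlternant,
    ← det_vandermonde_mul_det_coeffToeplitz hmonic hdeg hroot hmn, ← vdmPoly, mul_left_comm] at hgap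
  have heval := congrArg (MvPolynomial.eval x) (mul_left_cancel₀ (vdmPoly_ne_zero n ℂ) hgap)
  have hmap : (MvPolynomial.eval x).mapMatrix (coeffToeplitz g m N) =
      coeffToeplitz (∏ k, (X - C (x k))) m N := by
    rw [RingHom.mapMatrix_apply, map_coeffToeplitz]
    simp [hg, Polynomial.map_prod]
  rw [eval_coeffMap, map_mul, MvPolynomial.eval_C, map_mul, map_intCast, RingHom.map_det, hmap]
    at heval
  rw [← heval, eval_charProd]

theorem exists_eq_C_mul_prod_X_sub_C {K : Type*} [Field K] [IsAlgClosed K] (p : K[X]) {n : ℕ}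
    (hn : p.natDegree = n) :
    ∃ x : Fin n → K, p = C p.leadingCoeff * ∏ k, (X - C (x k)) := by
  have hcard : p.roots.card = p.natDegree := (IsAlgClosed.splits p).natDegree_eq_card_roots.symm
  have hlength : n = p.roots.toList.length := by rw [Multiset.length_toList, hcard, hn]
  refine ⟨fun k => p.roots.toList[finCongr hlength k], ?_⟩
  rw [(finCongr hlength).prod_comp fun k => X - C p.roots.toList[k]]
  conv_lhs => rw [← C_leadingCoeff_mul_prod_multiset_X_sub_C hcard, ← Multiset.coe_toList p.roots]
  rw [Multiset.map_coe, Multiset.prod_coe]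
  exact congrArg _ (Fin.prod_univ_fun_getElem p.roots.toList fun a => X - C a).symm

theorem det_aeval_X_sub_C {ι R A : Type*} [Fintype ι] [DecidableEq ι] [CommRing R] [CommRing A]
    [Algebra R A] (M : Matrix ι ι A) (a : R) :
    (aeval M (X - C a)).det =
      (-1) ^ Fintype.card ι * M.charpoly.eval (algebraMap R A a) := by
  rw [eval_charpoly, ← det_neg, neg_sub, aeval_sub, aeval_X, aeval_C, scalar_apply,
    algebraMap_eq_diagonal]
  rfl

theorem det_aeval_C_mul_prod_X_sub_C {κ ι R A : Type*} [Fintype κ] [Fintype ι] [DecidableEq ι]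
    [CommRing R] [CommRing A] [Algebra R A] (M : Matrix ι ι A) (a : R) (x : κ → R) :
    (aeval M (C a * ∏ k, (X - C (x k)))).det =
      (a ^ Fintype.card ι * ((-1) ^ Fintype.card ι) ^ Fintype.card κ) •
        ∏ k, M.charpoly.eval (algebraMap R A (x k)) := by
  have hprod : (aeval M (∏ k, (X - C (x k)))).det = ∏ k, (aeval M (X - C (x k))).det :=
    map_prod (detMonoidHom.comp (aeval M : R[X] →ₐ[R] Matrix ι ι A).toMonoidHom) _ _
  rw [aeval_mul, aeval_C, det_mul, hprod, Algebra.smul_def, map_mul]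
  simp only [det_aeval_X_sub_C, Finset.prod_mul_distrib, Finset.prod_const, Finset.card_univ,
    algebraMap_eq_diagonal, det_diagonal, Pi.algebraMap_apply, map_pow, map_neg, map_one]
  ring

theorem norm_haarMean_det_aeval {N m : ℕ} (p : ℂ[X]) (hm : m ≤ p.natDegree) :
    ‖haarMean N m (aeval (coordMatrix N) p).det‖ = ‖(coeffToeplitz p m N).det‖ := by
  obtain ⟨x, hx⟩ := exists_eq_C_mul_prod_X_sub_C p rfl
  rw [hx, det_aeval_C_mul_prod_X_sub_C, map_smul, haarMean_prod_charpoly hm, coeffToeplitz_C_mul,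
    det_smul]
  rcases Int.units_eq_one_or
    (Equiv.Perm.sign ((gapEquiv N hm).trans finSumFinEquiv.symm)) with h | h <;> simp [h]

end HaarToeplitz

section CauchyBinet

open Matrix Filter Topology

theorem det_mul_eq_sum_prod_mul_det_submatrix {ι κ R : Type*} [Fintype ι] [DecidableEq ι]
    [Fintype κ] [CommRing R] (A : Matrix ι κ R) (B : Matrix κ ι R) :
    (A * B).det = ∑ p : ι → κ, (∏ i, A i (p i)) * (B.submatrix p id).det := by
  classical
  have hmul : A * B = fun i => ∑ k, A i k • B k := by
    ext i j
    simp [mul_apply]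
  rw [hmul]
  change (detRowAlternating : (ι → R) [⋀^ι]→ₗ[R] R).toMultilinearMap _ = _
  rw [MultilinearMap.map_sum]
  exact Finset.sum_congr rfl fun p _ => MultilinearMap.map_smul_univ _ _ _

theorem exists_orderEmbedding_comp_perm {N : ℕ} {κ : Type*} [LinearOrder κ] {p : Fin N → κ}
    (hp : p.Injective) : ∃ (f : Fin N ↪o κ) (σ : Equiv.Perm (Fin N)), f ∘ σ = p := by
  have hcard : (Finset.univ.image p).card = N := by
    rw [Finset.card_image_of_injective _ hp, Finset.card_univ, Fintype.card_fin]
  set f := (Finset.univ.image p).orderEmbOfFin hcard with hf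
  have hmem (i : Fin N) : p i ∈ Set.range f := by
    rw [hf, Finset.range_orderEmbOfFin]
    simp
  choose g hg using hmem
  have hginj : Function.Injective g := fun a b h => hp (by rw [← hg a, ← hg b, h])
  exact ⟨f, Equiv.ofBijective g (Finite.injective_iff_bijective.1 hginj), funext hg⟩

theorem injective_orderEmbedding_comp_perm {N : ℕ} {κ : Type*} [LinearOrder κ] :
    Function.Injective fun x : (Fin N ↪o κ) × Equiv.Perm (Fin N) => x.1 ∘ x.2 := by
  rintro ⟨f, σ⟩ ⟨g, τ⟩ h
  have hrange : Set.range f = Set.range g := by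
    simpa only [EquivLike.range_comp] using congrArg Set.range h
  obtain rfl : f = g := OrderEmbedding.range_inj.1 hrange
  obtain rfl : σ = τ := Equiv.ext fun i => f.injective (congrFun h i)
  rfl

theorem det_mul_eq_sum_orderEmbedding {N : ℕ} {κ R : Type*} [Fintype κ] [LinearOrder κ]
    [CommRing R] (A : Matrix (Fin N) κ R) (B : Matrix κ (Fin N) R) :
    (A * B).det = ∑ f : Fin N ↪o κ, (A.submatrix id f).det * (B.submatrix f id).det := by
  have hperm (f : Fin N ↪o κ) : (A.submatrix id f).det * (B.submatrix f id).det =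
      ∑ σ : Equiv.Perm (Fin N), (∏ i, A i ((f ∘ σ) i)) * (B.submatrix (f ∘ σ) id).det := by
    rw [← det_transpose (A.submatrix id f), det_apply, Finset.sum_mul]
    refine Finset.sum_congr rfl fun σ _ => ?_
    have hσ : (B.submatrix (f ∘ σ) id).det = Equiv.Perm.sign σ * (B.submatrix f id).det :=
      det_permute σ (B.submatrix f id)
    rw [hσ, Units.smul_def, zsmul_eq_mul, mul_comm _ (∏ i, _), mul_assoc]
    rfl
  rw [det_mul_eq_sum_prod_mul_det_submatrix, Finset.sum_congr rfl fun f _ => hperm f,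
    ← Fintype.sum_prod_type']
  refine (Finset.sum_of_injOn _ injective_orderEmbedding_comp_perm.injOn
    (fun _ _ => Finset.mem_coe.2 (Finset.mem_univ _)) (fun p _ hp => ?_) fun _ _ => rfl).symm
  have hninj : ¬ p.Injective := fun hinj => hp <| by
    obtain ⟨f, σ, hfσ⟩ := exists_orderEmbedding_comp_perm hinj
    exact ⟨(f, σ), Finset.mem_coe.2 (Finset.mem_univ _), hfσ⟩
  obtain ⟨a, b, hab, hne⟩ := Function.not_injective_iff.1 hninj
  rw [det_zero_of_row_eq hne (by ext j; simp [hab]), mul_zero]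

theorem hasSum_of_tendsto_sum_of_nonneg {α β : Type*} {f : α → ℝ} (hf : ∀ i, 0 ≤ f i)
    {l : Filter β} [l.NeBot] {s : β → Finset α} (hs : Tendsto s l atTop) {a : ℝ}
    (h : Tendsto (fun b => ∑ i ∈ s b, f i) l (𝓝 a)) : HasSum f a := by
  have hsummable : Summable f := summable_of_sum_le hf fun u =>
    ge_of_tendsto h <| (hs.eventually_ge_atTop u).mono fun b hb =>
      Finset.sum_le_sum_of_subset_of_nonneg hb fun i _ _ => hf i
  rw [← tendsto_nhds_unique (hsummable.hasSum.comp hs) h]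
  exact hsummable.hasSum

/-- The strictly increasing sequences of length `N` with values below `L`. -/
noncomputable def strictMonoBelow (N L : ℕ) : Finset {s : Fin N → ℕ // StrictMono s} :=
  Finset.univ.map ⟨fun f : Fin N ↪o Fin L => ⟨fun j => f j, fun _ _ h => f.strictMono h⟩,
    fun f g h => by
      ext j
      exact congrFun (congrArg Subtype.val h) j⟩

theorem mem_strictMonoBelow {N L : ℕ} {s : {s : Fin N → ℕ // StrictMono s}} :
    s ∈ strictMonoBelow N L ↔ ∀ j, s.1 j < L := by
  simp only [strictMonoBelow, Finset.mem_map, Finset.mem_univ, true_and]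
  refine ⟨?_, fun h => ⟨OrderEmbedding.ofStrictMono (fun j => ⟨s.1 j, h j⟩) fun _ _ hab => s.2 hab,
    rfl⟩⟩
  rintro ⟨f, rfl⟩ j
  exact (f j).2

theorem tendsto_strictMonoBelow (N : ℕ) : Tendsto (strictMonoBelow N) atTop atTop := by
  refine tendsto_atTop_finset_of_monotone
    (fun L L' hL s hs => mem_strictMonoBelow.2 fun j => (mem_strictMonoBelow.1 hs j).trans_le hL)
    fun s => ⟨∑ j, s.1 j + 1, mem_strictMonoBelow.2 fun j => Nat.lt_succ_of_le ?_⟩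
  exact Finset.single_le_sum (f := s.1) (fun _ _ => Nat.zero_le _) (Finset.mem_univ j)

theorem sum_strictMonoBelow_det_sq {N : ℕ} {R : Type*} [CommRing R] (B : Fin N → ℕ → R) (L : ℕ) :
    ∑ s ∈ strictMonoBelow N L, (of fun i j => B i (s.1 j)).det ^ 2 =
      (of fun i j => ∑ s ∈ Finset.range L, B i s * B j s).det := by
  set A : Matrix (Fin N) (Fin L) R := of fun i s => B i s with hA
  have hgram : (of fun i j => ∑ s ∈ Finset.range L, B i s * B j s) = A * Aᵀ := by
    ext i j
    simp only [hA, mul_apply, of_apply, transpose_apply, Finset.sum_range]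
  rw [hgram, det_mul_eq_sum_orderEmbedding, strictMonoBelow, Finset.sum_map]
  refine Finset.sum_congr rfl fun f _ => ?_
  rw [← transpose_submatrix, det_transpose, ← sq]
  rfl

theorem hasSum_det_sq_strictMono {N : ℕ} {B : Fin N → ℕ → ℝ}
    (hB : ∀ i j, Summable fun s => B i s * B j s) :
    HasSum (fun s : {s : Fin N → ℕ // StrictMono s} => (of fun i j => B i (s.1 j)).det ^ 2)
      (of fun i j => ∑' s, B i s * B j s).det := by
  refine hasSum_of_tendsto_sum_of_nonneg (fun s => sq_nonneg _) (tendsto_strictMonoBelow N) ?_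
  simp only [sum_strictMonoBelow_det_sq]
  exact (continuous_id.matrix_det.tendsto _).comp <|
    tendsto_pi_nhds.2 fun i => tendsto_pi_nhds.2 fun j => (hB i j).hasSum.tendsto_sum_nat

end CauchyBinet

section ReflectedPolynomial

open Polynomial

theorem aeval_reflect_of_mul_eq_one {R A : Type*} [CommSemiring R] [Semiring A] [Algebra R A]
    {u v : A} (huv : u * v = 1) {p : R[X]} {M : ℕ} (hp : p.natDegree ≤ M) :
    aeval u (p.reflect M) = u ^ M * aeval v p := by
  have hpow (n : ℕ) : u ^ n * v ^ n = 1 := by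
    induction n with
    | zero => simp
    | succ n ih => rw [pow_succ, pow_succ', mul_assoc, ← mul_assoc u, huv, one_mul, ih]
  refine induction_with_natDegree_le
    (fun p => aeval u (p.reflect M) = u ^ M * aeval v p) M (by simp) ?_ ?_ p hp
  · intro n a _ hn
    rw [reflect_C_mul_X_pow, revAt_le hn, aeval_mul, aeval_mul, aeval_C, aeval_C, aeval_X_pow,
      aeval_X_pow, ← mul_assoc, (Algebra.commutes a (u ^ M)).symm, mul_assoc]
    conv_rhs => rw [← Nat.sub_add_cancel hn, pow_add, mul_assoc, hpow, mul_one]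
  · intro p₁ p₂ _ _ h₁ h₂
    rw [reflect_add, map_add, map_add, h₁, h₂, mul_add]

theorem coeff_mul_reflect {R : Type*} [Semiring R] (f : R[X]) {p : R[X]} {M : ℕ}
    (hp : p.natDegree ≤ M) (i : ℕ) :
    (f * p.reflect M).coeff (M + i) =
      ∑ c ∈ Finset.range (M + 1), f.coeff (i + c) * p.coeff c := by
  refine induction_with_natDegree_le
    (fun p => (f * p.reflect M).coeff (M + i) =
      ∑ c ∈ Finset.range (M + 1), f.coeff (i + c) * p.coeff c) M (by simp) ?_ ?_ p hp
  · intro n a _ hn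
    have hsplit : M + i = i + n + (M - n) := by omega
    rw [reflect_C_mul_X_pow, revAt_le hn, ← mul_assoc, hsplit, coeff_mul_X_pow, coeff_mul_C,
      Finset.sum_eq_single n]
    · simp
    · intro c _ hc
      simp [coeff_X_pow, hc]
    · intro h
      exact absurd (Finset.mem_range.2 (by omega)) h
  · intro p₁ p₂ _ _ h₁ h₂
    simp only [reflect_add, mul_add, coeff_add, h₁, h₂, Finset.sum_add_distrib]

theorem le_natDegree_mul_reflect {R : Type*} [Semiring R] [NoZeroDivisors R] {p : R[X]}
    (hp : p.coeff 0 ≠ 0) (M : ℕ) : M ≤ (p * p.reflect M).natDegree := by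
  have hcoeff : (p.reflect M).coeff M ≠ 0 := by
    rwa [coeff_reflect, revAt_le le_rfl, Nat.sub_self]
  have hp0 : p ≠ 0 := fun h => hp (by simp [h])
  have hreflect : p.reflect M ≠ 0 := fun h => hcoeff (by simp [h])
  rw [natDegree_mul hp0 hreflect]
  exact le_add_left (le_natDegree_of_ne_zero hcoeff)

theorem star_aeval {R A : Type*} [CommSemiring R] [StarRing R] [TrivialStar R] [Semiring A]
    [StarRing A] [Algebra R A] [StarModule R A] (a : A) (p : R[X]) :
    star (aeval a p) = aeval (star a) p := by
  induction p using Polynomial.induction_on with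
  | C r => rw [aeval_C, aeval_C, ← algebraMap_star_comm, star_trivial]
  | add p₁ p₂ h₁ h₂ => simp only [map_add, star_add, h₁, h₂]
  | monomial n r _ =>
    rw [aeval_mul, aeval_mul, aeval_C, aeval_C, aeval_X_pow, aeval_X_pow, star_mul, star_pow,
      ← algebraMap_star_comm, star_trivial r, Algebra.commutes]

end ReflectedPolynomial

section HaarReflected

open Polynomial Matrix MeasureTheory

variable {N M : ℕ} {p : ℝ[X]}

theorem inv_det_pow_mul_det_aeval_mul_reflect (U : unitaryGroup (Fin N) ℂ)
    (hp : p.natDegree ≤ M) :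
    (U : Matrix (Fin N) (Fin N) ℂ).det⁻¹ ^ M *
        (aeval (U : Matrix (Fin N) (Fin N) ℂ) (p * p.reflect M)).det =
      ((‖(aeval (U : Matrix (Fin N) (Fin N) ℂ) p).det‖ ^ 2 : ℝ) : ℂ) := by
  have hdet := pow_ne_zero M (det_ne_zero_of_mem_unitaryGroup U.2)
  rw [aeval_mul, aeval_reflect_of_mul_eq_one (mem_unitaryGroup_iff.1 U.2) hp, ← star_aeval,
    det_mul, det_mul, det_pow, star_eq_conjTranspose, det_conjTranspose, inv_pow,
    Complex.ofReal_pow, ← Complex.mul_conj', RCLike.star_def]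
  field_simp

theorem integral_norm_det_aeval_sq (N : ℕ) (hp : p.natDegree ≤ M) (h0 : p.coeff 0 ≠ 0) :
    ∫ U : unitaryGroup (Fin N) ℂ,
        ‖(aeval (U : Matrix (Fin N) (Fin N) ℂ) p).det‖ ^ 2 ∂haarU N =
      |(coeffToeplitz (p * p.reflect M) M N).det| := by
  set g : ℂ[X] := (p * p.reflect M).map (algebraMap ℝ ℂ) with hg
  have hdeg : M ≤ g.natDegree := by
    rw [hg, natDegree_map]
    exact le_natDegree_mul_reflect h0 M
  have heval (U : unitaryGroup (Fin N) ℂ) : (aeval (coordMatrix N) g).det U =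
      (aeval (U : Matrix (Fin N) (Fin N) ℂ) (p * p.reflect M)).det := by
    change (ContinuousMap.evalAlgHom ℂ ℂ U : C(unitaryGroup (Fin N) ℂ, ℂ) →+* ℂ) _ = _
    rw [RingHom.map_det, ← aeval_map_algebraMap ℂ (U : Matrix (Fin N) (Fin N) ℂ), ← hg]
    exact congrArg det (aeval_algHom_apply (ContinuousMap.evalAlgHom ℂ ℂ U).mapMatrix _ g).symm
  have hnorm := norm_haarMean_det_aeval (N := N) g hdeg
  simp only [haarMean_apply, heval, inv_det_pow_mul_det_aeval_mul_reflect _ hp] at hnorm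
  rw [integral_complex_ofReal, Complex.norm_real, Real.norm_of_nonneg
    (integral_nonneg fun U => by positivity), hg, ← map_coeffToeplitz] at hnorm
  rw [hnorm, ← RingHom.mapMatrix_apply, ← RingHom.map_det, Complex.coe_algebraMap,
    Complex.norm_real, Real.norm_eq_abs]

end HaarReflected

section ShiftedSequences

/-- The sequence `h` shifted by `i` to the right; these are the rows of the infinite Toeplitz
matrix of `h`. -/
def shiftSeq (h : ℕ → ℝ) (i s : ℕ) : ℝ := if i ≤ s then h (s - i) else 0

variable {h : ℕ → ℝ}

theorem abs_shiftSeq_le (hh : Summable fun r => |h r|) (i s : ℕ) :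
    |shiftSeq h i s| ≤ ∑' r, |h r| := by
  rw [shiftSeq]
  split_ifs
  · exact hh.le_tsum _ fun _ _ => abs_nonneg _
  · rw [abs_zero]
    exact tsum_nonneg fun _ => abs_nonneg _

theorem summable_abs_shiftSeq (hh : Summable fun r => |h r|) (i : ℕ) :
    Summable fun s => |shiftSeq h i s| := by
  rw [← summable_nat_add_iff i]
  simpa [shiftSeq] using hh

theorem summable_shiftSeq_mul (hh : Summable fun r => |h r|) (i j : ℕ) :
    Summable fun s => shiftSeq h i s * shiftSeq h j s := by
  refine Summable.of_norm_bounded ((summable_abs_shiftSeq hh i).mul_right (∑' r, |h r|)) fun s => ?_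
  rw [Real.norm_eq_abs, abs_mul]
  exact mul_le_mul_of_nonneg_left (abs_shiftSeq_le hh j s) (abs_nonneg _)

theorem hasSum_shiftSeq_mul (hh : Summable fun r => |h r|) (i j : ℕ) :
    HasSum (fun c => shiftSeq h j (i + c) * h c) (∑' s, shiftSeq h i s * shiftSeq h j s) := by
  have hvanish : ∑ s ∈ Finset.range i, shiftSeq h i s * shiftSeq h j s = 0 :=
    Finset.sum_eq_zero fun s hs => by
      rw [shiftSeq, if_neg (by simpa using hs), zero_mul]
  have htail := (hasSum_nat_add_iff' i).2 (summable_shiftSeq_mul hh i j).hasSum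
  rw [hvanish, sub_zero] at htail
  refine htail.congr_fun fun c => ?_
  simp [shiftSeq, add_comm, mul_comm]

end ShiftedSequences

section HaarLimit

open Polynomial Matrix MeasureTheory Filter Topology

/-- The polynomial truncation `∑_{r ≤ M} h_r X^r` of the generating series of `h`. -/
noncomputable def truncPoly (h : ℕ → ℝ) (M : ℕ) : ℝ[X] :=
  PowerSeries.trunc (M + 1) (PowerSeries.mk h)

theorem coeff_truncPoly (h : ℕ → ℝ) (M r : ℕ) :
    (truncPoly h M).coeff r = if r < M + 1 then h r else 0 := by
  rw [truncPoly, PowerSeries.coeff_trunc, PowerSeries.coeff_mk]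

theorem natDegree_truncPoly_le (h : ℕ → ℝ) (M : ℕ) : (truncPoly h M).natDegree ≤ M :=
  Nat.lt_succ_iff.1 (PowerSeries.natDegree_trunc_lt _ _)

theorem aeval_truncPoly {A : Type*} [Semiring A] [Algebra ℝ A] (h : ℕ → ℝ) (M : ℕ) (a : A) :
    aeval a (truncPoly h M) = ∑ r ∈ Finset.range (M + 1), h r • a ^ r := by
  rw [aeval_eq_sum_range' (Nat.lt_succ_of_le (natDegree_truncPoly_le h M))]
  refine Finset.sum_congr rfl fun r hr => ?_
  rw [coeff_truncPoly, if_pos (Finset.mem_range.1 hr)]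

theorem coeff_X_pow_mul_truncPoly_mul_reflect (h : ℕ → ℝ) (M i j : ℕ) :
    (X ^ j * (truncPoly h M * (truncPoly h M).reflect M)).coeff (M + i) =
      ∑ c ∈ Finset.range (min (M + 1) (M + 1 + j - i)), shiftSeq h j (i + c) * h c := by
  have hrange : Finset.range (min (M + 1) (M + 1 + j - i)) =
      (Finset.range (M + 1)).filter (· < M + 1 + j - i) := by
    ext c
    simp
  rw [← mul_assoc, coeff_mul_reflect _ (natDegree_truncPoly_le h M), hrange, Finset.sum_filter]
  refine Finset.sum_congr rfl fun c hc => ?_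
  rw [coeff_X_pow_mul', coeff_truncPoly, coeff_truncPoly, if_pos (Finset.mem_range.1 hc), shiftSeq]
  split_ifs <;> first | omega | simp

variable {h : ℕ → ℝ}

theorem tendsto_det_coeffToeplitz_truncPoly (N : ℕ) (hh : Summable fun r => |h r|) :
    Tendsto (fun M => (coeffToeplitz (truncPoly h M * (truncPoly h M).reflect M) M N).det) atTop
      (𝓝 (of fun i j : Fin N => ∑' s, shiftSeq h i s * shiftSeq h j s).det) := by
  refine ((continuous_id.matrix_det).tendsto _).comp ?_
  refine tendsto_pi_nhds.2 fun i => tendsto_pi_nhds.2 fun j => ?_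
  simp only [of_apply, coeff_X_pow_mul_truncPoly_mul_reflect]
  refine (hasSum_shiftSeq_mul hh i j).tendsto_sum_nat.comp (tendsto_atTop.2 fun b => ?_)
  filter_upwards [eventually_ge_atTop (b + i)] with M hM
  omega

theorem tendstoUniformlyOn_aeval_truncPoly (hh : Summable fun r => |h r|) {F : ℂ → ℂ}
    (hF : ∀ z : ℂ, ‖z‖ = 1 → HasSum (fun r => (h r : ℂ) * z ^ r) (F z)) :
    TendstoUniformlyOn (fun M z => aeval z (truncPoly h M)) F atTop (Metric.sphere (0 : ℂ) 1) := by
  have htsum := tendstoUniformlyOn_tsum_nat (f := fun r (z : ℂ) => (h r : ℂ) * z ^ r)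
    (s := Metric.sphere (0 : ℂ) 1) hh fun r z hz => by simp [mem_sphere_zero_iff_norm.1 hz]
  have hpartial := htsum.congr_right fun z hz => (hF z (mem_sphere_zero_iff_norm.1 hz)).tsum_eq
  intro u hu
  filter_upwards [(tendsto_add_atTop_nat 1).eventually (hpartial u hu)] with M hM z hz
  simpa only [aeval_truncPoly, Complex.real_smul] using hM z hz

theorem norm_det_aeval_truncPoly_le {N : ℕ} (hh : Summable fun r => |h r|) (M : ℕ)
    (U : unitaryGroup (Fin N) ℂ) :
    ‖(aeval (U : Matrix (Fin N) (Fin N) ℂ) (truncPoly h M)).det‖ ≤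
      N.factorial • (∑' r, |h r|) ^ N := by
  have hentry (i j : Fin N) :
      ‖aeval (U : Matrix (Fin N) (Fin N) ℂ) (truncPoly h M) i j‖ ≤ ∑' r, |h r| := by
    rw [aeval_truncPoly, Matrix.sum_apply]
    calc ‖∑ r ∈ Finset.range (M + 1), (h r • (U : Matrix (Fin N) (Fin N) ℂ) ^ r) i j‖
        ≤ ∑ r ∈ Finset.range (M + 1), |h r| := norm_sum_le_of_le _ fun r _ => by
          rw [Matrix.smul_apply, norm_smul, Real.norm_eq_abs]
          exact mul_le_of_le_one_right (abs_nonneg _) (entry_norm_bound_of_unitary (U ^ r).2 i j)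
      _ ≤ ∑' r, |h r| := hh.sum_le_tsum _ fun _ _ => abs_nonneg _
  exact (Matrix.det_le (abv := NormedField.toAbsoluteValue ℂ) hentry).trans_eq (by simp)

section FunctionalCalculus

open scoped Matrix.Norms.L2Operator

variable {N : ℕ} {f F : ℂ → ℂ}

theorem det_matrixFun_of_eq_mul_star (U : unitaryGroup (Fin N) ℂ)
    (hF : ContinuousOn F (Metric.sphere 0 1)) (hf : ∀ z : ℂ, ‖z‖ = 1 → f z = F z * star (F z)) :
    (matrixFun f (U : Matrix (Fin N) (Fin N) ℂ)).det =
      ((‖(matrixFun F (U : Matrix (Fin N) (Fin N) ℂ)).det‖ ^ 2 : ℝ) : ℂ) := by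
  have hsp : spectrum ℂ (U : Matrix (Fin N) (Fin N) ℂ) ⊆ Metric.sphere 0 1 :=
    Unitary.spectrum_subset_circle U
  have hmul : matrixFun f (U : Matrix (Fin N) (Fin N) ℂ) =
      matrixFun F (U : Matrix (Fin N) (Fin N) ℂ) *
        star (matrixFun F (U : Matrix (Fin N) (Fin N) ℂ)) := by
    simp only [matrixFun]
    rw [← cfc_star, ← cfc_mul _ _ _ (hF.mono hsp) (hF.mono hsp).star]
    exact cfc_congr fun z hz => hf z (mem_sphere_zero_iff_norm.1 (hsp hz))
  rw [hmul, det_mul, star_eq_conjTranspose, det_conjTranspose, RCLike.star_def,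
    Complex.ofReal_pow, Complex.mul_conj']

theorem tendsto_aeval_matrixFun (U : unitaryGroup (Fin N) ℂ) {p : ℕ → ℝ[X]}
    (hp : TendstoUniformlyOn (fun M z => aeval z (p M)) F atTop (Metric.sphere (0 : ℂ) 1)) :
    Tendsto (fun M => aeval (U : Matrix (Fin N) (Fin N) ℂ) (p M)) atTop
      (𝓝 (matrixFun F (U : Matrix (Fin N) (Fin N) ℂ))) := by
  have hsp : spectrum ℂ (U : Matrix (Fin N) (Fin N) ℂ) ⊆ Metric.sphere 0 1 :=
    Unitary.spectrum_subset_circle U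
  have hcfc := tendsto_cfc_fun (hp.mono hsp)
    (Eventually.of_forall fun M => (p M).continuous_aeval.continuousOn)
  refine hcfc.congr fun M => ?_
  rw [← aeval_map_algebraMap ℂ, ← cfc_polynomial _ (U : Matrix (Fin N) (Fin N) ℂ)]
  simp only [eval_map_algebraMap]

end FunctionalCalculus

theorem tendsto_integral_norm_det_aeval_sq {N : ℕ} (hh : Summable fun r => |h r|) {f F : ℂ → ℂ}
    (hF : ∀ z : ℂ, ‖z‖ = 1 → HasSum (fun r => (h r : ℂ) * z ^ r) (F z))
    (hf : ∀ z : ℂ, ‖z‖ = 1 → f z = F z * star (F z)) :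
    Tendsto (fun M => ((∫ U : unitaryGroup (Fin N) ℂ,
        ‖(aeval (U : Matrix (Fin N) (Fin N) ℂ) (truncPoly h M)).det‖ ^ 2 ∂haarU N : ℝ) : ℂ)) atTop
      (𝓝 (∫ U : unitaryGroup (Fin N) ℂ,
        (matrixFun f (U : Matrix (Fin N) (Fin N) ℂ)).det ∂haarU N)) := by
  have hunif := tendstoUniformlyOn_aeval_truncPoly hh hF
  have hFc : ContinuousOn F (Metric.sphere 0 1) := hunif.continuousOn
    (Frequently.of_forall fun M => (truncPoly h M).continuous_aeval.continuousOn)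
  have hcont (M : ℕ) : Continuous fun U : unitaryGroup (Fin N) ℂ =>
      ‖(aeval (U : Matrix (Fin N) (Fin N) ℂ) (truncPoly h M)).det‖ ^ 2 := by
    simp only [aeval_truncPoly]
    fun_prop
  simp only [det_matrixFun_of_eq_mul_star _ hFc hf]
  rw [integral_complex_ofReal]
  refine (Complex.continuous_ofReal.tendsto _).comp (tendsto_integral_of_dominated_convergence
    (fun _ => (N.factorial • (∑' r, |h r|) ^ N) ^ 2) (fun M => (hcont M).aestronglyMeasurable)
    (integrable_const _) (fun M => .of_forall fun U => ?_) (.of_forall fun U => ?_))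
  · rw [norm_pow, norm_norm]
    exact pow_le_pow_left₀ (norm_nonneg _) (norm_det_aeval_truncPoly_le hh M U) 2
  · exact (((continuous_id.matrix_det).tendsto _).comp
      (tendsto_aeval_matrixFun U hunif)).norm.pow 2

theorem integral_det_matrixFun {N : ℕ} (hh : Summable fun r => |h r|) (h0 : h 0 ≠ 0)
    {f F : ℂ → ℂ} (hF : ∀ z : ℂ, ‖z‖ = 1 → HasSum (fun r => (h r : ℂ) * z ^ r) (F z))
    (hf : ∀ z : ℂ, ‖z‖ = 1 → f z = F z * star (F z)) :
    ∫ U : unitaryGroup (Fin N) ℂ, (matrixFun f (U : Matrix (Fin N) (Fin N) ℂ)).det ∂haarU N =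
      ((of fun i j : Fin N => ∑' s, shiftSeq h i s * shiftSeq h j s).det : ℝ) := by
  have hcoeff (M : ℕ) : (truncPoly h M).coeff 0 ≠ 0 := by simpa [coeff_truncPoly] using h0
  have hgram : 0 ≤ (of fun i j : Fin N => ∑' s, shiftSeq h i s * shiftSeq h j s).det :=
    (hasSum_det_sq_strictMono (B := fun i : Fin N => shiftSeq h i)
      fun i j => summable_shiftSeq_mul hh i j).nonneg fun _ => sq_nonneg _
  have hintegral := tendsto_integral_norm_det_aeval_sq (N := N) hh hF hf
  simp only [integral_norm_det_aeval_sq N (natDegree_truncPoly_le h _) (hcoeff _)] at hintegral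
  refine tendsto_nhds_unique hintegral ((Complex.continuous_ofReal.tendsto _).comp ?_)
  simpa only [abs_of_nonneg hgram] using (tendsto_det_coeffToeplitz_truncPoly N hh).abs

end HaarLimit

section PartitionSequences

open Matrix

theorem add_sub_le_of_strictMono_fin {N : ℕ} {s : Fin N → ℕ} (hs : StrictMono s) {a b : Fin N}
    (hab : a ≤ b) : s a + (b - a : ℕ) ≤ s b := by
  have hcard : (Finset.Ico a b).card ≤ (Finset.Ico (s a) (s b)).card :=
    Finset.card_le_card_of_injOn s
      (fun x hx => by
        rw [Finset.mem_coe, Finset.mem_Ico] at hx ⊢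
        exact ⟨hs.monotone hx.1, hs hx.2⟩)
      hs.injective.injOn
  rw [Fin.card_Ico, Nat.card_Ico] at hcard
  have := hs.monotone hab
  omega

theorem le_apply_of_strictMono_fin {N : ℕ} {s : Fin N → ℕ} (hs : StrictMono s) (j : Fin N) :
    (j : ℕ) ≤ s j := by
  have := add_sub_le_of_strictMono_fin hs (show ⟨0, j.pos⟩ ≤ j from Nat.zero_le j)
  simp only at this
  omega

theorem rowLen_eq_zero_of_partLength_le {lam : YoungDiagram} {i : ℕ} (h : partLength lam ≤ i) :
    lam.rowLen i = 0 := by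
  by_contra hne
  have hmem : (i, 0) ∈ lam := YoungDiagram.mem_iff_lt_rowLen.2 (Nat.pos_of_ne_zero hne)
  exact (YoungDiagram.mem_iff_lt_colLen.1 hmem).not_ge h

theorem youngDiagram_ext_rowLen {lam mu : YoungDiagram} (h : ∀ i, lam.rowLen i = mu.rowLen i) :
    lam = mu := by
  ext ⟨i, j⟩
  rw [YoungDiagram.mem_cells, YoungDiagram.mem_cells, YoungDiagram.mem_iff_lt_rowLen,
    YoungDiagram.mem_iff_lt_rowLen, h]

theorem exists_rowLen_eq_of_antitone {N : ℕ} {w : Fin N → ℕ} (hw : Antitone w) :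
    ∃ lam : YoungDiagram, partLength lam ≤ N ∧ ∀ i : Fin N, lam.rowLen i = w i := by
  have hsorted : (List.ofFn w).SortedGE := List.sortedGE_ofFn_iff.2 hw
  refine ⟨YoungDiagram.ofRowLens (List.ofFn w) hsorted, ?_, fun i => ?_⟩
  · by_contra hlt
    obtain ⟨hN, -⟩ := YoungDiagram.mem_ofRowLens.1
      (YoungDiagram.mem_iff_lt_colLen.2 (not_le.1 hlt))
    simp at hN
  · simpa using YoungDiagram.rowLen_ofRowLens (hw := hsorted) ⟨i, by simp⟩

/-- The strictly increasing sequence `λ_{N-j} + j`, `0 ≤ j < N`, that encodes a partition of length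
at most `N`. -/
def partSeq (N : ℕ) (lam : YoungDiagram) (j : Fin N) : ℕ := lam.rowLen (N - 1 - j) + j

theorem strictMono_partSeq (N : ℕ) (lam : YoungDiagram) : StrictMono (partSeq N lam) := by
  intro a b hab
  rw [Fin.lt_def] at hab
  have := lam.rowLen_anti (N - 1 - b) (N - 1 - a) (by omega)
  simp only [partSeq]
  omega

theorem exists_partSeq_eq {N : ℕ} {s : Fin N → ℕ} (hs : StrictMono s) :
    ∃ lam : YoungDiagram, partLength lam ≤ N ∧ partSeq N lam = s := by
  have hanti : Antitone fun i : Fin N => s i.rev - (i.rev : ℕ) := fun a b hab => by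
    have hrev : b.rev ≤ a.rev := Fin.rev_le_rev.2 hab
    have hgap := add_sub_le_of_strictMono_fin hs hrev
    have := le_apply_of_strictMono_fin hs b.rev
    rw [Fin.le_def] at hrev
    simp only
    omega
  obtain ⟨lam, hlen, hrow⟩ := exists_rowLen_eq_of_antitone hanti
  refine ⟨lam, hlen, funext fun j => ?_⟩
  have hj := hrow j.rev
  rw [Fin.rev_rev] at hj
  rw [partSeq, show N - 1 - (j : ℕ) = (j.rev : ℕ) by rw [Fin.val_rev]; omega, hj,
    Nat.sub_add_cancel (le_apply_of_strictMono_fin hs j)]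

theorem partSeq_injOn (N : ℕ) : Set.InjOn (partSeq N) {lam | partLength lam ≤ N} := by
  intro lam hlam mu hmu h
  refine youngDiagram_ext_rowLen fun i => ?_
  by_cases hi : i < N
  · have hi' := congrFun h ⟨N - 1 - i, by omega⟩
    simp only [partSeq] at hi'
    rw [show N - 1 - (N - 1 - i) = i by omega] at hi'
    omega
  · rw [rowLen_eq_zero_of_partLength_le (hlam.trans (not_lt.1 hi)),
      rowLen_eq_zero_of_partLength_le (hmu.trans (not_lt.1 hi))]

/-- The bijection between partitions of length at most `N` and strictly increasing sequences of `N`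
natural numbers. -/
noncomputable def partSeqEquiv (N : ℕ) :
    {lam : YoungDiagram // partLength lam ≤ N} ≃ {s : Fin N → ℕ // StrictMono s} :=
  Equiv.ofBijective (fun lam => ⟨partSeq N lam.1, strictMono_partSeq N lam.1⟩)
    ⟨fun lam mu h => Subtype.ext (partSeq_injOn N lam.2 mu.2 (congrArg Subtype.val h)), fun s =>
      have ⟨lam, hlen, hlam⟩ := exists_partSeq_eq s.2
      ⟨⟨lam, hlen⟩, Subtype.ext hlam⟩⟩

theorem hasSum_det_sq_partSeq {N : ℕ} {B : Fin N → ℕ → ℝ}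
    (hB : ∀ i j, Summable fun s => B i s * B j s) :
    HasSum (fun lam : {lam : YoungDiagram // partLength lam ≤ N} =>
      (of fun i j => B i (partSeq N lam.1 j)).det ^ 2) (of fun i j => ∑' s, B i s * B j s).det := by
  have := (partSeqEquiv N).hasSum_iff.2 (hasSum_det_sq_strictMono hB)
  exact this

end PartitionSequences

section QPochhammer

open Filter Topology

variable {q : ℝ}

theorem one_sub_pow_pos (hq : |q| < 1) {n : ℕ} (hn : n ≠ 0) : 0 < 1 - q ^ n :=
  sub_pos.2 ((le_abs_self _).trans_lt (by
    rw [abs_pow]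
    exact pow_lt_one₀ (abs_nonneg q) hq hn))

theorem norm_mul_ofReal_pow_le (hq : |q| < 1) (x : ℂ) (m : ℕ) : ‖x * (q : ℂ) ^ m‖ ≤ ‖x‖ := by
  rw [norm_mul, norm_pow, Complex.norm_real, Real.norm_eq_abs]
  exact mul_le_of_le_one_right (norm_nonneg _) (pow_le_one₀ (abs_nonneg q) hq.le)

theorem tendsto_mul_ofReal_pow_zero (hq : |q| < 1) (x : ℂ) :
    Tendsto (fun m : ℕ => x * (q : ℂ) ^ m) atTop (𝓝 0) := by
  simpa using (tendsto_pow_atTop_nhds_zero_of_norm_lt_one (x := (q : ℂ)) (by simpa)).const_mul x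

theorem tendsto_prod_qPochInf (hq : |q| < 1) (x : ℂ) :
    Tendsto (fun n => ∏ k ∈ Finset.range n, (1 - x * (q : ℂ) ^ k)) atTop (𝓝 (qPochInf x q)) := by
  have hmul : Multipliable fun k : ℕ => 1 + -(x * (q : ℂ) ^ k) := by
    refine multipliable_one_add_of_summable ?_
    simp only [norm_neg, norm_mul, norm_pow, Complex.norm_real, Real.norm_eq_abs]
    exact (summable_geometric_of_lt_one (abs_nonneg q) hq).mul_left _
  simp only [← sub_eq_add_neg] at hmul
  exact hmul.hasProd.tendsto_prod_nat

variable {w : ℂ} {G : ℂ → ℂ}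

theorem eq_qPochInf_of_functional (hq : |q| < 1) (hw : ‖w‖ < 1)
    (hlim : Tendsto (fun m : ℕ => G (w * (q : ℂ) ^ m)) atTop (𝓝 1))
    (hfun : ∀ v : ℂ, ‖v‖ < 1 → G v = (1 - v) * G (v * q)) : G w = qPochInf w q := by
  have hiter (n : ℕ) :
      G w = (∏ k ∈ Finset.range n, (1 - w * (q : ℂ) ^ k)) * G (w * (q : ℂ) ^ n) := by
    induction n with
    | zero => simp
    | succ n ih =>
      rw [ih, Finset.prod_range_succ, hfun _ ((norm_mul_ofReal_pow_le hq w n).trans_lt hw),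
        mul_assoc w, ← pow_succ, ← mul_assoc]
  have hprod := (tendsto_prod_qPochInf hq w).mul hlim
  rw [mul_one] at hprod
  exact tendsto_nhds_unique (tendsto_const_nhds.congr hiter) hprod

theorem mul_qPochInf_eq_one_of_functional (hq : |q| < 1) (hw : ‖w‖ < 1)
    (hlim : Tendsto (fun m : ℕ => G (w * (q : ℂ) ^ m)) atTop (𝓝 1))
    (hfun : ∀ v : ℂ, ‖v‖ < 1 → (1 - v) * G v = G (v * q)) : G w * qPochInf w q = 1 := by
  have hiter (n : ℕ) :
      G w * ∏ k ∈ Finset.range n, (1 - w * (q : ℂ) ^ k) = G (w * (q : ℂ) ^ n) := by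
    induction n with
    | zero => simp
    | succ n ih =>
      rw [Finset.prod_range_succ, ← mul_assoc, ih, mul_comm,
        hfun _ ((norm_mul_ofReal_pow_le hq w n).trans_lt hw), mul_assoc, ← pow_succ]
  exact tendsto_nhds_unique (((tendsto_prod_qPochInf hq w).const_mul (G w)).congr hiter) hlim

theorem tendsto_tsum_mul_pow (hq : |q| < 1) {c : ℕ → ℂ}
    (hs : Summable fun r => ‖c r * w ^ r‖) :
    Tendsto (fun m : ℕ => ∑' r, c r * (w * (q : ℂ) ^ m) ^ r) atTop (𝓝 (c 0)) := by
  rw [← tsum_ite_eq (0 : ℕ) c]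
  refine tendsto_tsum_of_dominated_convergence hs (fun r => ?_) (Eventually.of_forall fun m r => ?_)
  · rcases Nat.eq_zero_or_pos r with rfl | hr
    · simp
    · simpa [hr.ne'] using ((tendsto_mul_ofReal_pow_zero hq w).pow r).const_mul (c r)
  · rw [norm_mul, norm_mul, norm_pow, norm_pow]
    exact mul_le_mul_of_nonneg_left
      (pow_le_pow_left₀ (norm_nonneg _) (norm_mul_ofReal_pow_le hq w m) r) (norm_nonneg _)

theorem tsum_mul_pow_sub_tsum_mul_mul_pow {𝕜 : Type*} [NormedField 𝕜] {a v : 𝕜} {c e : ℕ → 𝕜}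
    (hv : Summable fun r => c r * v ^ r) (hva : Summable fun r => c r * (v * a) ^ r)
    (he : ∀ r, c (r + 1) * (1 - a ^ (r + 1)) = e r) :
    ∑' r, c r * v ^ r - ∑' r, c r * (v * a) ^ r = v * ∑' r, e r * v ^ r := by
  rw [← hv.tsum_sub hva, (hv.sub hva).tsum_eq_zero_add, pow_zero, pow_zero, sub_self, zero_add,
    ← tsum_mul_left]
  refine tsum_congr fun r => ?_
  rw [← he]
  ring

end QPochhammer

section EulerExpansions

open Filter Topology

variable {q : ℝ}

/-- The finite `q`-Pochhammer symbol `(q;q)_r = ∏_{1 ≤ t ≤ r} (1 - q^t)`. -/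
noncomputable def qFact (q : ℝ) (r : ℕ) : ℝ := ∏ t ∈ Finset.range r, (1 - q ^ (t + 1))

theorem qFact_zero (q : ℝ) : qFact q 0 = 1 := by simp [qFact]

theorem qFact_succ (q : ℝ) (r : ℕ) : qFact q (r + 1) = qFact q r * (1 - q ^ (r + 1)) :=
  Finset.prod_range_succ _ _

theorem qFact_pos (hq : |q| < 1) (r : ℕ) : 0 < qFact q r :=
  Finset.prod_pos fun _ _ => one_sub_pow_pos hq (Nat.succ_ne_zero _)

theorem inv_qFact_succ_mul (hq : |q| < 1) (r : ℕ) :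
    ((qFact q (r + 1))⁻¹ : ℂ) * (1 - (q : ℂ) ^ (r + 1)) = (qFact q r : ℂ)⁻¹ := by
  have hne : (1 - q ^ (r + 1) : ℝ) ≠ 0 := (one_sub_pow_pos hq (Nat.succ_ne_zero r)).ne'
  have hreal : (qFact q (r + 1))⁻¹ * (1 - q ^ (r + 1)) = (qFact q r)⁻¹ := by
    rw [qFact_succ, mul_inv, mul_assoc, inv_mul_cancel₀ hne, mul_one]
  exact_mod_cast hreal

theorem summable_norm_inv_qFact_mul_pow (hq : |q| < 1) {w : ℂ} (hw : ‖w‖ < 1) :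
    Summable fun r => ‖(qFact q r : ℂ)⁻¹ * w ^ r‖ := by
  obtain ⟨ρ, hwρ, hρ⟩ := exists_between hw
  have hratio : Tendsto (fun r : ℕ => ‖w‖ / (1 - q ^ (r + 1))) atTop (𝓝 (‖w‖ / (1 - 0))) :=
    tendsto_const_nhds.div (tendsto_const_nhds.sub
      ((tendsto_add_atTop_iff_nat 1).2 (tendsto_pow_atTop_nhds_zero_of_abs_lt_one hq)))
      (by norm_num)
  rw [sub_zero, div_one] at hratio
  refine summable_of_ratio_norm_eventually_le hρ ?_
  filter_upwards [hratio.eventually_le_const hwρ] with r hr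
  have hpos := one_sub_pow_pos hq (Nat.succ_ne_zero r)
  have hstep : ‖(qFact q (r + 1) : ℂ)⁻¹ * w ^ (r + 1)‖ =
      ‖w‖ / (1 - q ^ (r + 1)) * ‖(qFact q r : ℂ)⁻¹ * w ^ r‖ := by
    simp only [norm_mul, norm_inv, norm_pow, Complex.norm_real, qFact_succ,
      Real.norm_of_nonneg hpos.le, pow_succ ‖w‖]
    field_simp
  rw [norm_norm, norm_norm, hstep]
  exact mul_le_mul_of_nonneg_right hr (norm_nonneg _)

theorem hasSum_inv_qPochInf (hq : |q| < 1) {w : ℂ} (hw : ‖w‖ < 1) :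
    HasSum (fun r => (qFact q r : ℂ)⁻¹ * w ^ r) (qPochInf w q)⁻¹ := by
  have hsum {v : ℂ} (hv : ‖v‖ < 1) := summable_norm_inv_qFact_mul_pow hq hv
  have hlim := tendsto_tsum_mul_pow hq (hsum hw)
  rw [qFact_zero, Complex.ofReal_one, inv_one] at hlim
  have hmul := mul_qPochInf_eq_one_of_functional hq hw
    (G := fun v => ∑' r, (qFact q r : ℂ)⁻¹ * v ^ r) hlim fun v hv => by
      have hvq : ‖v * (q : ℂ)‖ < 1 := by
        simpa using (norm_mul_ofReal_pow_le hq v 1).trans_lt hv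
      linear_combination tsum_mul_pow_sub_tsum_mul_mul_pow (hsum hv).of_norm (hsum hvq).of_norm
        (inv_qFact_succ_mul hq)
  rw [← eq_inv_of_mul_eq_one_left hmul]
  exact (hsum hw).of_norm.hasSum

theorem hasSum_qPochInf (hq : |q| < 1) {w : ℂ} (hw : ‖w‖ < 1) :
    HasSum (fun r => ((-1) ^ r * (q : ℂ) ^ r.choose 2 * (qFact q r : ℂ)⁻¹) * w ^ r)
      (qPochInf w q) := by
  have hsum {v : ℂ} (hv : ‖v‖ < 1) :
      Summable fun r => ‖((-1) ^ r * (q : ℂ) ^ r.choose 2 * (qFact q r : ℂ)⁻¹) * v ^ r‖ := by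
    refine Summable.of_nonneg_of_le (fun _ => norm_nonneg _) (fun r => ?_)
      (summable_norm_inv_qFact_mul_pow hq hv)
    have hnorm : ‖(-1 : ℂ) ^ r * (q : ℂ) ^ r.choose 2‖ ≤ 1 := by
      simpa using norm_mul_ofReal_pow_le hq ((-1) ^ r) (r.choose 2)
    rw [mul_assoc, norm_mul]
    exact mul_le_of_le_one_left (norm_nonneg _) hnorm
  have hlim := tendsto_tsum_mul_pow hq (hsum hw)
  rw [qFact_zero, Complex.ofReal_one, inv_one, Nat.choose_zero_succ, pow_zero, pow_zero, mul_one,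
    mul_one] at hlim
  have heq := eq_qPochInf_of_functional hq hw
    (G := fun v => ∑' r, ((-1) ^ r * (q : ℂ) ^ r.choose 2 * (qFact q r : ℂ)⁻¹) * v ^ r) hlim
    fun v hv => by
      have hvq : ‖v * (q : ℂ)‖ < 1 := by
        simpa using (norm_mul_ofReal_pow_le hq v 1).trans_lt hv
      have hcoeff (r : ℕ) :
          (-1) ^ (r + 1) * (q : ℂ) ^ (r + 1).choose 2 * (qFact q (r + 1) : ℂ)⁻¹ *
              (1 - (q : ℂ) ^ (r + 1)) =
            -((-1) ^ r * (q : ℂ) ^ r.choose 2 * (qFact q r : ℂ)⁻¹ * (q : ℂ) ^ r) := by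
        rw [mul_assoc, inv_qFact_succ_mul hq, Nat.choose_succ_succ' r 1, Nat.choose_one_right]
        ring
      have hdiff := tsum_mul_pow_sub_tsum_mul_mul_pow (hsum hv).of_norm (hsum hvq).of_norm hcoeff
      simp only [neg_mul, tsum_neg, mul_assoc _ ((q : ℂ) ^ _) (v ^ _), ← mul_pow] at hdiff
      rw [mul_comm (q : ℂ) v] at hdiff
      linear_combination hdiff
  rw [← heq]
  exact (hsum hw).of_norm.hasSum

end EulerExpansions

section ExponentialFormulas

open Filter Topology

variable {q : ℝ}

/-- The series `∑_{n ≥ 1} wⁿ / (n (1 - qⁿ))`, which represents `-log (w;q)_∞`; the term `n = 0`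
vanishes because `0⁻¹ = 0`. -/
noncomputable def qLog (w : ℂ) (q : ℝ) : ℂ := ∑' n : ℕ, (n * (1 - (q : ℂ) ^ n))⁻¹ * w ^ n

theorem summable_norm_qLog (hq : |q| < 1) {w : ℂ} (hw : ‖w‖ < 1) :
    Summable fun n : ℕ => ‖(n * (1 - (q : ℂ) ^ n))⁻¹ * w ^ n‖ := by
  have hpos : 0 < 1 - |q| := sub_pos.2 hq
  refine Summable.of_nonneg_of_le (fun _ => norm_nonneg _) (fun n => ?_)
    ((summable_geometric_of_lt_one (norm_nonneg w) hw).mul_left (1 - |q|)⁻¹)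
  rw [norm_mul, norm_pow]
  refine mul_le_mul_of_nonneg_right ?_ (by positivity)
  rcases Nat.eq_zero_or_pos n with rfl | hn
  · simpa using hpos.le
  have hpow : |q| ^ n ≤ |q| := pow_le_of_le_one (abs_nonneg q) hq.le hn.ne'
  have hqn : q ^ n ≤ |q| ^ n := (le_abs_self _).trans_eq (abs_pow q n)
  have hn1 : (1 : ℝ) ≤ n := by exact_mod_cast hn
  have hbound : 1 - |q| ≤ n * (1 - q ^ n) := by nlinarith
  have hcast : (n * (1 - (q : ℂ) ^ n)) = ((n * (1 - q ^ n) : ℝ) : ℂ) := by push_cast; rfl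
  rw [norm_inv, hcast, Complex.norm_real, Real.norm_of_nonneg (hpos.le.trans hbound)]
  exact inv_anti₀ hpos hbound

theorem qLog_sub_qLog_mul (hq : |q| < 1) {v : ℂ} (hv : ‖v‖ < 1) :
    qLog v q - qLog (v * q) q = -Complex.log (1 - v) := by
  have hvq : ‖v * (q : ℂ)‖ < 1 := by
    simpa using (norm_mul_ofReal_pow_le hq v 1).trans_lt hv
  have hterm (n : ℕ) : (n * (1 - (q : ℂ) ^ n))⁻¹ * v ^ n -
      (n * (1 - (q : ℂ) ^ n))⁻¹ * (v * q) ^ n = v ^ n / n := by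
    rcases Nat.eq_zero_or_pos n with rfl | hn
    · simp
    have hne : 1 - (q : ℂ) ^ n ≠ 0 := by exact_mod_cast (one_sub_pow_pos hq hn.ne').ne'
    rw [mul_pow]
    field_simp
  rw [qLog, qLog, ← (summable_norm_qLog hq hv).of_norm.tsum_sub (summable_norm_qLog hq hvq).of_norm,
    tsum_congr hterm, (Complex.hasSum_taylorSeries_neg_log hv).tsum_eq]

theorem exp_qLog_mul_qPochInf (hq : |q| < 1) {w : ℂ} (hw : ‖w‖ < 1) :
    Complex.exp (qLog w q) * qPochInf w q = 1 := by
  have hlim := (Complex.continuous_exp.tendsto _).comp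
    (tendsto_tsum_mul_pow hq (summable_norm_qLog hq hw))
  rw [Nat.cast_zero, zero_mul, inv_zero, Complex.exp_zero] at hlim
  refine mul_qPochInf_eq_one_of_functional hq hw (G := fun v => Complex.exp (qLog v q)) hlim
    fun v hv => ?_
  have hne : 1 - v ≠ 0 := fun h => by
    rw [← sub_eq_zero.1 h, norm_one] at hv
    exact lt_irrefl _ hv
  rw [show qLog (v * q) q = Complex.log (1 - v) + qLog v q by
    linear_combination -qLog_sub_qLog_mul hq hv, Complex.exp_add, Complex.exp_log hne]

theorem expTerm_eq (hq : 0 < q) (a : ℝ) (z : ℂ) (n : ℕ) :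
    expTerm a q z n = -((n * (1 - (q : ℂ) ^ n))⁻¹ * (a * √q * z) ^ n +
      (n * (1 - (q : ℂ) ^ n))⁻¹ * (a * √q * z⁻¹) ^ n) := by
  have hsqrt : (q : ℂ) = (√q : ℂ) ^ 2 := by
    rw [← Complex.ofReal_pow, Real.sq_sqrt hq.le]
  have hne : (√q : ℂ) ^ n ≠ 0 :=
    pow_ne_zero n (Complex.ofReal_ne_zero.2 (Real.sqrt_pos.2 hq).ne')
  have hdenom : (√q : ℂ) ^ n - ((√q : ℂ) ^ n)⁻¹ = -((1 - (q : ℂ) ^ n) * ((√q : ℂ) ^ n)⁻¹) := by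
    rw [hsqrt]
    field_simp
    ring
  rw [expTerm, hdenom, div_eq_mul_inv]
  simp only [mul_inv, inv_neg, mul_neg, inv_inv, mul_pow, inv_pow]
  ring

variable {a : ℝ} {z : ℂ}

theorem hasSum_expTerm (hq₀ : 0 < q) (hq₁ : q < 1) (hz : ‖a * √q * z‖ < 1)
    (hz' : ‖a * √q * z⁻¹‖ < 1) :
    HasSum (fun n : ℕ => expTerm a q z (n + 1))
      (-(qLog (a * √q * z) q + qLog (a * √q * z⁻¹) q)) := by
  have hq : |q| < 1 := by rwa [abs_of_pos hq₀]
  have hsum := ((summable_norm_qLog hq hz).of_norm.hasSum.add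
    (summable_norm_qLog hq hz').of_norm.hasSum).neg
  simp only [← expTerm_eq hq₀] at hsum
  simpa [expTerm, qLog] using (hasSum_nat_add_iff' 1).2 hsum

theorem weight_eq_exp (hq₀ : 0 < q) (hq₁ : q < 1) (hz : ‖a * √q * z‖ < 1)
    (hz' : ‖a * √q * z⁻¹‖ < 1) :
    weight a q z = Complex.exp (-∑' n : ℕ, expTerm a q z (n + 1)) := by
  have hq : |q| < 1 := by rwa [abs_of_pos hq₀]
  rw [(hasSum_expTerm hq₀ hq₁ hz hz').tsum_eq, neg_neg, Complex.exp_add, weight, mul_inv,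
    eq_inv_of_mul_eq_one_left (exp_qLog_mul_qPochInf hq hz),
    eq_inv_of_mul_eq_one_left (exp_qLog_mul_qPochInf hq hz')]

theorem weightCheck_eq_inv_weight_neg (a q : ℝ) (z : ℂ) :
    weightCheck a q z = (weight (-a) q z)⁻¹ := by
  simp only [weightCheck, weight, inv_inv, Complex.ofReal_neg, neg_mul]

theorem weightCheck_eq_exp (hq₀ : 0 < q) (hq₁ : q < 1) (hz : ‖a * √q * z‖ < 1)
    (hz' : ‖a * √q * z⁻¹‖ < 1) :
    weightCheck a q z = Complex.exp (∑' n : ℕ, expTerm (-a) q z (n + 1)) := by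
  rw [weightCheck_eq_inv_weight_neg, weight_eq_exp hq₀ hq₁ (by simpa using hz) (by simpa using hz'),
    Complex.exp_neg, inv_inv]

end ExponentialFormulas

section DiagramSums

open Finset

theorem lt_colLen_of_lt_rowLen {lam : YoungDiagram} {i j : ℕ} (h : j < lam.rowLen i) :
    i < lam.colLen j :=
  YoungDiagram.mem_iff_lt_colLen.1 (YoungDiagram.mem_iff_lt_rowLen.2 h)

theorem lt_rowLen_of_lt_colLen {lam : YoungDiagram} {i j : ℕ} (h : i < lam.colLen j) :
    j < lam.rowLen i :=
  YoungDiagram.mem_iff_lt_rowLen.1 (YoungDiagram.mem_iff_lt_colLen.2 h)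

theorem mem_cells_iff_of_partLength_le {lam : YoungDiagram} {N : ℕ} (h : partLength lam ≤ N)
    (c : ℕ × ℕ) : c ∈ lam.cells ↔ c.1 ∈ range N ∧ c.2 ∈ range (lam.rowLen c.1) := by
  rw [YoungDiagram.mem_cells, YoungDiagram.mem_iff_lt_rowLen, mem_range, mem_range]
  refine ⟨fun hc => ⟨?_, hc⟩, And.right⟩
  by_contra hi
  rw [rowLen_eq_zero_of_partLength_le (h.trans (not_lt.1 hi))] at hc
  exact Nat.not_lt_zero _ hc

@[to_additive]
theorem prod_cells {M : Type*} [CommMonoid M] {lam : YoungDiagram} {N : ℕ}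
    (h : partLength lam ≤ N) (f : ℕ × ℕ → M) :
    ∏ c ∈ lam.cells, f c = ∏ i ∈ range N, ∏ j ∈ range (lam.rowLen i), f (i, j) :=
  prod_finset_product _ _ _ (mem_cells_iff_of_partLength_le h)

@[to_additive]
theorem prod_cells_transpose {M : Type*} [CommMonoid M] (lam : YoungDiagram) (f : ℕ × ℕ → M) :
    ∏ c ∈ lam.transpose.cells, f c = ∏ c ∈ lam.cells, f c.swap :=
  prod_equiv (Equiv.prodComm ℕ ℕ)
    (fun c => by simp only [YoungDiagram.mem_cells, YoungDiagram.mem_transpose,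
      Equiv.prodComm_apply])
    fun _ _ => by rw [Equiv.prodComm_apply, Prod.swap_swap]

theorem card_transpose (lam : YoungDiagram) : lam.transpose.card = lam.card := by
  simpa [YoungDiagram.card] using sum_cells_transpose lam fun _ => (1 : ℕ)

theorem card_eq_sum_rowLen {lam : YoungDiagram} {N : ℕ} (h : partLength lam ≤ N) :
    lam.card = ∑ i ∈ range N, lam.rowLen i := by
  simpa [YoungDiagram.card] using sum_cells h fun _ => (1 : ℕ)

theorem bStat_eq_sum_cells (lam : YoungDiagram) : bStat lam = ∑ c ∈ lam.cells, c.1 := by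
  rw [sum_cells le_rfl, bStat]
  exact sum_congr rfl fun i _ => by simp [mul_comm]

theorem bStat_eq_sum_range {lam : YoungDiagram} {N : ℕ} (h : partLength lam ≤ N) :
    bStat lam = ∑ i ∈ range N, i * lam.rowLen i := by
  rw [bStat_eq_sum_cells, sum_cells h]
  exact sum_congr rfl fun i _ => by simp [mul_comm]

theorem bStat_transpose_eq_sum_choose {lam : YoungDiagram} {N : ℕ} (h : partLength lam ≤ N) :
    bStat lam.transpose = ∑ i ∈ range N, (lam.rowLen i).choose 2 := by
  rw [bStat_eq_sum_cells, sum_cells_transpose, sum_cells h]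
  refine sum_congr rfl fun i _ => ?_
  simp only [Prod.fst_swap]
  rw [sum_range_id, Nat.choose_two_right]

end DiagramSums

section HookLengths

open Finset

theorem hookLen_transpose (lam : YoungDiagram) (c : ℕ × ℕ) :
    hookLen lam.transpose c = hookLen lam c.swap := by
  simp only [hookLen, YoungDiagram.rowLen_transpose, YoungDiagram.colLen_transpose, Prod.fst_swap,
    Prod.snd_swap]
  omega

theorem hookLen_ne_zero {lam : YoungDiagram} {c : ℕ × ℕ} (hc : c ∈ lam.cells) :
    hookLen lam c ≠ 0 := by
  have hrow := YoungDiagram.mem_iff_lt_rowLen.1 hc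
  have hcol := lt_colLen_of_lt_rowLen hrow
  simp only [hookLen]
  omega

theorem hookLen_lt_of_lt {lam : YoungDiagram} {i j k : ℕ} (hjk : j < k) (hk : k < lam.rowLen i) :
    hookLen lam (i, k) < hookLen lam (i, j) := by
  have := lt_colLen_of_lt_rowLen hk
  have := lam.colLen_anti j k hjk.le
  simp only [hookLen]
  omega

theorem injOn_hookLen_row (lam : YoungDiagram) (i : ℕ) :
    Set.InjOn (fun j => hookLen lam (i, j)) (range (lam.rowLen i)) := by
  have hanti : StrictAntiOn (fun j => hookLen lam (i, j)) (range (lam.rowLen i)) :=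
    fun j _ k hk hjk => hookLen_lt_of_lt hjk (by simpa using hk)
  exact hanti.injOn

theorem injOn_partSeq_sub (N : ℕ) (lam : YoungDiagram) (j : Fin N) :
    Set.InjOn (fun i => partSeq N lam j - partSeq N lam i) (Iio j : Finset (Fin N)) := by
  intro a ha b hb h
  rw [mem_coe, mem_Iio] at ha hb
  have ha' := strictMono_partSeq N lam ha
  have hb' := strictMono_partSeq N lam hb
  refine (strictMono_partSeq N lam).injective ?_
  simp only at h
  omega

variable {N : ℕ} {lam : YoungDiagram}

theorem hookLen_ne_partSeq_sub {i j : Fin N} (hij : i < j) {c : ℕ}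
    (hc : c < lam.rowLen (N - 1 - j)) :
    hookLen lam (N - 1 - j, c) ≠ partSeq N lam j - partSeq N lam i := by
  have hcol := lt_colLen_of_lt_rowLen hc
  have hseq := strictMono_partSeq N lam hij
  rw [Fin.lt_def] at hij
  simp only [hookLen, partSeq] at hseq ⊢
  rcases lt_or_ge (N - 1 - (i : ℕ)) (lam.colLen c) with hi | hi
  · have := lt_rowLen_of_lt_colLen hi
    omega
  · have : lam.rowLen (N - 1 - i) ≤ c := not_lt.1 fun h => (lt_colLen_of_lt_rowLen h).not_ge hi
    omega

theorem hookLen_le_partSeq (hlam : partLength lam ≤ N) {j : Fin N} {c : ℕ}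
    (hc : c < lam.rowLen (N - 1 - j)) : hookLen lam (N - 1 - j, c) ≤ partSeq N lam j := by
  have hcol : lam.colLen c ≤ N := (lam.colLen_anti 0 c (Nat.zero_le _)).trans hlam
  simp only [hookLen, partSeq]
  omega

theorem disjoint_image_hookLen_image_partSeq_sub (j : Fin N) :
    Disjoint ((range (lam.rowLen (N - 1 - j))).image fun c => hookLen lam (N - 1 - j, c))
      ((Iio j).image fun i => partSeq N lam j - partSeq N lam i) := by
  rw [disjoint_left]
  intro n hn hn'
  obtain ⟨c, hc, rfl⟩ := mem_image.1 hn
  obtain ⟨i, hi, h⟩ := mem_image.1 hn'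
  exact hookLen_ne_partSeq_sub (mem_Iio.1 hi) (mem_range.1 hc) h.symm

theorem image_hookLen_union_image_partSeq_sub (hlam : partLength lam ≤ N) (j : Fin N) :
    (range (lam.rowLen (N - 1 - j))).image (fun c => hookLen lam (N - 1 - j, c)) ∪
        (Iio j).image (fun i => partSeq N lam j - partSeq N lam i) =
      (range (partSeq N lam j)).image (· + 1) := by
  refine eq_of_subset_of_card_le (fun n hn => ?_) ?_
  · suffices n ≠ 0 ∧ n ≤ partSeq N lam j by
      rw [mem_image]
      exact ⟨n - 1, mem_range.2 (by omega), by omega⟩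
    rcases mem_union.1 hn with hn | hn
    · obtain ⟨c, hc, rfl⟩ := mem_image.1 hn
      rw [mem_range] at hc
      exact ⟨hookLen_ne_zero (YoungDiagram.mem_iff_lt_rowLen.2 hc), hookLen_le_partSeq hlam hc⟩
    · obtain ⟨i, hi, rfl⟩ := mem_image.1 hn
      have := strictMono_partSeq N lam (mem_Iio.1 hi)
      omega
  · rw [card_union_of_disjoint (disjoint_image_hookLen_image_partSeq_sub j),
      card_image_of_injOn (injOn_hookLen_row _ _), card_image_of_injOn (injOn_partSeq_sub N lam j),
      card_range, Fin.card_Iio, card_image_of_injective _ (add_left_injective 1), card_range,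
      partSeq]

theorem prod_hookLen_mul_prod_partSeq_sub {M : Type*} [CommMonoid M] (hlam : partLength lam ≤ N)
    (j : Fin N) (f : ℕ → M) :
    (∏ c ∈ range (lam.rowLen (N - 1 - j)), f (hookLen lam (N - 1 - j, c))) *
        ∏ i ∈ Iio j, f (partSeq N lam j - partSeq N lam i) =
      ∏ t ∈ range (partSeq N lam j), f (t + 1) := by
  rw [← prod_image (f := f) (injOn_hookLen_row lam _),
    ← prod_image (f := f) (injOn_partSeq_sub N lam j),
    ← prod_union (disjoint_image_hookLen_image_partSeq_sub j),
    image_hookLen_union_image_partSeq_sub hlam j, prod_image fun _ _ _ _ h => Nat.succ_injective h]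

theorem prod_cells_hookLen_mul_prod_partSeq_sub {M : Type*} [CommMonoid M]
    (hlam : partLength lam ≤ N) (f : ℕ → M) :
    (∏ c ∈ lam.cells, f (hookLen lam c)) *
        ∏ i : Fin N, ∏ j ∈ Ioi i, f (partSeq N lam j - partSeq N lam i) =
      ∏ j : Fin N, ∏ t ∈ range (partSeq N lam j), f (t + 1) := by
  have hswap : ∏ i : Fin N, ∏ j ∈ Ioi i, f (partSeq N lam j - partSeq N lam i) =
      ∏ j : Fin N, ∏ i ∈ Iio j, f (partSeq N lam j - partSeq N lam i) :=
    prod_comm' (by simp)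
  rw [hswap, prod_cells hlam, ← prod_range_reflect, prod_range, ← prod_mul_distrib]
  exact prod_congr rfl fun j _ => prod_hookLen_mul_prod_partSeq_sub hlam j f

end HookLengths

section HookFormula

open Finset Matrix

variable {N : ℕ} {lam : YoungDiagram}

theorem sum_partSeq (hlam : partLength lam ≤ N) :
    ∑ j : Fin N, partSeq N lam j = lam.card + ∑ j : Fin N, (j : ℕ) := by
  simp only [partSeq, sum_add_distrib]
  rw [card_eq_sum_rowLen hlam, ← sum_range_reflect, sum_range]

theorem sum_range_mul_sub (N : ℕ) :
    ∑ i ∈ range N, i * (N - 1 - i) = ∑ i ∈ range N, i.choose 2 := by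
  induction N with
  | zero => simp
  | succ n ih =>
    rw [sum_range_succ, sum_range_succ, ← ih, Nat.choose_two_right, ← sum_range_id,
      ← sum_add_distrib, Nat.add_sub_cancel, Nat.sub_self, mul_zero, add_zero]
    refine sum_congr rfl fun i hi => ?_
    rw [show n - i = n - 1 - i + 1 by have := mem_range.1 hi; omega, mul_add, mul_one]

theorem sum_partSeq_mul (hlam : partLength lam ≤ N) :
    ∑ j : Fin N, partSeq N lam j * (N - 1 - j) = bStat lam + ∑ i ∈ range N, i.choose 2 := by
  simp only [partSeq, add_mul, sum_add_distrib]
  rw [← sum_range_mul_sub, bStat_eq_sum_range hlam, ← sum_range_reflect (fun i => i * lam.rowLen i),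
    sum_range, sum_range]
  simp only [mul_comm]

variable {q : ℝ}

/-- The quantity `q^{b(λ)} ∏_{c ∈ λ} (1 - q^{h(c)})⁻¹`, which is the Schur function `s_λ` at
`(1, q, q², …)`. -/
noncomputable def hookWeight (q : ℝ) (lam : YoungDiagram) : ℝ :=
  q ^ bStat lam * ∏ c ∈ lam.cells, (1 - q ^ hookLen lam c)⁻¹

theorem prod_one_sub_pow_partSeq_sub (hq : |q| < 1) (hlam : partLength lam ≤ N) :
    ∏ i : Fin N, ∏ j ∈ Ioi i, (1 - q ^ (partSeq N lam j - partSeq N lam i)) =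
      (∏ c ∈ lam.cells, (1 - q ^ hookLen lam c)⁻¹) * ∏ j, qFact q (partSeq N lam j) := by
  have hpos : 0 < ∏ c ∈ lam.cells, (1 - q ^ hookLen lam c) :=
    prod_pos fun _ hc => one_sub_pow_pos hq (hookLen_ne_zero hc)
  rw [prod_inv_distrib, eq_inv_mul_iff_mul_eq₀ hpos.ne']
  exact prod_cells_hookLen_mul_prod_partSeq_sub hlam fun n => 1 - q ^ n

theorem det_vandermonde_partSeq_sq (hq : |q| < 1) (hlam : partLength lam ≤ N) :
    (vandermonde fun j : Fin N => q ^ partSeq N lam j).det ^ 2 =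
      (q ^ (∑ i ∈ range N, i.choose 2) * hookWeight q lam *
        ∏ j, qFact q (partSeq N lam j)) ^ 2 := by
  have hfactor (i j : Fin N) (hij : j ∈ Ioi i) :
      (q ^ partSeq N lam j - q ^ partSeq N lam i) ^ 2 =
        (q ^ partSeq N lam i * (1 - q ^ (partSeq N lam j - partSeq N lam i))) ^ 2 := by
    have hle := (strictMono_partSeq N lam (mem_Ioi.1 hij)).le
    rw [mul_sub, ← pow_add, Nat.add_sub_cancel' hle, mul_one, ← neg_sq, neg_sub]
  have hprod : (∏ i : Fin N, ∏ j ∈ Ioi i, (q ^ partSeq N lam j - q ^ partSeq N lam i)) ^ 2 =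
      (∏ i : Fin N, ∏ j ∈ Ioi i,
        q ^ partSeq N lam i * (1 - q ^ (partSeq N lam j - partSeq N lam i))) ^ 2 := by
    simp only [← prod_pow]
    exact prod_congr rfl fun i _ => prod_congr rfl (hfactor i)
  rw [det_vandermonde, hprod]
  simp only [prod_mul_distrib, prod_const, Fin.card_Ioi, ← pow_mul]
  rw [prod_one_sub_pow_partSeq_sub hq hlam, prod_pow_eq_pow_sum, sum_partSeq_mul hlam, pow_add,
    hookWeight]
  ring

end HookFormula

section ShiftSeqDeterminants

open Finset Matrix

theorem natDegree_prod_range_X_sub_C {R : Type*} [CommRing R] [Nontrivial R] (c : ℕ → R) (i : ℕ) :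
    (∏ t ∈ range i, (Polynomial.X - Polynomial.C (c t))).natDegree = i := by
  rw [Polynomial.natDegree_prod_of_monic _ _ fun t _ => Polynomial.monic_X_sub_C _]
  simp

theorem det_of_mul_prod_range_sub {R : Type*} [CommRing R] {N : ℕ} (u v y : Fin N → R)
    (c : ℕ → R) :
    (of fun i j : Fin N => u j * (v i * ∏ t ∈ range i, (y j - c t))).det =
      (∏ j, u j) * ((∏ i, v i) * (vandermonde y).det) := by
  nontriviality R
  rw [det_eval_matrixOfPolynomials_eq_det_vandermonde y
    (fun i => ∏ t ∈ range i, (Polynomial.X - Polynomial.C (c t)))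
    (fun i => natDegree_prod_range_X_sub_C c i)
    (fun i => Polynomial.monic_prod_of_monic _ _ fun t _ => Polynomial.monic_X_sub_C _),
    ← det_transpose (of fun i j => _), ← det_mul_row, ← det_mul_column]
  congr 1
  ext i j
  simp [Polynomial.eval_prod]

theorem shiftSeq_mul_pow {x : ℝ} (hx : x ≠ 0) (h : ℕ → ℝ) (i s : ℕ) :
    shiftSeq (fun r => h r * x ^ r) i s = x ^ s * ((x ^ i)⁻¹ * shiftSeq h i s) := by
  simp only [shiftSeq]
  split_ifs with his
  · rw [pow_sub₀ x hx his]
    ring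
  · rw [mul_zero, mul_zero]

theorem det_shiftSeq_mul_pow_partSeq {x : ℝ} (hx : x ≠ 0) (h : ℕ → ℝ) {N : ℕ}
    {lam : YoungDiagram} (hlam : partLength lam ≤ N) :
    (of fun i j : Fin N => shiftSeq (fun r => h r * x ^ r) i (partSeq N lam j)).det =
      x ^ lam.card * (of fun i j : Fin N => shiftSeq h i (partSeq N lam j)).det := by
  have hsum : x ^ (∑ i : Fin N, (i : ℕ)) ≠ 0 := pow_ne_zero _ hx
  simp only [shiftSeq_mul_pow hx]
  refine (det_mul_row (fun j => x ^ partSeq N lam j)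
    (of fun i j : Fin N => (x ^ (i : ℕ))⁻¹ * shiftSeq h i (partSeq N lam j))).trans ?_
  refine (congrArg _ (det_mul_column (fun i : Fin N => (x ^ (i : ℕ))⁻¹)
    (of fun i j : Fin N => shiftSeq h i (partSeq N lam j)))).trans ?_
  rw [prod_inv_distrib, prod_pow_eq_pow_sum, prod_pow_eq_pow_sum, sum_partSeq hlam, pow_add,
    mul_assoc, mul_inv_cancel_left₀ hsum]

variable {q : ℝ}

theorem inv_qFact_sub (hq : |q| < 1) {i s : ℕ} (h : i ≤ s) :
    (qFact q (s - i))⁻¹ = (∏ t ∈ range i, (1 - q ^ (s - t))) * (qFact q s)⁻¹ := by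
  induction i with
  | zero => simp
  | succ i ih =>
    have hstep : qFact q (s - i) = qFact q (s - (i + 1)) * (1 - q ^ (s - i)) := by
      rw [show s - i = s - (i + 1) + 1 by omega, qFact_succ]
    have hne : 1 - q ^ (s - i) ≠ 0 := (one_sub_pow_pos hq (by omega)).ne'
    rw [prod_range_succ, mul_right_comm, ← ih (by omega), hstep, mul_inv,
      inv_mul_cancel_right₀ hne]

theorem prod_range_pow_sub_pow {i s : ℕ} (h : i ≤ s) :
    ∏ t ∈ range i, (q ^ s - q ^ t) =
      (-1) ^ i * q ^ i.choose 2 * ∏ t ∈ range i, (1 - q ^ (s - t)) := by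
  have hfactor (t : ℕ) (ht : t ∈ range i) :
      q ^ s - q ^ t = -1 * q ^ t * (1 - q ^ (s - t)) := by
    rw [mem_range] at ht
    linear_combination -pow_mul_pow_sub q (ht.le.trans h)
  rw [prod_congr rfl hfactor, prod_mul_distrib, prod_mul_distrib, prod_const, card_range,
    prod_pow_eq_pow_sum, sum_range_id, Nat.choose_two_right]

theorem prod_range_inv_pow_sub_inv_pow (hq : q ≠ 0) {i s : ℕ} (h : i ≤ s) :
    ∏ t ∈ range i, ((q ^ s)⁻¹ - (q ^ t)⁻¹) =
      (q ^ (s * i))⁻¹ * ∏ t ∈ range i, (1 - q ^ (s - t)) := by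
  have hfactor (t : ℕ) (ht : t ∈ range i) :
      (q ^ s)⁻¹ - (q ^ t)⁻¹ = (q ^ s)⁻¹ * (1 - q ^ (s - t)) := by
    rw [mem_range] at ht
    rw [pow_sub₀ q hq (ht.le.trans h), mul_sub, mul_one,
      inv_mul_cancel_left₀ (pow_ne_zero s hq)]
  rw [prod_congr rfl hfactor, prod_mul_distrib, prod_const, card_range, inv_pow, ← pow_mul]

theorem shiftSeq_inv_qFact (hq : |q| < 1) (hq' : q ≠ 0) (i s : ℕ) :
    shiftSeq (fun r => (qFact q r)⁻¹) i s =
      (qFact q s)⁻¹ *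
        ((-1) ^ i * (q ^ i.choose 2)⁻¹ * ∏ t ∈ range i, (q ^ s - q ^ t)) := by
  rw [shiftSeq]
  split_ifs with h
  · have hsign : ((-1 : ℝ) ^ i) * (-1) ^ i = 1 := by rw [← mul_pow]; norm_num
    have hpow : (q ^ i.choose 2)⁻¹ * q ^ i.choose 2 = 1 := inv_mul_cancel₀ (pow_ne_zero _ hq')
    rw [prod_range_pow_sub_pow h, inv_qFact_sub hq h]
    linear_combination (-(∏ t ∈ range i, (1 - q ^ (s - t))) * (qFact q s)⁻¹) *
      (hsign + (-1) ^ i * (-1) ^ i * hpow)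
  · rw [prod_eq_zero (mem_range.2 (not_le.1 h)) (sub_self _), mul_zero, mul_zero]

theorem choose_two_sub_add {i s : ℕ} (h : i ≤ s) :
    (s - i).choose 2 + s * i = s.choose 2 + (i + 1).choose 2 := by
  obtain ⟨d, rfl⟩ := Nat.exists_eq_add_of_le h
  rw [Nat.add_sub_cancel_left]
  qify
  simp only [Nat.cast_choose_two]
  push_cast
  ring

theorem shiftSeq_pow_choose_two (hq : |q| < 1) (hq' : q ≠ 0) (i s : ℕ) :
    shiftSeq (fun r => q ^ r.choose 2 * (qFact q r)⁻¹) i s =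
      (q ^ s.choose 2 * (qFact q s)⁻¹) *
        (q ^ (i + 1).choose 2 * ∏ t ∈ range i, ((q ^ s)⁻¹ - (q ^ t)⁻¹)) := by
  rw [shiftSeq]
  split_ifs with h
  · have hpow : q ^ (s - i).choose 2 =
        q ^ s.choose 2 * q ^ (i + 1).choose 2 * (q ^ (s * i))⁻¹ := by
      rw [eq_mul_inv_iff_mul_eq₀ (pow_ne_zero _ hq'), ← pow_add, ← pow_add, choose_two_sub_add h]
    rw [prod_range_inv_pow_sub_inv_pow hq' h, inv_qFact_sub hq h, hpow]
    ring
  · rw [prod_eq_zero (mem_range.2 (not_le.1 h)) (sub_self _), mul_zero, mul_zero]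

variable {N : ℕ} {lam : YoungDiagram}

theorem det_shiftSeq_inv_qFact_partSeq_sq (hq : |q| < 1) (hq' : q ≠ 0)
    (hlam : partLength lam ≤ N) :
    (of fun i j : Fin N => shiftSeq (fun r => (qFact q r)⁻¹) i (partSeq N lam j)).det ^ 2 =
      hookWeight q lam ^ 2 := by
  have hfact : ∏ j, qFact q (partSeq N lam j) ≠ 0 := (prod_pos fun j _ => qFact_pos hq _).ne'
  have hpow : q ^ (∑ i ∈ range N, i.choose 2) ≠ 0 := pow_ne_zero _ hq'
  have hsign : ((-1 : ℝ) ^ (∑ i : Fin N, (i : ℕ))) ^ 2 = 1 := by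
    rw [← pow_mul, mul_comm, pow_mul, neg_one_sq, one_pow]
  simp only [shiftSeq_inv_qFact hq hq']
  rw [det_of_mul_prod_range_sub (fun j => (qFact q (partSeq N lam j))⁻¹)
      (fun i : Fin N => (-1) ^ (i : ℕ) * (q ^ (i : ℕ).choose 2)⁻¹)
      (fun j => q ^ partSeq N lam j) (fun t => q ^ t),
    mul_pow, mul_pow, det_vandermonde_partSeq_sq hq hlam, prod_mul_distrib, prod_inv_distrib,
    prod_inv_distrib, prod_pow_eq_pow_sum, prod_pow_eq_pow_sum,
    ← sum_range fun i => i.choose 2, mul_pow, hsign]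
  field_simp

theorem det_vandermonde_inv_partSeq_sq (hq : |q| < 1) (hq' : q ≠ 0) (hlam : partLength lam ≤ N) :
    (vandermonde fun j : Fin N => (q ^ partSeq N lam j)⁻¹).det ^ 2 =
      ((∏ j : Fin N, (q ^ (partSeq N lam j * j))⁻¹) *
        ((∏ c ∈ lam.cells, (1 - q ^ hookLen lam c)⁻¹) * ∏ j, qFact q (partSeq N lam j))) ^ 2 := by
  have hfactor (i j : Fin N) (hij : j ∈ Ioi i) :
      (q ^ partSeq N lam j)⁻¹ - (q ^ partSeq N lam i)⁻¹ =
        (q ^ partSeq N lam j)⁻¹ * (1 - q ^ (partSeq N lam j - partSeq N lam i)) := by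
    rw [pow_sub₀ q hq' (strictMono_partSeq N lam (mem_Ioi.1 hij)).le, mul_sub, mul_one,
      inv_mul_cancel_left₀ (pow_ne_zero _ hq')]
  have hswap : ∏ i : Fin N, ∏ j ∈ Ioi i, (q ^ partSeq N lam j)⁻¹ =
      ∏ j : Fin N, ∏ _i ∈ Iio j, (q ^ partSeq N lam j)⁻¹ := prod_comm' (by simp)
  rw [← prod_one_sub_pow_partSeq_sub hq hlam, det_vandermonde,
    prod_congr rfl fun i _ => prod_congr rfl (hfactor i)]
  simp only [prod_mul_distrib]
  rw [hswap]
  simp only [prod_const, Fin.card_Iio, inv_pow, ← pow_mul]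

theorem hookWeight_transpose (q : ℝ) (lam : YoungDiagram) :
    hookWeight q lam.transpose =
      q ^ bStat lam.transpose * ∏ c ∈ lam.cells, (1 - q ^ hookLen lam c)⁻¹ := by
  rw [hookWeight, prod_cells_transpose]
  simp only [hookLen_transpose, Prod.swap_swap]

theorem prod_pow_choose_two_partSeq (hq : q ≠ 0) (hlam : partLength lam ≤ N) :
    (∏ j : Fin N, q ^ (partSeq N lam j).choose 2) * (∏ j : Fin N, q ^ ((j : ℕ) + 1).choose 2) *
        (∏ j : Fin N, (q ^ (partSeq N lam j * j))⁻¹) = q ^ bStat lam.transpose := by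
  rw [bStat_transpose_eq_sum_choose hlam, ← sum_range_reflect, sum_range, ← prod_pow_eq_pow_sum,
    ← prod_mul_distrib, ← prod_mul_distrib]
  refine prod_congr rfl fun j _ => ?_
  have hchoose := choose_two_sub_add (i := j) (s := partSeq N lam j) (Nat.le_add_left _ _)
  rw [← pow_add, ← hchoose, pow_add, mul_inv_cancel_right₀ (pow_ne_zero _ hq), partSeq,
    Nat.add_sub_cancel]

theorem det_shiftSeq_pow_choose_two_partSeq_sq (hq : |q| < 1) (hq' : q ≠ 0)
    (hlam : partLength lam ≤ N) :
    (of fun i j : Fin N =>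
      shiftSeq (fun r => q ^ r.choose 2 * (qFact q r)⁻¹) i (partSeq N lam j)).det ^ 2 =
      hookWeight q lam.transpose ^ 2 := by
  have hfact : ∏ j, qFact q (partSeq N lam j) ≠ 0 := (prod_pos fun j _ => qFact_pos hq _).ne'
  simp only [shiftSeq_pow_choose_two hq hq']
  rw [det_of_mul_prod_range_sub
      (fun j => q ^ (partSeq N lam j).choose 2 * (qFact q (partSeq N lam j))⁻¹)
      (fun i : Fin N => q ^ ((i : ℕ) + 1).choose 2)
      (fun j => (q ^ partSeq N lam j)⁻¹) (fun t => (q ^ t)⁻¹),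
    mul_pow, mul_pow, det_vandermonde_inv_partSeq_sq hq hq' hlam, hookWeight_transpose,
    ← prod_pow_choose_two_partSeq hq' hlam, prod_mul_distrib, prod_inv_distrib (f := fun j =>
    qFact q (partSeq N lam j))]
  field_simp

end ShiftSeqDeterminants

section CauchyDeterminant

open Finset Matrix Polynomial

theorem vandermonde_mul_of_coeff {R : Type*} [CommRing R] {n : ℕ} {P : Fin n → R[X]}
    (hP : ∀ j, (P j).natDegree < n) (y : Fin n → R) :
    (vandermonde y * of fun (k : Fin n) j => (P j).coeff k) = of fun i j => (P j).eval (y i) := by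
  ext i j
  rw [mul_apply, of_apply, eval_eq_sum_range' (hP j), sum_range]
  exact sum_congr rfl fun k _ => by rw [of_apply, vandermonde_apply, mul_comm]

variable {K : Type*} [Field K] {n : ℕ}

/-- The common denominator `∏ l, (1 - b l * X)` of the entries of a row of the Cauchy matrix, with
the factor of column `j` removed. -/
noncomputable def cauchyNumerator (b : Fin n → K) (j : Fin n) : K[X] :=
  ∏ l ∈ ({j}ᶜ : Finset (Fin n)), (1 - C (b l) * X)

theorem natDegree_cauchyNumerator_lt (b : Fin n → K) (j : Fin n) :
    (cauchyNumerator b j).natDegree < n := by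
  have hle : (cauchyNumerator b j).natDegree ≤ ∑ l ∈ ({j}ᶜ : Finset (Fin n)), 1 := by
    refine (natDegree_prod_le _ _).trans (sum_le_sum fun l _ => ?_)
    compute_degree
  have hn := j.pos
  rw [sum_const, smul_eq_mul, mul_one, card_compl, card_singleton, Fintype.card_fin] at hle
  omega

theorem eval_cauchyNumerator (b : Fin n → K) (j : Fin n) (t : K) :
    (cauchyNumerator b j).eval t = ∏ l ∈ ({j}ᶜ : Finset (Fin n)), (1 - b l * t) := by
  simp [cauchyNumerator, eval_prod]

theorem eval_cauchyNumerator_inv {b : Fin n → K} (hb : ∀ j, b j ≠ 0) :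
    (of fun i j => (cauchyNumerator b j).eval (b i)⁻¹) =
      diagonal fun j => ∏ l ∈ ({j}ᶜ : Finset (Fin n)), (1 - b l * (b j)⁻¹) := by
  ext i j
  rw [of_apply, eval_cauchyNumerator, diagonal_apply]
  split_ifs with hij
  · rw [hij]
  · exact prod_eq_zero (i := i) (by simpa using hij) (by rw [mul_inv_cancel₀ (hb i), sub_self])

theorem det_coeff_cauchyNumerator {b : Fin n → K} (hb : ∀ j, b j ≠ 0)
    (hinj : Function.Injective b) :
    (of fun (k : Fin n) j => (cauchyNumerator b j).coeff k).det = (vandermonde b).det := by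
  have hne : (vandermonde fun i => (b i)⁻¹).det ≠ 0 :=
    det_vandermonde_ne_zero_iff.2 fun i j hij => hinj (inv_injective hij)
  refine mul_left_cancel₀ hne ?_
  rw [← det_mul, vandermonde_mul_of_coeff (natDegree_cauchyNumerator_lt b),
    eval_cauchyNumerator_inv hb, det_diagonal,
    ← prod_prod_Ioi_mul_eq_prod_prod_off_diag (fun l j => 1 - b l * (b j)⁻¹), det_vandermonde,
    det_vandermonde, ← prod_mul_distrib]
  refine prod_congr rfl fun i _ => ?_
  rw [← prod_mul_distrib]
  refine prod_congr rfl fun j _ => ?_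
  have hi := hb i
  have hj := hb j
  field_simp

theorem det_inv_one_sub_mul (a : Fin n → K) {b : Fin n → K} (hb : ∀ j, b j ≠ 0)
    (hinj : Function.Injective b) (h : ∀ i j, 1 - a i * b j ≠ 0) :
    (of fun i j => (1 - a i * b j)⁻¹).det * ∏ i, ∏ j, (1 - a i * b j) =
      (vandermonde a).det * (vandermonde b).det := by
  rw [← det_coeff_cauchyNumerator hb hinj, ← det_mul,
    vandermonde_mul_of_coeff (natDegree_cauchyNumerator_lt b), mul_comm, ← det_mul_column]
  congr 1
  ext i j
  rw [of_apply, of_apply, of_apply, eval_cauchyNumerator,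
    Fintype.prod_eq_mul_prod_compl j fun l => 1 - a i * b l, mul_right_comm,
    mul_inv_cancel₀ (h i j), one_mul]
  simp only [mul_comm]

end CauchyDeterminant

section CauchyIdentity

open Finset Matrix

theorem rowLen_bot (i : ℕ) : (⊥ : YoungDiagram).rowLen i = 0 := by
  by_contra h
  exact YoungDiagram.notMem_bot _ (YoungDiagram.mem_iff_lt_rowLen.2 (Nat.pos_of_ne_zero h))

theorem partLength_bot : partLength ⊥ = 0 := by
  by_contra h
  exact YoungDiagram.notMem_bot _ (YoungDiagram.mem_iff_lt_colLen.2 (Nat.pos_of_ne_zero h))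

theorem partSeq_bot (N : ℕ) (j : Fin N) : partSeq N ⊥ j = j := by
  rw [partSeq, rowLen_bot, zero_add]

theorem hookWeight_bot (q : ℝ) : hookWeight q ⊥ = 1 := by
  simp [hookWeight, bStat, partLength_bot]

/-- The ratio of the Schur function `s_λ(1, q, …, q ^ (N - 1))` to `s_λ(1, q, q², …)`, written as
`∏ⱼ (q;q)_{sⱼ} / (q;q)_j` for the sequence `s` of `λ`. -/
noncomputable def qFactRatio (q : ℝ) (N : ℕ) (lam : YoungDiagram) : ℝ :=
  ∏ j : Fin N, qFact q (partSeq N lam j) / qFact q j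

variable {q x : ℝ} {N : ℕ} {lam : YoungDiagram}

theorem det_mul_pow_partSeq_sq (hq : |q| < 1) (x : ℝ) (hlam : partLength lam ≤ N) :
    (of fun i j : Fin N => (x * q ^ (i : ℕ)) ^ partSeq N lam j).det ^ 2 =
      (x ^ (lam.card + ∑ j : Fin N, (j : ℕ)) * (q ^ (∑ i ∈ range N, i.choose 2) *
        hookWeight q lam * ∏ j, qFact q (partSeq N lam j))) ^ 2 := by
  have hfactor : (of fun i j : Fin N => (x * q ^ (i : ℕ)) ^ partSeq N lam j) =
      of fun i j : Fin N => x ^ partSeq N lam j *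
        (vandermonde fun i : Fin N => q ^ partSeq N lam i)ᵀ i j := by
    ext i j
    simp only [vandermonde_apply, of_apply, transpose_apply, mul_pow, ← pow_mul, mul_comm]
  rw [hfactor, det_mul_row, mul_pow, det_transpose, det_vandermonde_partSeq_sq hq hlam,
    prod_pow_eq_pow_sum, sum_partSeq hlam, ← mul_pow]

theorem det_mul_pow_partSeq_sq_eq_vandermonde (hq : |q| < 1) (x : ℝ) (hlam : partLength lam ≤ N) :
    (of fun i j : Fin N => (x * q ^ (i : ℕ)) ^ partSeq N lam j).det ^ 2 =
      (vandermonde fun i : Fin N => x * q ^ (i : ℕ)).det ^ 2 *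
        ((x ^ lam.card * hookWeight q lam) ^ 2 * qFactRatio q N lam ^ 2) := by
  have hfact : ∏ j : Fin N, qFact q j ≠ 0 := (prod_pos fun j _ => qFact_pos hq _).ne'
  have hbot := det_mul_pow_partSeq_sq (lam := ⊥) (N := N) hq x (by simp [partLength_bot])
  simp only [partSeq_bot, hookWeight_bot, YoungDiagram.card, YoungDiagram.cells_bot, card_empty,
    zero_add] at hbot
  change (vandermonde fun i : Fin N => x * q ^ (i : ℕ)).det ^ 2 = _ at hbot
  rw [hbot, det_mul_pow_partSeq_sq hq x hlam, qFactRatio, prod_div_distrib, pow_add]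
  field_simp

theorem det_vandermonde_mul_pow_ne_zero (hq : |q| < 1) (hq' : q ≠ 0) (hx : x ≠ 0) :
    (vandermonde fun i : Fin N => x * q ^ (i : ℕ)).det ≠ 0 := by
  refine det_vandermonde_ne_zero_iff.2 fun i j hij => Fin.ext ?_
  have habs : |q| ^ (i : ℕ) = |q| ^ (j : ℕ) := by
    rw [← abs_pow, ← abs_pow, mul_left_cancel₀ hx hij]
  exact pow_right_injective₀ (abs_pos.2 hq') hq.ne habs

theorem hasSum_hookWeight_sq_mul_qFactRatio_sq (hq : |q| < 1) (hq' : q ≠ 0) (hx : |x| < 1)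
    (hx' : x ≠ 0) (N : ℕ) :
    HasSum (fun lam : {lam : YoungDiagram // partLength lam ≤ N} =>
      (x ^ lam.1.card * hookWeight q lam.1) ^ 2 * qFactRatio q N lam.1 ^ 2)
      (∏ i : Fin N, ∏ j : Fin N, (1 - x ^ 2 * q ^ ((i : ℕ) + j))⁻¹) := by
  have habs (i : ℕ) : |x * q ^ i| < 1 := by
    rw [abs_mul, abs_pow]
    exact mul_lt_one_of_nonneg_of_lt_one_left (abs_nonneg _) hx (pow_le_one₀ (abs_nonneg _) hq.le)
  have hnorm (i j : ℕ) : ‖(x * q ^ i) * (x * q ^ j)‖ < 1 := by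
    rw [norm_mul]
    exact mul_lt_one_of_nonneg_of_lt_one_left (norm_nonneg _) (habs i) (habs j).le
  have hgeom (i j : Fin N) : HasSum (fun s => (x * q ^ (i : ℕ)) ^ s * (x * q ^ (j : ℕ)) ^ s)
      (1 - (x * q ^ (i : ℕ)) * (x * q ^ (j : ℕ)))⁻¹ := by
    simp only [← mul_pow]
    exact hasSum_geometric_of_norm_lt_one (hnorm i j)
  have hne (i j : Fin N) : 1 - (x * q ^ (i : ℕ)) * (x * q ^ (j : ℕ)) ≠ 0 :=
    sub_ne_zero.2 fun h => by simpa [← h] using hnorm i j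
  have hvdm := det_vandermonde_mul_pow_ne_zero (N := N) hq hq' hx'
  have hcauchy := det_inv_one_sub_mul (fun i : Fin N => x * q ^ (i : ℕ))
    (fun i => mul_ne_zero hx' (pow_ne_zero _ hq')) (det_vandermonde_ne_zero_iff.1 hvdm) hne
  have hsum := hasSum_det_sq_partSeq fun i j => (hgeom i j).summable
  simp only [(hgeom _ _).tsum_eq] at hsum
  rw [← sq, ← eq_div_iff (prod_ne_zero_iff.2 fun i _ => prod_ne_zero_iff.2 fun j _ => hne i j)]
    at hcauchy
  rw [hcauchy] at hsum
  simp only [fun lam : {lam : YoungDiagram // partLength lam ≤ N} =>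
    det_mul_pow_partSeq_sq_eq_vandermonde hq x lam.2] at hsum
  have hprod : ∏ i : Fin N, ∏ j : Fin N, (1 - x ^ 2 * q ^ ((i : ℕ) + j))⁻¹ =
      (∏ i : Fin N, ∏ j : Fin N, (1 - (x * q ^ (i : ℕ)) * (x * q ^ (j : ℕ))))⁻¹ := by
    simp only [← prod_inv_distrib]
    exact prod_congr rfl fun i _ => prod_congr rfl fun j _ => by ring
  rw [hprod, ← hasSum_mul_left_iff (pow_ne_zero 2 hvdm), ← div_eq_mul_inv]
  exact hsum

end CauchyIdentity

section QFactRatio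

open Finset Filter Topology

variable {q : ℝ}

theorem antitone_qFact (hq₀ : 0 ≤ q) (hq₁ : q < 1) : Antitone (qFact q) := by
  refine antitone_nat_of_succ_le fun n => ?_
  rw [qFact_succ]
  exact mul_le_of_le_one_right (qFact_pos (by rwa [abs_of_nonneg hq₀]) n).le
    (sub_le_self _ (pow_nonneg hq₀ _))

theorem qFactRatio_nonneg (hq : |q| < 1) (N : ℕ) (lam : YoungDiagram) : 0 ≤ qFactRatio q N lam :=
  prod_nonneg fun _ _ => div_nonneg (qFact_pos hq _).le (qFact_pos hq _).le

theorem qFactRatio_le_one (hq₀ : 0 ≤ q) (hq₁ : q < 1) (N : ℕ) (lam : YoungDiagram) :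
    qFactRatio q N lam ≤ 1 := by
  have hq : |q| < 1 := by rwa [abs_of_nonneg hq₀]
  refine prod_le_one (fun _ _ => div_nonneg (qFact_pos hq _).le (qFact_pos hq _).le) fun j _ => ?_
  rw [div_le_one (qFact_pos hq _)]
  exact antitone_qFact hq₀ hq₁ (Nat.le_add_left _ _)

theorem tendsto_qFact_div (hq : |q| < 1) (k : ℕ) :
    Tendsto (fun n => qFact q (k + n) / qFact q n) atTop (𝓝 1) := by
  induction k with
  | zero =>
    refine tendsto_const_nhds.congr fun n => ?_
    rw [zero_add, div_self (qFact_pos hq n).ne']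
  | succ k ih =>
    have hfactor : Tendsto (fun n : ℕ => 1 - q ^ (n + (k + 1))) atTop (𝓝 (1 - 0)) :=
      tendsto_const_nhds.sub ((tendsto_add_atTop_iff_nat (k + 1)).2
        (tendsto_pow_atTop_nhds_zero_of_abs_lt_one hq))
    have hmul := ih.mul hfactor
    rw [sub_zero, mul_one] at hmul
    refine hmul.congr fun n => ?_
    rw [show k + 1 + n = k + n + 1 by ring, qFact_succ, show n + (k + 1) = k + n + 1 by ring]
    ring

theorem qFactRatio_eq_prod_range (hq : |q| < 1) {N l : ℕ} {lam : YoungDiagram}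
    (hlam : partLength lam ≤ l) (hl : l ≤ N) :
    qFactRatio q N lam =
      ∏ i ∈ range l, qFact q (lam.rowLen i + (N - 1 - i)) / qFact q (N - 1 - i) := by
  have htail : ∏ i ∈ range l, qFact q (lam.rowLen i + (N - 1 - i)) / qFact q (N - 1 - i) =
      ∏ i ∈ range N, qFact q (lam.rowLen i + (N - 1 - i)) / qFact q (N - 1 - i) := by
    refine prod_subset (range_subset_range.2 hl) fun i _ hi => ?_
    rw [rowLen_eq_zero_of_partLength_le (hlam.trans (by simpa using hi)), zero_add,
      div_self (qFact_pos hq _).ne']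
  rw [htail, ← prod_range_reflect, prod_range]
  refine prod_congr rfl fun j _ => ?_
  rw [Nat.sub_sub_self (Nat.le_sub_one_of_lt j.2), partSeq]

theorem tendsto_qFactRatio (hq : |q| < 1) (lam : YoungDiagram) :
    Tendsto (fun N => qFactRatio q N lam) atTop (𝓝 1) := by
  have hprod : Tendsto (fun N => ∏ i ∈ range (partLength lam),
      qFact q (lam.rowLen i + (N - 1 - i)) / qFact q (N - 1 - i)) atTop
      (𝓝 (∏ _i ∈ range (partLength lam), 1)) := by
    refine tendsto_finsetProd _ fun i _ => (tendsto_qFact_div hq (lam.rowLen i)).comp ?_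
    simpa only [Nat.sub_sub] using tendsto_sub_atTop_nat (1 + i)
  rw [prod_const_one] at hprod
  refine hprod.congr' ?_
  filter_upwards [eventually_ge_atTop (partLength lam)] with N hN
  exact (qFactRatio_eq_prod_range hq le_rfl hN).symm

end QFactRatio

section MacMahon

open Finset Filter Topology

variable {q : ℝ}

theorem multipliable_inv_one_sub_mul_pow_add {y : ℝ} (hy₀ : 0 ≤ y) (hy₁ : y < 1) (hq₀ : 0 ≤ q)
    (hq₁ : q < 1) : Multipliable fun p : ℕ × ℕ => (1 - y * q ^ (p.1 + p.2))⁻¹ := by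
  have hgeom : Summable fun p : ℕ × ℕ => (1 - y)⁻¹ * (q ^ p.1 * q ^ p.2) :=
    ((summable_geometric_of_lt_one hq₀ hq₁).mul_of_nonneg (summable_geometric_of_lt_one hq₀ hq₁)
      (fun n => pow_nonneg hq₀ n) (fun n => pow_nonneg hq₀ n)).mul_left _
  suffices h : Summable fun p : ℕ × ℕ => ‖(1 - y * q ^ (p.1 + p.2))⁻¹ - 1‖ by
    simpa only [add_sub_cancel] using multipliable_one_add_of_summable h
  refine hgeom.of_nonneg_of_le (fun _ => norm_nonneg _) fun p => ?_
  have hpow : 0 ≤ q ^ (p.1 + p.2) := pow_nonneg hq₀ _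
  have hle : y * q ^ (p.1 + p.2) ≤ y := mul_le_of_le_one_right hy₀ (pow_le_one₀ hq₀ hq₁.le)
  have hpos : 0 < 1 - y * q ^ (p.1 + p.2) := by linarith
  have hsub : (1 - y * q ^ (p.1 + p.2))⁻¹ - 1 =
      (1 - y * q ^ (p.1 + p.2))⁻¹ * (y * q ^ (p.1 + p.2)) := by
    field_simp
    ring
  rw [hsub, Real.norm_eq_abs, abs_of_nonneg (by positivity), ← pow_add]
  exact mul_le_mul (inv_anti₀ (by linarith) (by linarith)) (mul_le_of_le_one_left hpow hy₁.le)
    (by positivity) (inv_nonneg.2 (by linarith))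

theorem hasProd_inv_one_sub_mul_pow_add {ξ : ℝ} (hq₀ : 0 ≤ q) (hq₁ : q < 1)
    (hξq : ξ ^ 2 * q < 1) :
    HasProd (fun p : ℕ × ℕ => (1 - ξ ^ 2 * q * q ^ (p.1 + p.2))⁻¹) (macMahon ξ q) := by
  have hmul := (multipliable_inv_one_sub_mul_pow_add (by positivity) hξq hq₀ hq₁).hasProd
  suffices h : HasProd (fun n => 1 / (1 - ξ ^ 2 * q ^ (n + 1)) ^ (n + 1))
      (∏' p : ℕ × ℕ, (1 - ξ ^ 2 * q * q ^ (p.1 + p.2))⁻¹) by rwa [macMahon, h.tprod_eq]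
  refine ((HasAntidiagonal.sigmaAntidiagonalEquivProd (A := ℕ)).hasProd_iff.2 hmul).sigma
    fun n => ?_
  have hfiber (c : antidiagonal n) :
      (1 - ξ ^ 2 * q * q ^ ((c : ℕ × ℕ).1 + (c : ℕ × ℕ).2))⁻¹ = (1 - ξ ^ 2 * q ^ (n + 1))⁻¹ := by
    rw [mem_antidiagonal.1 c.2, mul_assoc, ← pow_succ']
  have hcard : 1 / (1 - ξ ^ 2 * q ^ (n + 1)) ^ (n + 1) =
      ∏ c : antidiagonal n, (1 - ξ ^ 2 * q * q ^ ((c : ℕ × ℕ).1 + (c : ℕ × ℕ).2))⁻¹ := by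
    rw [prod_congr rfl fun c _ => hfiber c, prod_const, card_univ, Fintype.card_coe,
      Nat.card_antidiagonal, inv_pow, one_div]
  rw [hcard]
  exact hasProd_fintype _

theorem tendsto_prod_macMahon {ξ : ℝ} (hq₀ : 0 ≤ q) (hq₁ : q < 1) (hξq : ξ ^ 2 * q < 1) :
    Tendsto (fun N => ∏ i : Fin N, ∏ j : Fin N, (1 - ξ ^ 2 * q * q ^ ((i : ℕ) + j))⁻¹) atTop
      (𝓝 (macMahon ξ q)) := by
  have hbox : Tendsto (fun N : ℕ => range N ×ˢ range N) atTop atTop := by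
    refine tendsto_atTop_finset_of_monotone (fun a b hab => ?_) fun p => ?_
    · exact product_subset_product (range_subset_range.2 hab) (range_subset_range.2 hab)
    · exact ⟨p.1 + p.2 + 1, by rw [mem_product, mem_range, mem_range]; omega⟩
  refine (Tendsto.comp (hasProd_inv_one_sub_mul_pow_add hq₀ hq₁ hξq) hbox).congr fun N => ?_
  simp only [Function.comp, prod_product, prod_range]

end MacMahon

section TotalMass

open Finset Filter Topology

theorem hasSum_of_tendsto_hasSum_truncation {α : Type*} {w : α → ℝ} {r : ℕ → α → ℝ} {l : α → ℕ}
    {c : ℕ → ℝ} {C : ℝ} (hw : ∀ a, 0 ≤ w a) (hr₀ : ∀ N a, 0 ≤ r N a) (hr₁ : ∀ N a, r N a ≤ 1)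
    (hr : ∀ a, Tendsto (fun N => r N a) atTop (𝓝 1))
    (hc : ∀ N, HasSum (fun a : {a // l a ≤ N} => w a * r N a) (c N))
    (hC : Tendsto c atTop (𝓝 C)) : HasSum w C := by
  have hle (u : Finset α) : ∑ a ∈ u, w a ≤ C := by
    have hlim : Tendsto (fun N => ∑ a ∈ u, w a * r N a) atTop (𝓝 (∑ a ∈ u, w a * 1)) :=
      tendsto_finsetSum _ fun a _ => (hr a).const_mul _
    simp only [mul_one] at hlim
    refine le_of_tendsto_of_tendsto hlim hC ?_
    filter_upwards [eventually_ge_atTop (u.sup l)] with N hN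
    have hpartial := sum_le_hasSum (u.subtype fun a => l a ≤ N)
      (fun _ _ => mul_nonneg (hw _) (hr₀ _ _)) (hc N)
    rwa [sum_subtype_of_mem (fun a => w a * r N a) fun a ha => (le_sup ha).trans hN] at hpartial
  have hsum : Summable w := summable_of_sum_le hw hle
  have hge : C ≤ ∑' a, w a := by
    refine le_of_tendsto' hC fun N => ?_
    have hinj : Function.Injective fun a : {a // l a ≤ N} => (a : α) := Subtype.val_injective
    refine (hasSum_le (fun a => ?_) (hc N) (hsum.comp_injective hinj).hasSum).trans
      (tsum_comp_le_tsum_of_inj hsum hw hinj)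
    exact mul_le_of_le_one_right (hw a) (hr₁ N a)
  rw [← le_antisymm (hsum.tsum_le_of_sum_le hle) hge]
  exact hsum.hasSum

theorem hasSum_hookWeight_sq {ξ q : ℝ} (hq₀ : 0 < q) (hq₁ : q < 1) (hξ : ξ ≠ 0)
    (hξq : |ξ| * √q < 1) :
    HasSum (fun lam : YoungDiagram => ((ξ * √q) ^ lam.card * hookWeight q lam) ^ 2)
      (macMahon ξ q) := by
  have hq : |q| < 1 := by rwa [abs_of_pos hq₀]
  have hx : |ξ * √q| < 1 := by rwa [abs_mul, abs_of_nonneg (Real.sqrt_nonneg q)]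
  have hx' : ξ * √q ≠ 0 := mul_ne_zero hξ (Real.sqrt_pos.2 hq₀).ne'
  have hsq : (ξ * √q) ^ 2 = ξ ^ 2 * q := by rw [mul_pow, Real.sq_sqrt hq₀.le]
  have hlim := tendsto_prod_macMahon hq₀.le hq₁ (hsq ▸ (sq_lt_one_iff_abs_lt_one _).2 hx)
  rw [← hsq] at hlim
  exact hasSum_of_tendsto_hasSum_truncation (fun _ => sq_nonneg _) (fun _ _ => sq_nonneg _)
    (fun N lam => pow_le_one₀ (qFactRatio_nonneg hq N lam) (qFactRatio_le_one hq₀.le hq₁ N lam))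
    (fun lam => by simpa only [one_pow] using (tendsto_qFactRatio hq lam).pow 2)
    (hasSum_hookWeight_sq_mul_qFactRatio_sq hq hq₀.ne' hx hx') hlim

end TotalMass

section PlancherelWeight

variable {ξ q : ℝ}

/-- The mass of `λ` under the squared type q-Plancherel measure before normalization, written as
the square of the Schur function `s_λ` at `(x, x q, x q², …)` with `x = ξ q^{1/2}`. -/
noncomputable def plancherelWeight (ξ q : ℝ) (lam : YoungDiagram) : ℝ :=
  ((ξ * √q) ^ lam.card * hookWeight q lam) ^ 2

theorem plancherelWeight_nonneg (ξ q : ℝ) (lam : YoungDiagram) : 0 ≤ plancherelWeight ξ q lam :=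
  sq_nonneg _

theorem plancherelWeight_bot (ξ q : ℝ) : plancherelWeight ξ q ⊥ = 1 := by
  simp [plancherelWeight, hookWeight_bot, YoungDiagram.card]

theorem plancherelWeight_eq_zero (hx : ξ * √q = 0) {lam : YoungDiagram} (hlam : lam ≠ ⊥) :
    plancherelWeight ξ q lam = 0 := by
  have hcard : lam.card ≠ 0 := fun h => hlam (YoungDiagram.ext (Finset.card_eq_zero.1 h))
  rw [plancherelWeight, hx, zero_pow hcard, zero_mul, zero_pow two_ne_zero]

theorem tsum_plancherelWeight_eq_one (hx : ξ * √q = 0) {l : YoungDiagram → ℕ} (hl : l ⊥ = 0)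
    (N : ℕ) : ∑' lam : {lam // l lam ≤ N}, plancherelWeight ξ q lam = 1 := by
  rw [tsum_eq_single ⟨⊥, by rw [hl]; exact Nat.zero_le N⟩
    fun lam hlam => plancherelWeight_eq_zero hx fun h => hlam (Subtype.ext h)]
  exact plancherelWeight_bot ξ q

theorem hasSum_plancherelWeight (hq₀ : 0 ≤ q) (hq₁ : q < 1) (hξq : |ξ| * √q < 1) :
    HasSum (plancherelWeight ξ q) (macMahon ξ q) := by
  rcases eq_or_ne (ξ * √q) 0 with hx | hx
  · have hzero : ξ = 0 ∨ q = 0 := by simpa [Real.sqrt_eq_zero hq₀] using hx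
    have hmac : macMahon ξ q = 1 := by rcases hzero with rfl | rfl <;> simp [macMahon]
    rw [hmac, ← plancherelWeight_bot ξ q]
    exact hasSum_single ⊥ fun lam hlam => plancherelWeight_eq_zero hx hlam
  · have hξ := left_ne_zero_of_mul hx
    have hq : q ≠ 0 := fun h => right_ne_zero_of_mul hx (by rw [h, Real.sqrt_zero])
    exact hasSum_hookWeight_sq (hq₀.lt_of_ne' hq) hq₁ hξ hξq

theorem macMahon_pos (hq₀ : 0 ≤ q) (hq₁ : q < 1) (hξq : |ξ| * √q < 1) : 0 < macMahon ξ q := by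
  have hle := le_hasSum (hasSum_plancherelWeight hq₀ hq₁ hξq) ⊥
    fun lam _ => plancherelWeight_nonneg ξ q lam
  rw [plancherelWeight_bot] at hle
  exact one_pos.trans_le hle

theorem qPlancherelMass_eq_mul_plancherelWeight (hq : 0 ≤ q) (lam : YoungDiagram) :
    qPlancherelMass ξ q lam = (macMahon ξ q)⁻¹ * plancherelWeight ξ q lam := by
  have hsq : ξ ^ 2 * q = (ξ * √q) ^ 2 := by rw [mul_pow, Real.sq_sqrt hq]
  rw [qPlancherelMass, plancherelWeight, hookWeight, hsq]
  simp only [one_div, Finset.prod_inv_distrib, Finset.prod_pow]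
  ring

theorem qPlancherelMass_nonneg (hq₀ : 0 ≤ q) (hq₁ : q < 1) (hξq : |ξ| * √q < 1)
    (lam : YoungDiagram) : 0 ≤ qPlancherelMass ξ q lam := by
  rw [qPlancherelMass_eq_mul_plancherelWeight hq₀]
  exact mul_nonneg (inv_nonneg.2 (macMahon_pos hq₀ hq₁ hξq).le) (plancherelWeight_nonneg ξ q lam)

theorem hasSum_qPlancherelMass (hq₀ : 0 ≤ q) (hq₁ : q < 1) (hξq : |ξ| * √q < 1) :
    HasSum (qPlancherelMass ξ q) 1 := by
  have hsum := (hasSum_plancherelWeight hq₀ hq₁ hξq).mul_left (macMahon ξ q)⁻¹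
  rw [inv_mul_cancel₀ (macMahon_pos hq₀ hq₁ hξq).ne'] at hsum
  exact hsum.congr_fun (qPlancherelMass_eq_mul_plancherelWeight hq₀)

end PlancherelWeight

section Measure

open MeasureTheory Filter Topology

variable {ξ q : ℝ}

theorem qPlancherel_apply (ξ q : ℝ) (S : Set YoungDiagram) :
    qPlancherel ξ q S = ∑' lam, ENNReal.ofReal (S.indicator (qPlancherelMass ξ q) lam) := by
  rw [qPlancherel, Measure.sum_apply _ MeasurableSpace.measurableSet_top]
  refine tsum_congr fun lam => ?_
  rw [Measure.smul_apply, Measure.dirac_apply' _ MeasurableSpace.measurableSet_top, smul_eq_mul]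
  by_cases h : lam ∈ S <;> simp [h]

theorem isProbabilityMeasure_qPlancherel (hq₀ : 0 ≤ q) (hq₁ : q < 1) (hξq : |ξ| * √q < 1) :
    IsProbabilityMeasure (qPlancherel ξ q) := by
  have hsum := hasSum_qPlancherelMass hq₀ hq₁ hξq
  refine ⟨?_⟩
  rw [qPlancherel_apply, Set.indicator_univ,
    ← ENNReal.ofReal_tsum_of_nonneg (qPlancherelMass_nonneg hq₀ hq₁ hξq) hsum.summable,
    hsum.tsum_eq, ENNReal.ofReal_one]

theorem qPlancherel_real_eq_tsum_div (hq₀ : 0 ≤ q) (hq₁ : q < 1) (hξq : |ξ| * √q < 1)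
    (S : Set YoungDiagram) :
    (qPlancherel ξ q).real S = (∑' lam : S, plancherelWeight ξ q lam) / macMahon ξ q := by
  have hnonneg (lam : YoungDiagram) : 0 ≤ S.indicator (qPlancherelMass ξ q) lam :=
    Set.indicator_nonneg (fun lam _ => qPlancherelMass_nonneg hq₀ hq₁ hξq lam) lam
  have hsum := (hasSum_qPlancherelMass hq₀ hq₁ hξq).summable.indicator S
  rw [Measure.real, qPlancherel_apply, ← ENNReal.ofReal_tsum_of_nonneg hnonneg hsum,
    ENNReal.toReal_ofReal (tsum_nonneg hnonneg), ← tsum_subtype,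
    tsum_congr fun lam : S => qPlancherelMass_eq_mul_plancherelWeight hq₀ lam, tsum_mul_left,
    div_eq_inv_mul]

theorem tendsto_tsum_subtype_le {α : Type*} {w : α → ℝ} {c : ℝ} (hw₀ : ∀ a, 0 ≤ w a)
    (hw : HasSum w c) (l : α → ℕ) :
    Tendsto (fun N => ∑' a : {a // l a ≤ N}, w a) atTop (𝓝 c) := by
  have hindicator (N : ℕ) : ∑' a : {a // l a ≤ N}, w a = ∑' a, {a | l a ≤ N}.indicator w a :=
    tsum_subtype {a | l a ≤ N} w
  simp only [hindicator]
  rw [← hw.tsum_eq]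
  refine tendsto_tsum_of_dominated_convergence hw.summable (fun a => ?_)
    (Eventually.of_forall fun N a => ?_)
  · refine tendsto_const_nhds.congr' ?_
    filter_upwards [eventually_ge_atTop (l a)] with N hN
    exact (Set.indicator_of_mem (s := {a | l a ≤ N}) hN w).symm
  · rw [Real.norm_eq_abs, abs_of_nonneg (Set.indicator_nonneg (fun _ _ => hw₀ _) a)]
    exact Set.indicator_le_self' (fun _ _ => hw₀ _) a

end Measure

section Expansion

open MeasureTheory Matrix

theorem star_eq_of_hasSum_mul_pow {h : ℕ → ℝ} {z a b : ℂ} (hz : ‖z‖ = 1)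
    (ha : HasSum (fun r => (h r : ℂ) * z ^ r) a) (hb : HasSum (fun r => (h r : ℂ) * z⁻¹ ^ r) b) :
    star a = b := by
  have hstar : star z = z⁻¹ := by
    rw [Complex.inv_def, Complex.normSq_eq_norm_sq, hz]
    simp
  refine HasSum.unique ?_ hb
  simpa only [star_mul', star_pow, hstar, Complex.star_def, Complex.conj_ofReal] using ha.star

theorem integral_det_matrixFun_eq_tsum {N : ℕ} {h : ℕ → ℝ} (h₀ : h 0 ≠ 0) {f F : ℂ → ℂ}
    (hF : ∀ z, ‖z‖ = 1 → HasSum (fun r => (h r : ℂ) * z ^ r) (F z))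
    (hf : ∀ z, ‖z‖ = 1 → f z = F z * F z⁻¹) :
    ∫ U : unitaryGroup (Fin N) ℂ, (matrixFun f (U : Matrix (Fin N) (Fin N) ℂ)).det ∂haarU N =
      ((∑' lam : {lam : YoungDiagram // partLength lam ≤ N},
        (of fun i j : Fin N => shiftSeq h i (partSeq N lam.1 j)).det ^ 2 : ℝ) : ℂ) := by
  have hsum : Summable fun r => |h r| := by
    simpa only [one_pow, mul_one, Complex.norm_real, Real.norm_eq_abs] using
      (hF 1 norm_one).summable.norm
  rw [(hasSum_det_sq_partSeq fun i j => summable_shiftSeq_mul hsum i j).tsum_eq]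
  refine integral_det_matrixFun hsum h₀ hF fun z hz => ?_
  rw [hf z hz, star_eq_of_hasSum_mul_pow hz (hF z hz) (hF z⁻¹ (by rw [norm_inv, hz, inv_one]))]

open scoped Matrix.Norms.L2Operator in
theorem integral_det_matrixFun_one (N : ℕ) :
    ∫ U : unitaryGroup (Fin N) ℂ,
      (matrixFun (fun _ => 1) (U : Matrix (Fin N) (Fin N) ℂ)).det ∂haarU N = 1 := by
  have hdet (U : unitaryGroup (Fin N) ℂ) :
      (matrixFun (fun _ => 1) (U : Matrix (Fin N) (Fin N) ℂ)).det = 1 := by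
    have hU : IsStarNormal (U : Matrix (Fin N) (Fin N) ℂ) :=
      ⟨(Unitary.coe_star_mul_self U).trans (Unitary.coe_mul_star_self U).symm⟩
    rw [matrixFun, cfc_const_one ℂ _ hU, det_one]
  simp [hdet]

variable {ξ q : ℝ}

theorem norm_ofReal_mul_sqrt_mul (ξ q : ℝ) (z : ℂ) : ‖(ξ : ℂ) * √q * z‖ = |ξ| * √q * ‖z‖ := by
  rw [norm_mul, norm_mul, Complex.norm_real, Complex.norm_real, Real.norm_eq_abs,
    Real.norm_of_nonneg (Real.sqrt_nonneg q)]

theorem ofReal_mul_sqrt_eq_zero (hx : ξ * √q = 0) : (ξ : ℂ) * √q = 0 := by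
  rw [← Complex.ofReal_mul, hx, Complex.ofReal_zero]

theorem qPochInf_zero (q : ℝ) : qPochInf 0 q = 1 := by simp [qPochInf]

theorem Zint_eq_tsum (hq : |q| < 1) (hξq : |ξ| * √q < 1) (N : ℕ) :
    Zint ξ q N = ((∑' lam : {lam : YoungDiagram // partLength lam ≤ N},
      plancherelWeight ξ q lam : ℝ) : ℂ) := by
  rcases eq_or_ne (ξ * √q) 0 with hx | hx
  · have hweight : weight ξ q = fun _ => 1 :=
      funext fun z => by simp [weight, ofReal_mul_sqrt_eq_zero hx, qPochInf_zero]
    rw [Zint, hweight, integral_det_matrixFun_one, tsum_plancherelWeight_eq_one hx partLength_bot,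
      Complex.ofReal_one]
  have hq' : q ≠ 0 := fun h => right_ne_zero_of_mul hx (by rw [h, Real.sqrt_zero])
  have hF (z : ℂ) (hz : ‖z‖ = 1) :
      HasSum (fun r => (((qFact q r)⁻¹ * (ξ * √q) ^ r : ℝ) : ℂ) * z ^ r)
        (qPochInf (ξ * √q * z) q)⁻¹ := by
    refine (hasSum_inv_qPochInf hq (w := ξ * √q * z)
      (by rwa [norm_ofReal_mul_sqrt_mul, hz, mul_one])).congr_fun fun r => ?_
    push_cast
    ring
  rw [Zint, integral_det_matrixFun_eq_tsum (by simp [qFact_zero]) hF fun z _ => by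
    rw [weight, mul_inv]]
  refine congrArg _ (tsum_congr fun lam => ?_)
  rw [det_shiftSeq_mul_pow_partSeq hx _ lam.2, mul_pow,
    det_shiftSeq_inv_qFact_partSeq_sq hq hq' lam.2, ← mul_pow, plancherelWeight]

theorem tsum_plancherelWeight_largestPart_le (ξ q : ℝ) (N : ℕ) :
    ∑' lam : {lam : YoungDiagram // largestPart lam ≤ N}, plancherelWeight ξ q lam =
      ∑' lam : {lam : YoungDiagram // partLength lam ≤ N},
        plancherelWeight ξ q (lam : YoungDiagram).transpose := by
  refine (Equiv.tsum_eq (YoungDiagram.transposeOrderIso.toEquiv.subtypeEquiv fun lam => ?_)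
    fun lam : {lam : YoungDiagram // largestPart lam ≤ N} => plancherelWeight ξ q lam).symm
  change lam.colLen 0 ≤ N ↔ lam.transpose.rowLen 0 ≤ N
  rw [YoungDiagram.rowLen_transpose]

theorem ZintCheck_eq_tsum (hq : |q| < 1) (hξq : |ξ| * √q < 1) (N : ℕ) :
    ZintCheck ξ q N = ((∑' lam : {lam : YoungDiagram // largestPart lam ≤ N},
      plancherelWeight ξ q lam : ℝ) : ℂ) := by
  rcases eq_or_ne (ξ * √q) 0 with hx | hx
  · have hweight : weightCheck ξ q = fun _ => 1 :=
      funext fun z => by simp [weightCheck, ofReal_mul_sqrt_eq_zero hx, qPochInf_zero]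
    rw [ZintCheck, hweight, integral_det_matrixFun_one,
      tsum_plancherelWeight_eq_one hx (rowLen_bot 0), Complex.ofReal_one]
  have hq' : q ≠ 0 := fun h => right_ne_zero_of_mul hx (by rw [h, Real.sqrt_zero])
  have hF (z : ℂ) (hz : ‖z‖ = 1) :
      HasSum (fun r => ((q ^ r.choose 2 * (qFact q r)⁻¹ * (ξ * √q) ^ r : ℝ) : ℂ) * z ^ r)
        (qPochInf (-(ξ * √q * z)) q) := by
    refine (hasSum_qPochInf hq (w := -(ξ * √q * z))
      (by rwa [norm_neg, norm_ofReal_mul_sqrt_mul, hz, mul_one])).congr_fun fun r => ?_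
    have hsign : (-1 : ℂ) ^ r * (-1) ^ r = 1 := by rw [← mul_pow]; norm_num
    rw [neg_pow (ξ * √q * z : ℂ), mul_pow (ξ * √q : ℂ)]
    push_cast
    linear_combination
      -((q : ℂ) ^ r.choose 2 * (qFact q r : ℂ)⁻¹ * (ξ * √q) ^ r * z ^ r) * hsign
  rw [ZintCheck, integral_det_matrixFun_eq_tsum (by simp [qFact_zero]) hF fun z _ => by
    rw [weightCheck], tsum_plancherelWeight_largestPart_le]
  refine congrArg _ (tsum_congr fun lam => ?_)
  rw [det_shiftSeq_mul_pow_partSeq hx _ lam.2, mul_pow,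
    det_shiftSeq_pow_choose_two_partSeq_sq hq hq' lam.2, ← mul_pow, plancherelWeight,
    card_transpose]

theorem weight_eq_exp_and_weightCheck_eq_exp (hq₀ : 0 < q) (hq₁ : q < 1) {z : ℂ}
    (hz : |ξ| * √q < ‖z‖) (hz' : |ξ| * √q * ‖z‖ < 1) :
    Summable (fun n : ℕ => expTerm ξ q z (n + 1)) ∧
      weight ξ q z = Complex.exp (-∑' n : ℕ, expTerm ξ q z (n + 1)) ∧
      Summable (fun n : ℕ => expTerm (-ξ) q z (n + 1)) ∧
      weightCheck ξ q z = Complex.exp (∑' n : ℕ, expTerm (-ξ) q z (n + 1)) := by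
  have hzpos : 0 < ‖z‖ := (by positivity : 0 ≤ |ξ| * √q).trans_lt hz
  have hnorm (a : ℝ) (ha : |a| = |ξ|) : ‖(a : ℂ) * √q * z‖ < 1 := by
    rwa [norm_ofReal_mul_sqrt_mul, ha]
  have hnorm' (a : ℝ) (ha : |a| = |ξ|) : ‖(a : ℂ) * √q * z⁻¹‖ < 1 := by
    rwa [norm_ofReal_mul_sqrt_mul, ha, norm_inv, ← div_eq_mul_inv, div_lt_one hzpos]
  exact ⟨(hasSum_expTerm hq₀ hq₁ (hnorm ξ rfl) (hnorm' ξ rfl)).summable,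
    weight_eq_exp hq₀ hq₁ (hnorm ξ rfl) (hnorm' ξ rfl),
    (hasSum_expTerm hq₀ hq₁ (hnorm (-ξ) (abs_neg ξ)) (hnorm' (-ξ) (abs_neg ξ))).summable,
    weightCheck_eq_exp hq₀ hq₁ (hnorm ξ rfl) (hnorm' ξ rfl)⟩

end Expansion

section Limits

open Filter Topology

variable {ξ q : ℝ}

theorem tendsto_Zint (hq₀ : 0 ≤ q) (hq₁ : q < 1) (hξq : |ξ| * √q < 1) :
    Tendsto (fun N => Zint ξ q N) atTop (𝓝 (macMahon ξ q : ℂ)) := by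
  have hq : |q| < 1 := by rwa [abs_of_nonneg hq₀]
  simp only [Zint_eq_tsum hq hξq]
  exact (Complex.continuous_ofReal.tendsto _).comp (tendsto_tsum_subtype_le
    (plancherelWeight_nonneg ξ q) (hasSum_plancherelWeight hq₀ hq₁ hξq) partLength)

theorem tendsto_ZintCheck (hq₀ : 0 ≤ q) (hq₁ : q < 1) (hξq : |ξ| * √q < 1) :
    Tendsto (fun N => ZintCheck ξ q N) atTop (𝓝 (macMahon ξ q : ℂ)) := by
  have hq : |q| < 1 := by rwa [abs_of_nonneg hq₀]
  simp only [ZintCheck_eq_tsum hq hξq]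
  exact (Complex.continuous_ofReal.tendsto _).comp (tendsto_tsum_subtype_le
    (plancherelWeight_nonneg ξ q) (hasSum_plancherelWeight hq₀ hq₁ hξq) largestPart)

end Limits

theorem proposition3_general (ξ q : ℝ) (hq₀ : 0 ≤ q) (hq₁ : q < 1) (hξq : |ξ| * √q < 1) :
    MeasureTheory.IsProbabilityMeasure (qPlancherel ξ q) ∧
    (∀ N : ℕ, (((qPlancherel ξ q).real {lam | partLength lam ≤ N} : ℝ) : ℂ) =
      Zint ξ q N / (macMahon ξ q : ℂ)) ∧
    (∀ N : ℕ, (((qPlancherel ξ q).real {lam | largestPart lam ≤ N} : ℝ) : ℂ) =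
      ZintCheck ξ q N / (macMahon ξ q : ℂ)) ∧
    Filter.Tendsto (fun N : ℕ => Zint ξ q N) Filter.atTop (nhds (macMahon ξ q : ℂ)) ∧
    Filter.Tendsto (fun N : ℕ => ZintCheck ξ q N) Filter.atTop (nhds (macMahon ξ q : ℂ)) ∧
    (0 < q → ∀ z : ℂ, |ξ| * √q < ‖z‖ → |ξ| * √q * ‖z‖ < 1 →
      Summable (fun n : ℕ => expTerm ξ q z (n + 1)) ∧
      weight ξ q z = Complex.exp (-∑' n : ℕ, expTerm ξ q z (n + 1)) ∧
      Summable (fun n : ℕ => expTerm (-ξ) q z (n + 1)) ∧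
      weightCheck ξ q z = Complex.exp (∑' n : ℕ, expTerm (-ξ) q z (n + 1))) := by
  have hq : |q| < 1 := by rwa [abs_of_nonneg hq₀]
  refine ⟨isProbabilityMeasure_qPlancherel hq₀ hq₁ hξq, fun N => ?_, fun N => ?_,
    tendsto_Zint hq₀ hq₁ hξq, tendsto_ZintCheck hq₀ hq₁ hξq,
    fun hq₀ z => weight_eq_exp_and_weightCheck_eq_exp hq₀ hq₁⟩
  · rw [qPlancherel_real_eq_tsum_div hq₀ hq₁ hξq, Zint_eq_tsum hq hξq, Complex.ofReal_div]
    rfl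
  · rw [qPlancherel_real_eq_tsum_div hq₀ hq₁ hξq, ZintCheck_eq_tsum hq hξq, Complex.ofReal_div]
    rfl

theorem proposition3 (ξ q : ℝ) (hξ₀ : 0 ≤ ξ) (hξ₁ : ξ < 1) (hq₀ : 0 ≤ q) (hq₁ : q < 1) :
    -- the squared type q-Plancherel measure is a probability measure
    MeasureTheory.IsProbabilityMeasure (qPlancherel ξ q) ∧
    -- gap probabilities as unitary matrix integrals, with `Z_∞ = Ž_∞ = M(ξ;q)`
    (∀ N : ℕ, (((qPlancherel ξ q).real {lam | partLength lam ≤ N} : ℝ) : ℂ) =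
      Zint ξ q N / (macMahon ξ q : ℂ)) ∧
    (∀ N : ℕ, (((qPlancherel ξ q).real {lam | largestPart lam ≤ N} : ℝ) : ℂ) =
      ZintCheck ξ q N / (macMahon ξ q : ℂ)) ∧
    -- `Z_∞` and `Ž_∞` are the limits of `Z_N` and `Ž_N`
    Filter.Tendsto (fun N : ℕ => Zint ξ q N) Filter.atTop (nhds (macMahon ξ q : ℂ)) ∧
    Filter.Tendsto (fun N : ℕ => ZintCheck ξ q N) Filter.atTop (nhds (macMahon ξ q : ℂ)) ∧
    -- exponential formulas for the weights (on an annulus that contains the unit circle)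
    (0 < q → ∀ z : ℂ, ξ * √q < ‖z‖ → ξ * √q * ‖z‖ < 1 →
      Summable (fun n : ℕ => expTerm ξ q z (n + 1)) ∧
      weight ξ q z = Complex.exp (-∑' n : ℕ, expTerm ξ q z (n + 1)) ∧
      Summable (fun n : ℕ => expTerm (-ξ) q z (n + 1)) ∧
      weightCheck ξ q z = Complex.exp (∑' n : ℕ, expTerm (-ξ) q z (n + 1))) := by
  have hξq : |ξ| * √q < 1 := (abs_of_nonneg hξ₀).symm ▸
    mul_lt_one_of_nonneg_of_lt_one_left hξ₀ hξ₁ (Real.sqrt_le_one.2 hq₁.le)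
  simpa only [abs_of_nonneg hξ₀] using proposition3_general ξ q hq₀ hq₁ hξq
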